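/- Let $m\ge 2$, $n\ge 1$ and $2n-1\le m$. Put $q=n-1$. **The slice in type $D$.** Realise $\mathfrak{so}_{2m}(\mathbb C)$ by the symmetric form with Gram matrix $\begin{pmatrix}0&I\\I&0\end{pmatrix}$, with root vectors $X_{e_i-e_j}=E_{i,j}-E_{m+j,m+i}$ (also used for $i=j$), and, for $i<j$, $X_{e_i+e_j}=E_{i,m+j}-E_{j,m+i}$, $X_{-e_i-e_j}=E_{m+i,j}-E_{m+j,i}$. Let $$X_q=\sum_{1\le i\le m-1,\ i\ne m-q}X_{e_i-e_{i+1}}+X_{e_{m-q-1}+e_{m-q}}+X_{e_{m-q}+e_m},$$ where the last summand is absent for $q=0$. Let $\mathcal S_q$ be the set of all $$\begin{aligned}S(a,y,z,d)=X_q&+a_1X_{e_{m-q}-e_m}-d_1X_{e_{m-q}-e_{m-q-1}}+\sum_{i=1}^{q-1}a_{q-i+1}X_{-e_{m-q+i}-e_{m-q+i+1}}+\sum_{i=1}^{q}y_iX_{-e_1-e_{m-q+i}}\\&-\sum_{j=1}^{q+1}z_jX_{e_{m-q}-e_j}+\sum_{k=1}^{m-q-1}d_{m-q-k}X_{-e_k-e_{k+1}}\end{aligned}$$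 with complex $a_1,\dots,a_q$, $y_1,\dots,y_q$, $z_1,\dots,z_{q+1}$, $d_1,\dots,d_{m-q-1}$ (the $a_1$-term is absent for $q=0$). Put $$A(t)=t^{2q}+\sum_{i=1}^{q}(-1)^ia_it^{2(q-i)},\qquad D(t)=\sum_{k=1}^{m-q-1}(-1)^{k-1}\,4d_k\,t^{2(m-q-1-k)},$$ $$B(t)=\sum_{i=1}^{q}y_it^{i-1}-t^{q}\Big(\sum_{j=1}^{q+1}(-1)^{j-1}z_jt^{j-1}+(-1)^{m-q}t^{m-q}\Big).$$ **The slice in type $B$.** Realise $\mathfrak g=\mathfrak{so}_{2m+1}(\mathbb C)$ by the Gram matrix $\mathrm{diag}\big(1,\begin{pmatrix}0&I\\I&0\end{pmatrix}\big)$, let $i:\mathfrak{so}_{2m}\to\mathfrak{so}_{2m+1}$, $i(Y)=\mathrm{diag}(0,Y)$, and let $X_{e_i}=E_{1,i+m+1}-E_{i+1,1}$, $X_{-e_i}=E_{1,i+1}-E_{i+m+1,1}$. Put $x_n=i(X_{n-1})$ and $$\mathcal S_n^B=i(\mathcal S_{n-1})+\mathcal V_n,\qquad \mathcal V_n=\Big\{\sqrt2\,a_0\,R_n-\tfrac{1}{\sqrt2}\,d_0\,X_{-e_1}\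 \Big|\ a_0,d_0\in\mathbb C\Big\},$$ where $R_n=X_{-e_{m-n+2}}$ if $n\ge2$ and $R_1=-X_{e_m}$. **Definitions.** The tangent space $T_x(\mathcal O_x)$ is the space of velocities at $s=0$ of the curves $g(s)\,x\,g(s)^{-1}$, with $g$ a holomorphic curve in $SO_{2m+1}(\mathbb C)$, $g(0)=1$. An affine subspace $\mathcal S=x+V$ of $\mathfrak g$ is transverse to the adjoint orbit of $x$ (at $x$) if $\mathfrak g=V\oplus T_x(\mathcal O_x)$. It is $\lambda$-invariant if there is a triple $H,x,N$ in $\mathfrak g$ with $[H,x]=2x$, $[H,N]=-2N$, $[x,N]=H$ such that $\mathcal S$ is preserved by $\lambda_r(Y)=r\exp(-\log(r)H/2)\,Y\exp(\log(r)H/2)$ for all $r\in\mathbb C^*$ and all values of $\log r$. **Theorem.** 1. $x_n$ is nilpotent with Jordan type (partition) $[2(m-n)+1,\,2n-1,\,1]$. 2. $\mathcal S_n^B$ is an affine subspace of $\mathfrak g$, is transverse to the adjoint orbit of $x_n$, and is $\lambda$-invariant. 3. The element $S=i(S(a,y,z,d))+\sqrt2\,a_0R_n-\tfrac1{\sqrt2}d_0X_{-e_1}$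 of $\mathcal S_n^B$ has characteristic polynomial $$\chi_S(t)=t\,a(t)\,d(t)+(-1)^m\,t\,b(t)\,b(-t),$$ where $a(t)=t^2A(t)+(-1)^na_0^2$, $\ d(t)=D(t)+(-1)^{m-n}d_0^2/t^2$, $\ b(t)=a_0d_0/t+B(t)$ (an identity of Laurent polynomials in $t$). 4. For $n=1$, assertion 2 also holds with $R_1=-X_{-e_m}$ in place of $-X_{e_m}$, and so does assertion 3 if $m$ is odd. -/

import Mathlib

noncomputable section

namespace SliceB

/-- Matrices of size `2m`; rows and columns are split into the two halves `1..m`, `m+1..2m`. -/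
abbrev MatD (m : ℕ) := Matrix (Fin m ⊕ Fin m) (Fin m ⊕ Fin m) ℂ

/-- Matrices of size `2m+1`; the first row and column come first, then a `2m × 2m` block. -/
abbrev MatB (m : ℕ) := Matrix (Unit ⊕ (Fin m ⊕ Fin m)) (Unit ⊕ (Fin m ⊕ Fin m)) ℂ

/-- The `m × m` matrix unit with 1 in the place `(i, j)`, with indices counted from 1. -/
def E (m i j : ℕ) : Matrix (Fin m) (Fin m) ℂ :=
  Matrix.of fun p q => if p.val + 1 = i ∧ q.val + 1 = j then 1 else 0

/-- The root vector `X_{e_i - e_j} = E_{i,j} - E_{m+j,m+i}`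
(for `i = j`, the diagonal matrix given by the same formula). -/
def rootPM (m i j : ℕ) : MatD m := Matrix.fromBlocks (E m i j) 0 0 (-E m j i)

/-- The root vector `X_{e_i + e_j} = E_{i,m+j} - E_{j,m+i}`. -/
def rootPP (m i j : ℕ) : MatD m := Matrix.fromBlocks 0 (E m i j - E m j i) 0 0

/-- The root vector `X_{-e_i - e_j} = E_{m+i,j} - E_{m+j,i}`. -/
def rootMM (m i j : ℕ) : MatD m := Matrix.fromBlocks 0 0 (E m i j - E m j i) 0

/-- The nilpotent element `X_q` of `so_{2m}`. The last summand is absent for `q = 0`. -/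
def nilD (m q : ℕ) : MatD m :=
  (∑ i ∈ (Finset.Icc 1 (m - 1)).filter (fun i => i ≠ m - q), rootPM m i (i + 1))
    + rootPP m (m - q - 1) (m - q)
    + (if q = 0 then 0 else rootPP m (m - q) m)

/-- The element `S(a, y, z, d)` of the slice in `so_{2m}`, for `2q + 1 ≤ m`. Only the coordinates
`a_1..a_q`, `y_1..y_q`, `z_1..z_{q+1}`, `d_1..d_{m-q-1}` occur. -/
def eltD (m q : ℕ) (a y z d : ℕ → ℂ) : MatD m :=
  nilD m q
    + (if q = 0 then 0 else a 1 • rootPM m (m - q) m)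
    - d 1 • rootPM m (m - q) (m - q - 1)
    + (∑ i ∈ Finset.Icc 1 (q - 1), a (q - i + 1) • rootMM m (m - q + i) (m - q + i + 1))
    + (∑ i ∈ Finset.Icc 1 q, y i • rootMM m 1 (m - q + i))
    - (∑ j ∈ Finset.Icc 1 (q + 1), z j • rootPM m (m - q) j)
    + (∑ k ∈ Finset.Icc 1 (m - q - 1), d (m - q - k) • rootMM m k (k + 1))

/-- The slice `S_q` in `so_{2m}`. -/
def sliceD (m q : ℕ) : Set (MatD m) := {Y | ∃ a y z d : ℕ → ℂ, Y = eltD m q a y z d}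

/-- `A(t) = t^{2q} - a_1 t^{2(q-1)} + ... + (-1)^q a_q`. -/
def polyA (q : ℕ) (a : ℕ → ℂ) (t : ℂ) : ℂ :=
  t ^ (2 * q) + ∑ i ∈ Finset.Icc 1 q, (-1) ^ i * a i * t ^ (2 * (q - i))

/-- `D(t) = 4 d_1 t^{2(m-q-2)} - 4 d_2 t^{2(m-q-3)} + ... + (-1)^{m-q} 4 d_{m-q-1}`. -/
def polyD (m q : ℕ) (d : ℕ → ℂ) (t : ℂ) : ℂ :=
  ∑ k ∈ Finset.Icc 1 (m - q - 1), (-1) ^ (k - 1) * (4 * d k) * t ^ (2 * (m - q - 1 - k))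

/-- `B(t) = y_1 + y_2 t + ... + y_q t^{q-1}
  - t^q (z_1 - z_2 t + ... + (-1)^q z_{q+1} t^q + (-1)^{m-q} t^{m-q})`. -/
def polyB (m q : ℕ) (y z : ℕ → ℂ) (t : ℂ) : ℂ :=
  (∑ i ∈ Finset.Icc 1 q, y i * t ^ (i - 1))
    - t ^ q * ((∑ j ∈ Finset.Icc 1 (q + 1), (-1) ^ (j - 1) * z j * t ^ (j - 1))
        + (-1) ^ (m - q) * t ^ (m - q))

/-- The inclusion `i : so_{2m} → so_{2m+1}`, on all matrices. -/
def incl {m : ℕ} (Y : MatD m) : MatB m := Matrix.fromBlocks 0 0 0 Y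

/-- The short root vector `X_{e_i} = E_{1,i+m+1} - E_{i+1,1}`. -/
def rootP (m i : ℕ) : MatB m :=
  Matrix.fromBlocks 0
    (Matrix.of fun _ q => Sum.elim (fun _ => 0) (fun k => if k.val + 1 = i then 1 else 0) q)
    (Matrix.of fun p _ => Sum.elim (fun k => if k.val + 1 = i then -1 else 0) (fun _ => 0) p) 0

/-- The short root vector `X_{-e_i} = E_{1,i+1} - E_{i+m+1,1}`. -/
def rootM (m i : ℕ) : MatB m :=
  Matrix.fromBlocks 0
    (Matrix.of fun _ q => Sum.elim (fun k => if k.val + 1 = i then 1 else 0) (fun _ => 0) q)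
    (Matrix.of fun p _ => Sum.elim (fun _ => 0) (fun k => if k.val + 1 = i then -1 else 0) p) 0

/-- The symmetric form on `ℂ^{2m+1}` with Gram matrix `diag(1, [[0, I], [I, 0]])`. -/
def form (m : ℕ) : MatB m := Matrix.fromBlocks 1 0 0 (LieAlgebra.Orthogonal.JD (Fin m) ℂ)

/-- The Lie algebra `so_{2m+1}`, as a space of matrices. -/
def so (m : ℕ) : Submodule ℂ (MatB m) := skewAdjointMatricesSubmodule (form m)

/-- The group `SO_{2m+1}`. -/
def SO (m : ℕ) : Set (MatB m) := {g | g.transpose * form m * g = form m ∧ g.det = 1}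

/-- The tangent space at `x` of the adjoint orbit of `x`: the space of velocities at `s = 0` of the
curves `s ↦ g(s) x g(s)⁻¹`, for holomorphic curves `g` in `SO_{2m+1}` with `g(0) = 1`. -/
def orbitTangent (m : ℕ) (x : MatB m) : Submodule ℂ (MatB m) :=
  Submodule.span ℂ {v | ∃ g : ℂ → MatB m,
    (∀ s, g s ∈ SO m) ∧ g 0 = 1 ∧
    (∀ p q, Differentiable ℂ fun s => g s p q) ∧
    ∀ p q, HasDerivAt (fun s => (g s * x * (g s)⁻¹) p q) (v p q) 0}

/-- `S` is an affine subspace `x + V` of `so_{2m+1}` whose direction `V` is complementary, inside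
`so_{2m+1}`, to the tangent space at `x` of the adjoint orbit of `x`. -/
def IsTransverseSlice (m : ℕ) (S : Set (MatB m)) (x : MatB m) : Prop :=
  ∃ V : Submodule ℂ (MatB m), S = {Y | ∃ v ∈ V, Y = x + v} ∧
    V ⊓ orbitTangent m x = ⊥ ∧ V ⊔ orbitTangent m x = so m

/-- A Jacobson-Morozov triple `H, x, N` in `so_{2m+1}`:
`[H, x] = 2x`, `[H, N] = -2N`, `[x, N] = H`. -/
def IsJMTriple (m : ℕ) (H x N : MatB m) : Prop :=
  H ∈ so m ∧ x ∈ so m ∧ N ∈ so m ∧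
  H * x - x * H = (2 : ℂ) • x ∧ H * N - N * H = (-2 : ℂ) • N ∧ x * N - N * x = H

/-- The action `λ_r(Y) = r exp(-log(r) H/2) Y exp(log(r) H/2)` of `r = exp w`. -/
def lambdaAct {m : ℕ} (H : MatB m) (w : ℂ) (Y : MatB m) : MatB m :=
  Complex.exp w • (NormedSpace.exp (-(w / 2) • H) * Y * NormedSpace.exp ((w / 2) • H))

/-- `S` is invariant under the `ℂ^*`-action `λ` given by some Jacobson-Morozov triple of `x`. As `w`
runs over `ℂ`, all `r = exp w` in `ℂ^*` and all values of `log r` are covered. -/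
def IsLambdaInvariant (m : ℕ) (S : Set (MatB m)) (x : MatB m) : Prop :=
  ∃ H N : MatB m, IsJMTriple m H x N ∧ ∀ w : ℂ, ∀ Y ∈ S, lambdaAct H w Y ∈ S

/-- `X` is nilpotent with Jordan blocks of the sizes listed in `l`. -/
def HasJordanType {ι : Type*} [Fintype ι] (X : Matrix ι ι ℂ) (l : List ℕ) : Prop :=
  ∃ b : Module.Basis (Σ i : Fin l.length, Fin (l.get i)) ℂ (ι → ℂ),
    ∀ i : Fin l.length, ∀ k : Fin (l.get i), X.mulVec (b ⟨i, k⟩) =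
      if k.val = 0 then 0 else b ⟨i, ⟨k.val - 1, lt_of_le_of_lt (Nat.sub_le _ _) k.isLt⟩⟩

/-- `x_n = i(X_{n-1})`. -/
def nilB (m n : ℕ) : MatB m := incl (nilD m (n - 1))

/-- The root vector that carries the coordinate `a_0`:
`X_{-e_{m-n+2}}` for `n ≥ 2`, and `-X_{e_m}` for `n = 1`. -/
def shortRoot (m n : ℕ) : MatB m := if n = 1 then -rootP m m else rootM m (m - n + 2)

/-- The vector `√2 a_0 R - (d_0/√2) X_{-e_1}`. -/
def vecV {m : ℕ} (R : MatB m) (a₀ d₀ : ℂ) : MatB m :=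
  ((Real.sqrt 2 : ℂ) * a₀) • R - (d₀ / (Real.sqrt 2 : ℂ)) • rootM m 1

/-- The slice `i(S_{n-1}) + {√2 a_0 R - (d_0/√2) X_{-e_1} | a_0, d_0 ∈ ℂ}` in `so_{2m+1}`. -/
def sliceB (m n : ℕ) (R : MatB m) : Set (MatB m) :=
  {Y | ∃ Z ∈ sliceD m (n - 1), ∃ a₀ d₀ : ℂ, Y = incl Z + vecV R a₀ d₀}

/-- `a(t) = t² A(t) + (-1)^n a_0²`. -/
def fa (n : ℕ) (a₀ : ℂ) (a : ℕ → ℂ) (t : ℂ) : ℂ :=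
  t ^ 2 * polyA (n - 1) a t + (-1) ^ n * a₀ ^ 2

/-- `d(t) = D(t) + (-1)^{m-n} d_0² / t²`, for `t ≠ 0`. -/
def fd (m n : ℕ) (d₀ : ℂ) (d : ℕ → ℂ) (t : ℂ) : ℂ :=
  polyD m (n - 1) d t + (-1) ^ (m - n) * d₀ ^ 2 / t ^ 2

/-- `b(t) = a_0 d_0 / t + B(t)`, for `t ≠ 0`. -/
def fb (m n : ℕ) (a₀ d₀ : ℂ) (y z : ℕ → ℂ) (t : ℂ) : ℂ :=
  a₀ * d₀ / t + polyB m (n - 1) y z t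

/-- The formula `χ_S(t) = t a(t) d(t) + (-1)^m t b(t) b(-t)` for the characteristic polynomial of
every element `S` of the slice. Both sides are Laurent polynomials in `t`, and the formula says that
they are equal, which for Laurent polynomials means equality at all `t ≠ 0` in `ℂ`. -/
def CharpolyFormula (m n : ℕ) (R : MatB m) : Prop :=
  ∀ (a y z d : ℕ → ℂ) (a₀ d₀ t : ℂ), t ≠ 0 →
    (incl (eltD m (n - 1) a y z d) + vecV R a₀ d₀).charpoly.eval t =
      t * fa n a₀ a t * fd m n d₀ d t
        + (-1) ^ m * t * fb m n a₀ d₀ y z t * fb m n a₀ d₀ y z (-t)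

end SliceB

end

/-!
The standard representation of `so_{2m+1}` on `V = ℂ^{2m+1}` carries the invariant form `pair`, and
the Lie algebra is spanned by the rank-two operators `u ∧ w = (y ↦ ⟨w, y⟩ u - ⟨u, y⟩ w)`, called
`wedge`. All root vectors are wedges of the weight vectors `f_i`, `f'_i`, `e` of weights `e_i`,
`-e_i`, `0`, and `[A, u ∧ w] = A u ∧ w + u ∧ A w`. Write `m = r + 1 + q` with `q = n - 1 ≤ r`.

**Jordan type.** Up to signs, the nilpotent `x_n` moves `f'_1` through `f'_2, …, f'_r` to `f_{r+1} +
f'_{r+1}` and on to `0` after `2r + 1` steps. A second chain of length `2q + 1`, orthogonal to the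
first, starts at a combination of `f'_{r+2}` (`f_{r+1}` if `q = 0`) and `x_n^{r-q} f'_1`, and the
vector `e` is a chain of length 1. The chains are mutually orthogonal and pairing is nondegenerate on each of them
(`ChainFrame`, `nil_chainFrame`), so together they form a basis.

**Transversality.** The orbit tangent space is `[x_n, so]` (`orbitTangent_eq`). Modulo `[x_n, so]`
one may move powers of `x_n` across a wedge, `x_n u ∧ w ≡ -u ∧ x_n w`; hence the wedges of chain
vectors reduce to the wedges `v ∧ x_n^k w` of generators, with `k` less than the length of the
shorter chain, and for `v = w` only odd `k` are needed. Up to signs and modulo `[x_n, so]` these are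
the elements that span the direction of the slice; so the direction and the tangent space span
`so` (`so_le_of_mem`). Here the generator of the second chain matters only modulo the first chain.
The dimension of `[x_n, so]` is that of `so` minus the dimension of the centralizer, and the
centralizer contains explicit linearly independent elements, as many as the slice has parameters
(`le_finrank_ker_commutatorMap`); so the sum is direct (`inf_eq_bot_and_sup_eq`).

**Invariance.** The diagonal grading element `H` with `[H, x_n] = 2 x_n` completes to a
Jacobson-Morozov triple (`ChainFrame.exists_jmTriple`), and the direction of the slice is
spanned by eigenvectors of the resulting `ℂ^*`-action (`isLambdaInvariant_of_weight`).

**Characteristic polynomial.** Put `φ = f_{r+1}`. An element of the slice is `S₀ + φ ∧ (η - S₀ φ)`,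
where `S₀ = core` is strictly triangular in the weight basis (`incl_eltD_add_vecV_eq_core`,
`core_isNilpotent`). By the matrix determinant lemma (`eval_charpoly_add_wedge`) its characteristic
polynomial is `t^{2m+1} ((1 - β)(1 + β') + δ (ε - 2t))`, where `β, β', δ, ε` are the coefficients
`⟨η, G φ⟩, ⟨φ, G η⟩, ⟨φ, G φ⟩, ⟨η, G η⟩` of the resolvent `G = (t - S₀)⁻¹`. Modulo the isotropic
space spanned by the `f'_i`, which `S₀` preserves, the resolvent is given by geometric series along
the two blocks of simple root vectors (`ladder`), and an error in an isotropic invariant subspace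
contributes to these coefficients only at first order (`pair_resolvent`). This identifies `1 - β`,
`1 + β'`, `δ` and `ε - 2t`, up to powers of `t` and signs, with `b(-t)`, `b(t)`, `d(t)` and `a(t)`.
For the other choice of the short root vector with `n = 1` the four factors change, but for odd `m`
the total does not.
-/

noncomputable section

open Matrix

namespace SliceB

/-! ### The invariant form and the wedge elements `u ∧ w` of `so_{2m+1}` -/

/-- The column vectors of length `2m+1`. -/
abbrev Vec (m : ℕ) := Unit ⊕ (Fin m ⊕ Fin m) → ℂ

theorem form_transpose (m : ℕ) : (form m)ᵀ = form m := by
  simp [form, LieAlgebra.Orthogonal.JD, fromBlocks_transpose]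

theorem form_mul_form (m : ℕ) : form m * form m = 1 := by
  simp [form, LieAlgebra.Orthogonal.JD, fromBlocks_multiply]

/-- The symmetric bilinear form on column vectors with Gram matrix `form m`. -/
def pair (m : ℕ) : Vec m →ₗ[ℂ] Vec m →ₗ[ℂ] ℂ := Matrix.toBilin' (form m)

theorem pair_apply {m : ℕ} (u w : Vec m) : pair m u w = u ⬝ᵥ form m *ᵥ w := by
  simp [pair, Matrix.toBilin'_apply']

theorem pair_comm {m : ℕ} (u w : Vec m) : pair m u w = pair m w u := by
  rw [pair_apply, pair_apply, dotProduct_mulVec, ← mulVec_transpose, form_transpose,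
    dotProduct_comm]

theorem form_mulVec_dotProduct {m : ℕ} (u w : Vec m) : form m *ᵥ u ⬝ᵥ w = pair m u w := by
  rw [pair_comm, pair_apply, dotProduct_comm]

theorem form_mulVec_form_mulVec {m : ℕ} (u : Vec m) : form m *ᵥ form m *ᵥ u = u := by
  rw [mulVec_mulVec, form_mul_form, one_mulVec]

theorem mem_so {m : ℕ} {A : MatB m} : A ∈ so m ↔ Aᵀ * form m = -(form m * A) := by
  rw [so, mem_skewAdjointMatricesSubmodule, Matrix.IsSkewAdjoint, Matrix.IsAdjointPair,
    Matrix.mul_neg]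

theorem mem_so_iff_pair {m : ℕ} {A : MatB m} :
    A ∈ so m ↔ ∀ u w, pair m (A *ᵥ u) w = -pair m u (A *ᵥ w) := by
  have key : ∀ u w : Vec m, pair m (A *ᵥ u) w = u ⬝ᵥ (Aᵀ * form m) *ᵥ w := fun u w => by
    rw [pair_apply, ← mulVec_mulVec, dotProduct_mulVec u, vecMul_transpose]
  have key' : ∀ u w : Vec m, -pair m u (A *ᵥ w) = u ⬝ᵥ (-(form m * A)) *ᵥ w := fun u w => by
    rw [pair_apply, neg_mulVec, dotProduct_neg, ← mulVec_mulVec]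
  rw [mem_so]
  constructor
  · intro h u w
    rw [key, key', h]
  · intro h
    ext i j
    have := h (Pi.single i 1) (Pi.single j 1)
    rw [key, key'] at this
    simpa using this

theorem pair_mulVec_left {m : ℕ} {A : MatB m} (hA : A ∈ so m) (u w : Vec m) :
    pair m (A *ᵥ u) w = -pair m u (A *ᵥ w) :=
  mem_so_iff_pair.1 hA u w

theorem pair_pow_left {m : ℕ} {A : MatB m} (hA : A ∈ so m) (k : ℕ) (u w : Vec m) :
    pair m (A ^ k *ᵥ u) w = (-1) ^ k * pair m u (A ^ k *ᵥ w) := by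
  induction k generalizing u w with
  | zero => simp
  | succ k ih =>
    rw [pow_succ, ← mulVec_mulVec, ih, pair_mulVec_left hA, mulVec_mulVec, ← pow_succ', ← pow_succ,
      pow_succ (-1 : ℂ)]
    ring

/-- The wedge `u ∧ w`, read as the endomorphism `y ↦ ⟨w, y⟩ u - ⟨u, y⟩ w`. This is the isomorphism
of the exterior square of the standard representation with `so_{2m+1}`. -/
def wedge (m : ℕ) : Vec m →ₗ[ℂ] Vec m →ₗ[ℂ] MatB m :=
  LinearMap.mk₂ ℂ (fun u w => vecMulVec u (form m *ᵥ w) - vecMulVec w (form m *ᵥ u))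
    (fun u u' w => by simp only [mulVec_add, add_vecMulVec, vecMulVec_add]; abel)
    (fun c u w => by
      simp only [mulVec_smul, smul_vecMulVec, vecMulVec_smul, smul_sub])
    (fun u w w' => by simp only [mulVec_add, add_vecMulVec, vecMulVec_add]; abel)
    (fun c u w => by
      simp only [mulVec_smul, smul_vecMulVec, vecMulVec_smul, smul_sub])

theorem wedge_apply {m : ℕ} (u w : Vec m) :
    wedge m u w = vecMulVec u (form m *ᵥ w) - vecMulVec w (form m *ᵥ u) := rfl

theorem wedge_mulVec {m : ℕ} (u w y : Vec m) :
    wedge m u w *ᵥ y = pair m w y • u - pair m u y • w := by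
  rw [wedge_apply, sub_mulVec, vecMulVec_mulVec, vecMulVec_mulVec, form_mulVec_dotProduct,
    form_mulVec_dotProduct]
  simp

theorem wedge_swap {m : ℕ} (u w : Vec m) : wedge m u w = -wedge m w u := by
  simp [wedge_apply]

theorem wedge_self {m : ℕ} (u : Vec m) : wedge m u u = 0 := by
  simp [wedge_apply]

theorem wedge_mem_so {m : ℕ} (u w : Vec m) : wedge m u w ∈ so m := by
  rw [mem_so_iff_pair]
  intro y z
  simp only [wedge_mulVec, map_sub, map_smul, LinearMap.sub_apply, LinearMap.smul_apply,
    smul_eq_mul]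
  rw [pair_comm y u, pair_comm y w]
  ring

theorem eq_of_forall_mulVec {m : ℕ} {A B : MatB m} (h : ∀ y, A *ᵥ y = B *ᵥ y) : A = B :=
  Matrix.mulVec_injective (funext h)

theorem commutator_wedge {m : ℕ} {A : MatB m} (hA : A ∈ so m) (u w : Vec m) :
    A * wedge m u w - wedge m u w * A = wedge m (A *ᵥ u) w + wedge m u (A *ᵥ w) := by
  refine eq_of_forall_mulVec fun y => ?_
  simp only [sub_mulVec, add_mulVec, ← mulVec_mulVec, wedge_mulVec, mulVec_sub, mulVec_smul,
    pair_mulVec_left hA]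
  module

/-- The wedges span `so_{2m+1}`. -/
theorem so_le_of_wedge_mem {m : ℕ} {M : Submodule ℂ (MatB m)} (h : ∀ u w, wedge m u w ∈ M) :
    so m ≤ M := by
  intro A hA
  -- `A` times the Gram matrix is an alternating matrix, a combination of the `e_i e_jᵀ - e_j e_iᵀ`.
  have hK : (A * form m)ᵀ = -(A * form m) := by
    have h1 := congrArg (fun Z => form m * Z * form m) (mem_so.1 hA)
    simp only [Matrix.mul_assoc, form_mul_form, Matrix.mul_one, Matrix.mul_neg,
      Matrix.neg_mul] at h1
    rw [transpose_mul, form_transpose, h1, ← Matrix.mul_assoc (form m) (form m), form_mul_form,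
      Matrix.one_mul]
  have hA' : A = (2⁻¹ : ℂ) • ∑ i, ∑ j, (A * form m) i j •
      wedge m (Pi.single i 1) (Pi.single j 1) := by
    have h2 : ∑ i, ∑ j, (A * form m) i j •
        wedge m (Pi.single i 1) (Pi.single j 1) = (A * form m - (A * form m)ᵀ) * form m := by
      have h3 : ∀ K : MatB m, ∑ i, ∑ j, K i j • vecMulVec (Pi.single i (1 : ℂ))
          (form m *ᵥ Pi.single j 1) = K * form m := by
        intro K
        conv_rhs => rw [matrix_eq_sum_single K]
        simp only [Finset.sum_mul]
        refine Finset.sum_congr rfl fun i _ => Finset.sum_congr rfl fun j _ => ?_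
        rw [← mul_one (K i j), ← smul_eq_mul (K i j) 1, ← smul_single, smul_mul,
          single_eq_single_vecMulVec_single, vecMulVec_mul, ← mulVec_transpose, form_transpose]
        simp
      rw [sub_mul, ← h3 (A * form m), ← h3 (A * form m)ᵀ]
      simp only [wedge_apply, smul_sub, Finset.sum_sub_distrib, transpose_apply]
      congr 1
      rw [Finset.sum_comm]
    rw [h2, hK, sub_neg_eq_add, ← two_smul ℂ, smul_mul, smul_smul, Matrix.mul_assoc,
      form_mul_form]
    norm_num
  rw [hA']
  exact M.smul_mem _ (M.sum_mem fun i _ => M.sum_mem fun j _ => M.smul_mem _ (h _ _))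

/-! ### The tangent space of the adjoint orbit -/

/-- The space `[so_{2m+1}, x]`. -/
def bracketRange (m : ℕ) (x : MatB m) : Submodule ℂ (MatB m) :=
  (so m).map (LinearMap.mulRight ℂ x - LinearMap.mulLeft ℂ x)

theorem mem_bracketRange {m : ℕ} {x A : MatB m} :
    A ∈ bracketRange m x ↔ ∃ Z ∈ so m, Z * x - x * Z = A := by
  simp [bracketRange]

theorem SO_inv {m : ℕ} {g : MatB m} (hg : g ∈ SO m) : g⁻¹ = form m * gᵀ * form m := by
  refine Matrix.inv_eq_left_inv ?_
  rw [Matrix.mul_assoc, Matrix.mul_assoc, ← Matrix.mul_assoc gᵀ, hg.1, form_mul_form]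

theorem hasDerivAt_matrix_mul {ι : Type*} [Fintype ι] {A B : ℂ → Matrix ι ι ℂ}
    {A' B' : Matrix ι ι ℂ} {z : ℂ} (hA : ∀ p q, HasDerivAt (fun s => A s p q) (A' p q) z)
    (hB : ∀ p q, HasDerivAt (fun s => B s p q) (B' p q) z) (p q : ι) :
    HasDerivAt (fun s => (A s * B s) p q) ((A' * B z + A z * B') p q) z := by
  simp only [Matrix.mul_apply, Matrix.add_apply, ← Finset.sum_add_distrib]
  exact HasDerivAt.fun_sum fun i _ => (hA p i).mul (hB i q)

open scoped Matrix.Norms.Operator in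
theorem norm_entry_le_linfty_opNorm {ι : Type*} [Fintype ι] (A : Matrix ι ι ℂ) (p q : ι) :
    ‖A p q‖ ≤ ‖A‖ := by
  rw [Matrix.linfty_opNorm_def, ← coe_nnnorm, NNReal.coe_le_coe]
  exact (Finset.single_le_sum (f := fun j => ‖A p j‖₊) (fun _ _ => zero_le)
    (Finset.mem_univ q)).trans (Finset.le_sup (f := fun i => ∑ j, ‖A i j‖₊) (Finset.mem_univ p))

open scoped Matrix.Norms.Operator in
theorem hasDerivAt_exp_smul_entry {ι : Type*} [Fintype ι] [DecidableEq ι] (Z : Matrix ι ι ℂ)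
    (t : ℂ) (p q : ι) :
    HasDerivAt (fun s : ℂ => NormedSpace.exp (s • Z) p q)
      ((NormedSpace.exp (t • Z) * Z) p q) t := by
  exact (LinearMap.mkContinuous
      { toFun := fun M : Matrix ι ι ℂ => M p q
        map_add' := fun _ _ => rfl
        map_smul' := fun _ _ => rfl : Matrix ι ι ℂ →ₗ[ℂ] ℂ } 1
      fun M => (norm_entry_le_linfty_opNorm M p q).trans_eq
        (one_mul _).symm).hasFDerivAt.comp_hasDerivAt t
    (hasDerivAt_exp_smul_const (𝕂 := ℂ) Z t)

theorem transpose_exp_of_conj {ι : Type*} [Fintype ι] [DecidableEq ι] {F Z : Matrix ι ι ℂ}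
    (hF : F * F = 1) (h : Zᵀ * F = -(F * Z)) :
    (NormedSpace.exp Z)ᵀ * F * NormedSpace.exp Z = F := by
  have hinv : F⁻¹ = F := Matrix.inv_eq_left_inv hF
  have hZ : Zᵀ = F * (-Z) * F⁻¹ := by
    rw [hinv, Matrix.mul_neg, ← h, Matrix.mul_assoc, hF, Matrix.mul_one]
  have hu : IsUnit (NormedSpace.exp Z).det :=
    (Matrix.isUnit_iff_isUnit_det _).1 (Matrix.isUnit_exp Z)
  rw [← Matrix.exp_transpose, hZ, Matrix.exp_conj _ _ (IsUnit.of_mul_eq_one _ hF), Matrix.exp_neg,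
    hinv, Matrix.mul_assoc _ F F, hF, Matrix.mul_one, Matrix.mul_assoc,
    Matrix.nonsing_inv_mul _ hu, Matrix.mul_one]

theorem exp_mem_SO {m : ℕ} {Z : MatB m} (hZ : Z ∈ so m) (s : ℂ) :
    NormedSpace.exp (s • Z) ∈ SO m := by
  have key : ∀ s : ℂ, (NormedSpace.exp (s • Z))ᵀ * form m * NormedSpace.exp (s • Z) = form m :=
    fun s => transpose_exp_of_conj (form_mul_form m) (mem_so.1 ((so m).smul_mem s hZ))
  refine ⟨key s, ?_⟩
  -- The determinant is `±1`, and it is a square because `exp(sZ) = exp(sZ/2)²`.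
  have h2 : NormedSpace.exp (s • Z) = NormedSpace.exp ((s / 2) • Z) ^ 2 := by
    rw [← Matrix.exp_nsmul]
    congr 1
    rw [← Nat.cast_smul_eq_nsmul ℂ, smul_smul]
    congr 1
    push_cast
    ring
  have h3 := congrArg Matrix.det (key (s / 2))
  rw [det_mul, det_mul, det_transpose] at h3
  have h4 : (form m).det ≠ 0 :=
    ((Matrix.isUnit_iff_isUnit_det _).1 (IsUnit.of_mul_eq_one _ (form_mul_form m))).ne_zero
  rw [h2, det_pow]
  apply mul_right_cancel₀ h4
  rw [one_mul]
  linear_combination h3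

/-- The tangent space to the adjoint orbit of `x` is `[so_{2m+1}, x]`. -/
theorem orbitTangent_eq (m : ℕ) (x : MatB m) : orbitTangent m x = bracketRange m x := by
  have hc : ∀ C : MatB m, ∀ z p q, HasDerivAt (fun _ : ℂ => C p q) ((0 : MatB m) p q) z :=
    fun C z p q => hasDerivAt_const z _
  -- The velocity of `g x g⁻¹ = g x F gᵀ F` at `1` is `Z x + x F Zᵀ F`, for the velocity `Z` of `g`.
  have vel : ∀ (g : ℂ → MatB m) (Z : MatB m), (∀ s, g s ∈ SO m) → g 0 = 1 →
      (∀ p q, HasDerivAt (fun s => g s p q) (Z p q) 0) → Z ∈ so m ∧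
      ∀ p q, HasDerivAt (fun s => (g s * x * (g s)⁻¹) p q) ((Z * x - x * Z) p q) 0 := by
    intro g Z hg g0 hd
    have hdT : ∀ p q, HasDerivAt (fun s => (g s)ᵀ p q) (Zᵀ p q) 0 := fun p q => hd q p
    have hZ : Z ∈ so m := by
      rw [mem_so]
      have h1 := hasDerivAt_matrix_mul (hasDerivAt_matrix_mul hdT (hc (form m) 0)) hd
      ext p q
      have h2 := h1 p q
      simp only [(hg _).1] at h2
      have h3 := h2.unique (hasDerivAt_const 0 _)
      simp only [g0, transpose_one, Matrix.mul_one, Matrix.one_mul, Matrix.mul_zero, add_zero,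
        Matrix.add_apply] at h3
      simpa using eq_neg_of_add_eq_zero_left h3
    refine ⟨hZ, fun p q => ?_⟩
    simp only [SO_inv (hg _)]
    have h1 := hasDerivAt_matrix_mul (hasDerivAt_matrix_mul hd (hc x 0))
      (hasDerivAt_matrix_mul (hasDerivAt_matrix_mul (hc (form m) 0) hdT) (hc (form m) 0)) p q
    convert h1 using 2
    simp only [g0, transpose_one, Matrix.mul_one, Matrix.one_mul, Matrix.mul_zero, add_zero,
      zero_add, form_mul_form]
    rw [Matrix.mul_assoc (form m), mem_so.1 hZ, Matrix.mul_neg, ← Matrix.mul_assoc (form m),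
      form_mul_form, Matrix.one_mul, Matrix.mul_neg, sub_eq_add_neg]
  apply le_antisymm
  · refine Submodule.span_le.2 ?_
    rintro v ⟨g, hg, g0, hd, hv⟩
    obtain ⟨hZ, h⟩ := vel g (Matrix.of fun p q => deriv (fun s => g s p q) 0) hg g0
      fun p q => (hd p q 0).hasDerivAt
    refine mem_bracketRange.2 ⟨_, hZ, ?_⟩
    ext p q
    exact (h p q).unique (hv p q)
  · intro v hv
    obtain ⟨Z, hZ, rfl⟩ := mem_bracketRange.1 hv
    refine Submodule.subset_span ⟨fun s => NormedSpace.exp (s • Z), exp_mem_SO hZ, by simp,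
      fun p q s => (hasDerivAt_exp_smul_entry Z s p q).differentiableAt, ?_⟩
    refine (vel _ Z (exp_mem_SO hZ) (by simp) fun p q => ?_).2
    simpa using hasDerivAt_exp_smul_entry Z 0 p q

/-! ### Orthogonal Jordan chains of a nilpotent element -/

/-- A nilpotent `X ∈ so_{2m+1}` with an orthogonal decomposition of the standard representation into
Jordan chains: the `i`-th chain is `g i, X (g i), …, X ^ (L i - 1) (g i)`, the only nonzero pairings
are those of mirror images in the same chain, and their value is `± c i`. -/
structure ChainFrame {κ : Type*} [Fintype κ] [DecidableEq κ] (m : ℕ) (X : MatB m) (L : κ → ℕ)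
    (g : κ → Vec m) (c : κ → ℂ) : Prop where
  skew : X ∈ so m
  card : ∑ i, L i = 2 * m + 1
  c_ne : ∀ i, c i ≠ 0
  pow_eq_zero : ∀ i, X ^ L i *ᵥ g i = 0
  gram : ∀ i j k, pair m (g i) (X ^ k *ᵥ g j) = if i = j ∧ k + 1 = L i then c i else 0

namespace ChainFrame

variable {κ : Type*} [Fintype κ] [DecidableEq κ] {m : ℕ} {X : MatB m} {L : κ → ℕ}
  {g : κ → Vec m} {c : κ → ℂ}

theorem pair_pow_pow (h : ChainFrame m X L g c) (i j : κ) (k l : ℕ) :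
    pair m (X ^ k *ᵥ g i) (X ^ l *ᵥ g j) =
      if i = j ∧ k + l + 1 = L i then (-1) ^ k * c i else 0 := by
  rw [pair_pow_left h.skew, mulVec_mulVec, ← pow_add, h.gram]
  split_ifs <;> simp

theorem pow_eq_zero_of_le (h : ChainFrame m X L g c) {i : κ} {k : ℕ} (hk : L i ≤ k) :
    X ^ k *ᵥ g i = 0 := by
  rw [← Nat.sub_add_cancel hk, pow_add, ← mulVec_mulVec, h.pow_eq_zero, mulVec_zero]

theorem linearIndependent (h : ChainFrame m X L g c) :
    LinearIndependent ℂ fun x : Σ i, Fin (L i) => X ^ x.2.val *ᵥ g x.1 := by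
  rw [Fintype.linearIndependent_iff]
  rintro s hs ⟨j, l⟩
  have h1 := congrArg (pair m (X ^ (L j - 1 - l.val) *ᵥ g j)) hs
  have hl := l.isLt
  simp only [map_sum, map_smul, smul_eq_mul, map_zero, h.pair_pow_pow] at h1
  rw [Finset.sum_eq_single ⟨j, l⟩] at h1
  · rw [if_pos ⟨rfl, by change L j - 1 - l.val + l.val + 1 = L j; omega⟩] at h1
    simpa [h.c_ne] using h1
  · rintro ⟨i, k⟩ - hne
    rw [if_neg, mul_zero]
    rintro ⟨rfl, hk⟩
    exact hne (by congr; ext; simp only at hk; omega)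
  · simp

/-- The basis formed by the vectors of the Jordan chains. -/
def basis (h : ChainFrame m X L g c) : Module.Basis (Σ i, Fin (L i)) ℂ (Vec m) :=
  basisOfLinearIndependentOfCardEqFinrank' _ h.linearIndependent
    (by simp [h.card]; ring)

theorem basis_apply (h : ChainFrame m X L g c) (x : Σ i, Fin (L i)) :
    h.basis x = X ^ x.2.val *ᵥ g x.1 := by
  simp [basis]

theorem mem_of_pow_mem (h : ChainFrame m X L g c) {M : Submodule ℂ (Vec m)}
    (hM : ∀ i k, X ^ k *ᵥ g i ∈ M) (y : Vec m) : y ∈ M := by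
  have h1 : Submodule.span ℂ (Set.range h.basis) ≤ M := by
    rw [Submodule.span_le]
    rintro _ ⟨x, rfl⟩
    rw [basis_apply]
    exact hM _ _
  exact h1 (h.basis.span_eq ▸ Submodule.mem_top)

theorem matrix_ext (h : ChainFrame m X L g c) {A B : MatB m}
    (hAB : ∀ i k, A *ᵥ X ^ k *ᵥ g i = B *ᵥ X ^ k *ᵥ g i) : A = B :=
  eq_of_forall_mulVec fun y =>
    h.mem_of_pow_mem (M := LinearMap.eqLocus A.mulVecLin B.mulVecLin) hAB y

theorem mem_so_of_pair (h : ChainFrame m X L g c) {A : MatB m}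
    (hA : ∀ i k j l, pair m (A *ᵥ X ^ k *ᵥ g i) (X ^ l *ᵥ g j) =
      -pair m (X ^ k *ᵥ g i) (A *ᵥ X ^ l *ᵥ g j)) : A ∈ so m := by
  rw [mem_so_iff_pair]
  intro u w
  refine h.mem_of_pow_mem (M := LinearMap.eqLocus ((pair m).flip w ∘ₗ A.mulVecLin)
    (-((pair m).flip (A *ᵥ w)))) (fun i k => ?_) u
  refine h.mem_of_pow_mem (M := LinearMap.eqLocus (pair m (A *ᵥ X ^ k *ᵥ g i))
    (-(pair m (X ^ k *ᵥ g i) ∘ₗ A.mulVecLin))) (fun j l => ?_) w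
  exact hA i k j l

theorem exists_jmTriple (h : ChainFrame m X L g c) {H : MatB m} (hH : H ∈ so m)
    (hHX : H * X - X * H = (2 : ℂ) • X) (hHg : ∀ i, H *ᵥ g i = (1 - L i : ℂ) • g i) :
    ∃ N, IsJMTriple m H X N := by
  -- `N` lowers each chain with the coefficients of the irreducible representation of `sl₂`.
  obtain ⟨N, hN⟩ : ∃ N : MatB m, ∀ i (k : ℕ), N *ᵥ X ^ k *ᵥ g i =
      ((k : ℂ) * (L i - k)) • X ^ (k - 1) *ᵥ g i := by
    refine ⟨LinearMap.toMatrix' (h.basis.constr ℂ fun x =>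
      ((x.2.val : ℂ) * (L x.1 - x.2.val)) • X ^ (x.2.val - 1) *ᵥ g x.1), fun i k => ?_⟩
    rw [LinearMap.toMatrix'_mulVec]
    rcases lt_trichotomy k (L i) with hk | rfl | hk
    · have h1 := h.basis_apply ⟨i, ⟨k, hk⟩⟩
      rw [← h1, Module.Basis.constr_basis]
    · simp [h.pow_eq_zero]
    · rw [h.pow_eq_zero_of_le hk.le, h.pow_eq_zero_of_le (Nat.le_sub_one_of_lt hk)]
      simp
  have hHk : ∀ i (k : ℕ), H *ᵥ X ^ k *ᵥ g i = (2 * k + 1 - L i : ℂ) • X ^ k *ᵥ g i := by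
    intro i k
    induction k with
    | zero => simp [hHg]
    | succ k ih =>
      have h1 : H * X = X * H + (2 : ℂ) • X := by rw [← hHX]; abel
      rw [pow_succ', ← mulVec_mulVec, mulVec_mulVec _ H, h1, add_mulVec, ← mulVec_mulVec, ih,
        smul_mulVec, mulVec_smul, ← add_smul]
      congr 1
      push_cast
      ring
  refine ⟨N, hH, h.skew, h.mem_so_of_pair fun i k j l => ?_, hHX, h.matrix_ext fun i k => ?_,
    h.matrix_ext fun i k => ?_⟩
  · rw [hN, hN, map_smul, map_smul, LinearMap.smul_apply, h.pair_pow_pow, h.pair_pow_pow]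
    rcases k with _ | k <;> rcases l with _ | l
    · simp
    · simp only [Nat.cast_zero, zero_mul, smul_eq_mul, Nat.add_sub_cancel]
      split_ifs with h1
      · rw [← h1.1, ← h1.2]
        push_cast
        ring
      · simp
    · simp only [Nat.cast_zero, zero_mul, smul_eq_mul, Nat.add_sub_cancel]
      split_ifs with h1
      · rw [← h1.2]
        push_cast
        ring
      · simp
    · simp only [smul_eq_mul, Nat.add_sub_cancel]
      by_cases h1 : i = j ∧ k + 1 + l + 1 = L i
      · rw [if_pos h1, if_pos ⟨h1.1, by omega⟩, ← h1.1, ← h1.2]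
        push_cast
        ring
      · rw [if_neg h1, if_neg (by rintro ⟨h2, h3⟩; exact h1 ⟨h2, by omega⟩)]
        simp
  · rw [sub_mulVec, ← mulVec_mulVec, ← mulVec_mulVec, hN, hHk, mulVec_smul, mulVec_smul, hHk, hN,
      smul_mulVec, hN]
    rcases k with _ | k
    · simp
    · simp only [smul_smul, ← sub_smul, Nat.add_sub_cancel]
      congr 1
      push_cast
      ring
  · rw [sub_mulVec, ← mulVec_mulVec, ← mulVec_mulVec, hN, hHk, mulVec_smul,
      mulVec_mulVec _ X (X ^ k), ← pow_succ', hN, mulVec_mulVec, Nat.add_sub_cancel]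
    rcases k with _ | k
    · push_cast
      module
    · rw [Nat.add_sub_cancel, ← pow_succ', ← sub_smul]
      congr 1
      push_cast
      ring

theorem hasJordanType {l : List ℕ} {g : Fin l.length → Vec m} {c : Fin l.length → ℂ}
    (h : ChainFrame m X l.get g c) : HasJordanType X l := by
  refine ⟨h.basis.reindex (Equiv.sigmaCongrRight fun _ => Fin.revPerm), fun i k => ?_⟩
  have hb : ∀ k : Fin (l.get i), h.basis.reindex (Equiv.sigmaCongrRight fun _ => Fin.revPerm)
      ⟨i, k⟩ = X ^ (l.get i - (k.val + 1)) *ᵥ g i := by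
    intro k
    rw [Module.Basis.reindex_apply, basis_apply]
    rfl
  have hk := k.isLt
  rw [hb, mulVec_mulVec, ← pow_succ']
  split_ifs with h0
  · exact h.pow_eq_zero_of_le (by omega)
  · rw [hb]
    congr 2
    simp only
    omega

end ChainFrame

/-! ### Transversality from the Jordan chains -/

theorem bracketRange_le_so {m : ℕ} {X : MatB m} (hX : X ∈ so m) : bracketRange m X ≤ so m := by
  intro A hA
  obtain ⟨Z, hZ, rfl⟩ := mem_bracketRange.1 hA
  rw [mem_so_iff_pair] at *
  intro u w
  simp only [sub_mulVec, ← mulVec_mulVec, map_sub, LinearMap.sub_apply, hZ, hX]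
  ring

theorem wedge_add_wedge_mem_bracketRange {m : ℕ} {X : MatB m} (hX : X ∈ so m) (u w : Vec m) :
    wedge m (X *ᵥ u) w + wedge m u (X *ᵥ w) ∈ bracketRange m X := by
  rw [← commutator_wedge hX]
  exact mem_bracketRange.2 ⟨-wedge m u w, (so m).neg_mem (wedge_mem_so u w), by noncomm_ring⟩

section reduction

variable {m : ℕ} {X : MatB m} {M : Submodule ℂ (MatB m)}

/-- Modulo the tangent space, powers of `X` move freely from one factor of a wedge to the other. -/
theorem wedge_pow_mem_iff (hX : X ∈ so m) (hM : bracketRange m X ≤ M) (u w : Vec m) (k l : ℕ) :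
    wedge m (X ^ k *ᵥ u) (X ^ l *ᵥ w) ∈ M ↔ wedge m u (X ^ (k + l) *ᵥ w) ∈ M := by
  induction k generalizing l with
  | zero => simp
  | succ k ih =>
    have h1 := hM (wedge_add_wedge_mem_bracketRange hX (X ^ k *ᵥ u) (X ^ l *ᵥ w))
    rw [mulVec_mulVec, mulVec_mulVec, ← pow_succ', ← pow_succ'] at h1
    rw [show k + 1 + l = k + (l + 1) by omega, ← ih (l + 1)]
    exact ⟨fun h => (M.add_mem_iff_right h).1 h1, fun h => (M.add_mem_iff_left h).1 h1⟩

theorem wedge_swap_mem_iff (u w : Vec m) : wedge m u w ∈ M ↔ wedge m w u ∈ M := by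
  rw [wedge_swap, M.neg_mem_iff]

/-- For even `k` the wedge `u ∧ X ^ k u` is tangent: it is equivalent to `± y ∧ y`,
where `y = X ^ (k / 2) u`. -/
theorem wedge_even_mem (hX : X ∈ so m) (hM : bracketRange m X ≤ M) (u : Vec m) (k : ℕ) :
    wedge m u (X ^ (k + k) *ᵥ u) ∈ M := by
  rw [← wedge_pow_mem_iff hX hM, wedge_self]
  exact M.zero_mem

end reduction

/-- The element `∑ (-1) ^ j (X ^ (j + r) u) ∧ (X ^ (k - j + s) w)`, which commutes with `X` if
`X ^ (k + 1 + r) u = 0` and `X ^ (k + 1 + s) w = 0`. -/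
def alternatingSum {m : ℕ} (X : MatB m) (u w : Vec m) (k r s : ℕ) : MatB m :=
  ∑ j ∈ Finset.range (k + 1),
    (-1 : ℂ) ^ j • wedge m (X ^ (j + r) *ᵥ u) (X ^ (k - j + s) *ᵥ w)

theorem alternatingSum_mem_so {m : ℕ} (X : MatB m) (u w : Vec m) (k r s : ℕ) :
    alternatingSum X u w k r s ∈ so m :=
  (so m).sum_mem fun _ _ => (so m).smul_mem _ (wedge_mem_so _ _)

theorem alternatingSum_comm {m : ℕ} {X : MatB m} (hX : X ∈ so m) {u w : Vec m} {k r s : ℕ}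
    (hu : X ^ (k + 1 + r) *ᵥ u = 0) (hw : X ^ (k + 1 + s) *ᵥ w = 0) :
    X * alternatingSum X u w k r s - alternatingSum X u w k r s * X = 0 := by
  let f : ℕ → MatB m := fun j =>
    (-1 : ℂ) ^ j • wedge m (X ^ (j + r) *ᵥ u) (X ^ (k + 1 - j + s) *ᵥ w)
  have h1 : X * alternatingSum X u w k r s - alternatingSum X u w k r s * X =
      ∑ j ∈ Finset.range (k + 1), (f j - f (j + 1)) := by
    rw [alternatingSum, Finset.mul_sum, Finset.sum_mul, ← Finset.sum_sub_distrib]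
    refine Finset.sum_congr rfl fun j hj => ?_
    have hj' : k + 1 - j = k - j + 1 := by have := Finset.mem_range.1 hj; omega
    rw [Matrix.mul_smul, Matrix.smul_mul, ← smul_sub, commutator_wedge hX, mulVec_mulVec,
      mulVec_mulVec, ← pow_succ', ← pow_succ']
    simp only [f]
    rw [hj', Nat.add_sub_add_right, pow_succ (-1 : ℂ), show j + 1 + r = j + r + 1 by omega,
      show k - j + 1 + s = k - j + s + 1 by omega]
    module
  rw [h1, Finset.sum_range_sub']
  simp [f, hu, hw]

/-- The commutator with `X` on `so_{2m+1}`. -/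
def commutatorMap {m : ℕ} (X : MatB m) : so m →ₗ[ℂ] MatB m :=
  (LinearMap.mulRight ℂ X - LinearMap.mulLeft ℂ X).domRestrict (so m)

namespace ChainFrame

variable {κ : Type*} [Fintype κ] [DecidableEq κ] {m : ℕ} {X : MatB m} {L : κ → ℕ}
  {g : κ → Vec m} {c : κ → ℂ}

theorem alternatingSum_mulVec (h : ChainFrame m X L g c) {i j : κ} {k r s : ℕ}
    (hr : r + k + 1 = L i) (hs : s + k + 1 = L j) (l : κ) :
    alternatingSum X (g i) (g j) k r s *ᵥ g l =
      (if l = j then c l else 0) • X ^ r *ᵥ g i -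
        (-1 : ℂ) ^ k • (if l = i then c l else 0) • X ^ s *ᵥ g j := by
  have hp : ∀ (i : κ) (n : ℕ), pair m (X ^ n *ᵥ g i) (g l) =
      if l = i ∧ n + 1 = L l then c l else 0 := fun i n => by rw [pair_comm, h.gram]
  rw [alternatingSum, sum_mulVec]
  simp only [smul_mulVec, wedge_mulVec, smul_sub, Finset.sum_sub_distrib]
  congr 1
  · rw [Finset.sum_eq_single 0]
    · rw [hp]
      by_cases hl : l = j
      · subst hl
        rw [if_pos ⟨rfl, by omega⟩, if_pos rfl]
        simp
      · simp [hl]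
    · intro n hn h0
      rw [hp, if_neg, zero_smul, smul_zero]
      rintro ⟨rfl, h1⟩
      have := Finset.mem_range.1 hn
      omega
    · simp
  · rw [Finset.sum_eq_single k]
    · rw [hp]
      by_cases hl : l = i
      · subst hl
        rw [if_pos ⟨rfl, by omega⟩, if_pos rfl]
        simp
      · simp [hl]
    · intro n hn h0
      rw [hp, if_neg, zero_smul, smul_zero]
      rintro ⟨rfl, h1⟩
      have := Finset.mem_range.1 hn
      omega
    · simp

theorem pair_alternatingSum (h : ChainFrame m X L g c) {i j : κ} {k r s : ℕ}
    (hr : r + k + 1 = L i) (hs : s + k + 1 = L j) (l l' : κ) (t : ℕ) :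
    pair m (X ^ t *ᵥ g l') (alternatingSum X (g i) (g j) k r s *ᵥ g l) =
      if t = k then (-1) ^ k * ((if l = j ∧ l' = i then c l * c l' else 0) -
        (-1) ^ k * (if l = i ∧ l' = j then c l * c l' else 0)) else 0 := by
  rw [h.alternatingSum_mulVec hr hs]
  simp only [map_sub, map_smul, h.pair_pow_pow, smul_eq_mul]
  have e1 : (l' = i ∧ t + r + 1 = L l') ↔ (l' = i ∧ t = k) := by
    constructor <;> rintro ⟨rfl, h1⟩ <;> exact ⟨rfl, by omega⟩
  have e2 : (l' = j ∧ t + s + 1 = L l') ↔ (l' = j ∧ t = k) := by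
    constructor <;> rintro ⟨rfl, h1⟩ <;> exact ⟨rfl, by omega⟩
  simp only [e1, e2]
  by_cases ht : t = k
  · subst ht
    have e3 : ∀ i, (if l' = i then (-1) ^ t * c l' else 0) =
        (-1) ^ t * (if l' = i then c l' else 0) := fun i => by split_ifs <;> simp
    simp only [and_true, if_true, ← ite_zero_mul_ite_zero, e3]
    ring1
  · simp [ht]

variable {a b : ℕ} {v w e : Vec m} {c : Fin 3 → ℂ}

/-- The centralizer of `X` in `so_{2m+1}` has at least the dimension predicted by the partition
`[2a+1, 2b+1, 1]`. -/
theorem le_finrank_ker_commutatorMap (h : ChainFrame m X ![2 * a + 1, 2 * b + 1, 1] ![v, w, e] c)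
    (hba : b ≤ a) : a + 3 * b + 3 ≤ Module.finrank ℂ (LinearMap.ker (commutatorMap X)) := by
  have hker : ∀ (i j : Fin 3) (k r s : ℕ), r + k + 1 = ![2 * a + 1, 2 * b + 1, 1] i →
      s + k + 1 = ![2 * a + 1, 2 * b + 1, 1] j →
      (⟨alternatingSum X (![v, w, e] i) (![v, w, e] j) k r s, alternatingSum_mem_so _ _ _ _ _ _⟩ :
        so m) ∈ LinearMap.ker (commutatorMap X) := by
    intro i j k r s hr hs
    have h1 := alternatingSum_comm h.skew (k := k) (r := r) (s := s)
      (h.pow_eq_zero_of_le (i := i) (by omega)) (h.pow_eq_zero_of_le (i := j) (by omega))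
    rw [LinearMap.mem_ker]
    change _ * X - X * _ = 0
    rw [← neg_sub, neg_eq_zero]
    exact h1
  let z : ∀ (i j : Fin 3) (k r s : ℕ), r + k + 1 = ![2 * a + 1, 2 * b + 1, 1] i →
      s + k + 1 = ![2 * a + 1, 2 * b + 1, 1] j → LinearMap.ker (commutatorMap X) :=
    fun i j k r s hr hs => ⟨_, hker i j k r s hr hs⟩
  let Φ : ((Fin a → ℂ) × (Fin b → ℂ) × (Fin (2 * b + 1) → ℂ) × ℂ × ℂ) →ₗ[ℂ]
      LinearMap.ker (commutatorMap X) :=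
    { toFun := fun x =>
        ∑ i, x.1 i • z 0 0 (2 * i + 1) (2 * a - (2 * i + 1)) (2 * a - (2 * i + 1))
          (by have := i.isLt; change _ = 2 * a + 1; omega)
          (by have := i.isLt; change _ = 2 * a + 1; omega)
        + ∑ i, x.2.1 i • z 1 1 (2 * i + 1) (2 * b - (2 * i + 1)) (2 * b - (2 * i + 1))
          (by have := i.isLt; change _ = 2 * b + 1; omega)
          (by have := i.isLt; change _ = 2 * b + 1; omega)
        + ∑ i, x.2.2.1 i • z 0 1 i (2 * a - i) (2 * b - i) (by simp; omega) (by simp; omega)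
        + x.2.2.2.1 • z 2 0 0 0 (2 * a) (by simp) (by simp)
        + x.2.2.2.2 • z 2 1 0 0 (2 * b) (by simp) (by simp)
      map_add' := fun x y => by
        simp only [Prod.fst_add, Prod.snd_add, Pi.add_apply, add_smul, Finset.sum_add_distrib]
        abel
      map_smul' := fun r x => by
        simp only [Prod.smul_fst, Prod.smul_snd, Pi.smul_apply, smul_eq_mul, mul_smul,
          ← Finset.smul_sum, smul_add, RingHom.id_apply] }
  have hΦ : Function.Injective Φ := by
    refine (injective_iff_map_eq_zero Φ).2 ?_
    rintro ⟨x, y, n, p, q⟩ h0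
    have h1 : ((Φ (x, y, n, p, q)).1.1 : MatB m) = 0 := by rw [h0]; rfl
    simp only [Φ, z, LinearMap.coe_mk, AddHom.coe_mk, Submodule.coe_add, Submodule.coe_sum,
      Submodule.coe_smul] at h1
    -- The coordinates are read off from the pairings of the chains with the images of `v` and `w`.
    have key : ∀ (l l' : Fin 3) (t : ℕ), _ := fun l l' t =>
      congrArg (fun A : MatB m => pair m (X ^ t *ᵥ ![v, w, e] l') (A *ᵥ ![v, w, e] l)) h1
    simp only [add_mulVec, sum_mulVec, smul_mulVec, map_add, map_sum, map_smul, zero_mulVec,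
      map_zero, smul_eq_mul] at key
    have z₁ := fun i : Fin a => h.pair_alternatingSum (i := 0) (j := 0) (k := 2 * i + 1)
      (r := 2 * a - (2 * i + 1)) (s := 2 * a - (2 * i + 1))
      (by have := i.isLt; change _ = 2 * a + 1; omega)
      (by have := i.isLt; change _ = 2 * a + 1; omega)
    have z₂ := fun i : Fin b => h.pair_alternatingSum (i := 1) (j := 1) (k := 2 * i + 1)
      (r := 2 * b - (2 * i + 1)) (s := 2 * b - (2 * i + 1))
      (by have := i.isLt; change _ = 2 * b + 1; omega)
      (by have := i.isLt; change _ = 2 * b + 1; omega)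
    have z₃ := fun i : Fin (2 * b + 1) => h.pair_alternatingSum (i := 0) (j := 1) (k := i)
      (r := 2 * a - i) (s := 2 * b - i)
      (by have := i.isLt; change _ = 2 * a + 1; omega)
      (by have := i.isLt; change _ = 2 * b + 1; omega)
    have z₄ := h.pair_alternatingSum (i := 2) (j := 0) (k := 0) (r := 0) (s := 2 * a) rfl rfl
    have z₅ := h.pair_alternatingSum (i := 2) (j := 1) (k := 0) (r := 0) (s := 2 * b) rfl rfl
    simp only [z₁, z₂, z₃, z₄, z₅] at key
    have hc := h.c_ne
    have hx : x = 0 := funext fun i => by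
      have h2 := key 0 0 (2 * i + 1)
      simpa [Fin.val_inj, hc, pow_succ, ← two_mul] using h2
    have hy : y = 0 := funext fun i => by
      have h2 := key 1 1 (2 * i + 1)
      simpa [Fin.val_inj, hc, pow_succ, ← two_mul] using h2
    have hn : n = 0 := funext fun i => by
      have h2 := key 1 0 i
      simpa [Fin.val_inj, hc] using h2
    have hp : p = 0 := by simpa [hc] using key 0 2 0
    have hq : q = 0 := by simpa [hc] using key 1 2 0
    rw [hx, hy, hn, hp, hq]
    rfl
  have h2 := LinearMap.finrank_le_finrank_of_injective hΦ
  simp only [Module.finrank_prod, Module.finrank_fin_fun, Module.finrank_self] at h2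
  omega

end ChainFrame

namespace ChainFrame

variable {m : ℕ} {X : MatB m} {a b : ℕ} {v w e : Vec m} {c : Fin 3 → ℂ}

/-- Every wedge of chain vectors is equivalent, modulo the tangent space, to one of
`v ∧ X ^ k v` (`k < 2a` odd), `u ∧ X ^ k u` (`k < 2b` odd), `v ∧ X ^ k u` (`k ≤ 2b`), `e ∧ v` and
`e ∧ u`. Here `u` generates the second chain only modulo the first one. -/
theorem so_le_of_mem (h : ChainFrame m X ![2 * a + 1, 2 * b + 1, 1] ![v, w, e] c)
    {u : Vec m} {r : ℂ} {s : ℕ} (hu : u = w + r • X ^ s *ᵥ v)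
    {M : Submodule ℂ (MatB m)} (hM : bracketRange m X ≤ M)
    (hvv : ∀ k < a, wedge m (X ^ k *ᵥ v) (X ^ (k + 1) *ᵥ v) ∈ M)
    (huu : ∀ k < b, wedge m (X ^ k *ᵥ u) (X ^ (k + 1) *ᵥ u) ∈ M)
    (hvu : ∀ k < b, wedge m v (X ^ k *ᵥ u) ∈ M)
    (huv : ∀ k ≤ b, wedge m (X ^ b *ᵥ u) (X ^ k *ᵥ v) ∈ M)
    (hev : wedge m e v ∈ M) (heu : wedge m e u ∈ M) : so m ≤ M := by
  have hX := h.skew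
  have move := wedge_pow_mem_iff (M := M) hX hM
  have he : X *ᵥ e = 0 := by simpa using h.pow_eq_zero 2
  have hvk : ∀ k, 2 * a + 1 ≤ k → X ^ k *ᵥ v = 0 := fun k hk => h.pow_eq_zero_of_le (i := 0) hk
  have hwk : ∀ k, 2 * b + 1 ≤ k → X ^ k *ᵥ w = 0 := fun k hk => h.pow_eq_zero_of_le (i := 1) hk
  have huk : ∀ k, 2 * b + 1 ≤ k → X ^ k *ᵥ u = r • X ^ (k + s) *ᵥ v := fun k hk => by
    rw [hu, mulVec_add, hwk k hk, zero_add, mulVec_smul, mulVec_mulVec, pow_add]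
  have vv : ∀ k, wedge m v (X ^ k *ᵥ v) ∈ M := by
    intro k
    rcases Nat.even_or_odd' k with ⟨n, rfl | rfl⟩
    · rw [two_mul]
      exact wedge_even_mem hX hM v n
    · rcases lt_or_ge n a with hn | hn
      · rw [show 2 * n + 1 = n + (n + 1) by omega, ← move]
        exact hvv n hn
      · rw [hvk _ (by omega), map_zero]
        exact M.zero_mem
  have vu : ∀ k, wedge m v (X ^ k *ᵥ u) ∈ M := by
    intro k
    rcases lt_or_ge k b with hk | hk
    · exact hvu k hk
    · rcases lt_or_ge (2 * b) k with hk2 | hk2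
      · rw [huk k hk2, map_smul]
        exact M.smul_mem _ (vv _)
      · rw [show k = (k - b) + b by omega, ← move, wedge_swap_mem_iff]
        exact huv _ (by omega)
  have uu : ∀ k, wedge m u (X ^ k *ᵥ u) ∈ M := by
    intro k
    rcases Nat.even_or_odd' k with ⟨n, rfl | rfl⟩
    · rw [two_mul]
      exact wedge_even_mem hX hM u n
    · rcases lt_or_ge n b with hn | hn
      · rw [show 2 * n + 1 = n + (n + 1) by omega, ← move]
        exact huu n hn
      · rw [huk _ (by omega), map_smul]
        refine M.smul_mem _ ((move u v (2 * n + 1 + s) 0).1 ?_)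
        rw [wedge_swap_mem_iff]
        exact (move v u 0 _).2 (vu _)
  have ek : ∀ y, wedge m e y ∈ M → ∀ k, wedge m e (X ^ k *ᵥ y) ∈ M := by
    intro y hy k
    rcases k with _ | k
    · simpa using hy
    · have h1 := (move e y (k + 1) 0).1 (by rw [pow_succ, ← mulVec_mulVec, he]; simp)
      exact h1
  -- The vectors `X ^ k v`, `X ^ k u` and `e` span everything.
  have span : ∀ N : Submodule ℂ (Vec m), (∀ k, X ^ k *ᵥ v ∈ N) → (∀ k, X ^ k *ᵥ u ∈ N) → e ∈ N →
      ∀ y, y ∈ N := by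
    intro N h0 h1 h2
    refine h.mem_of_pow_mem fun i k => ?_
    fin_cases i
    · exact h0 k
    · have : X ^ k *ᵥ w = X ^ k *ᵥ u - r • X ^ (k + s) *ᵥ v := by
        rw [hu, mulVec_add, mulVec_smul, mulVec_mulVec, pow_add]
        simp
      change X ^ k *ᵥ w ∈ N
      rw [this]
      exact N.sub_mem (h1 k) (N.smul_mem _ (h0 _))
    · rcases k with _ | k
      · simpa using h2
      · change X ^ (k + 1) *ᵥ e ∈ N
        rw [pow_succ, ← mulVec_mulVec, he, mulVec_zero]
        exact N.zero_mem
  have right : ∀ y, (∀ k, wedge m y (X ^ k *ᵥ v) ∈ M) → (∀ k, wedge m y (X ^ k *ᵥ u) ∈ M) →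
      wedge m y e ∈ M → ∀ z, wedge m y z ∈ M := fun y h0 h1 h2 z =>
    span (M.comap (wedge m y)) h0 h1 h2 z
  have hv : ∀ k z, wedge m (X ^ k *ᵥ v) z ∈ M := fun k =>
    right _ (fun l => (move v v k l).2 (vv _)) (fun l => (move v u k l).2 (vu _))
      ((wedge_swap_mem_iff _ _).2 (ek v hev k))
  have hu' : ∀ k z, wedge m (X ^ k *ᵥ u) z ∈ M := fun k =>
    right _ (fun l => (wedge_swap_mem_iff _ _).2 (hv l _)) (fun l => (move u u k l).2 (uu _))
      ((wedge_swap_mem_iff _ _).2 (ek u heu k))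
  refine so_le_of_wedge_mem fun y z => ?_
  rw [wedge_swap_mem_iff]
  exact right z (fun k => (wedge_swap_mem_iff _ _).2 (hv k z))
    (fun k => (wedge_swap_mem_iff _ _).2 (hu' k z))
    (right e (ek v hev) (ek u heu) (by rw [wedge_self]; exact M.zero_mem) z |>
      (wedge_swap_mem_iff _ _).1) y

/-- A space of the dimension of the centralizer that spans `so_{2m+1}` together with the tangent
space is complementary to the tangent space. -/
theorem inf_eq_bot_and_sup_eq (h : ChainFrame m X ![2 * a + 1, 2 * b + 1, 1] ![v, w, e] c)
    (hba : b ≤ a) {V : Submodule ℂ (MatB m)} (hV : V ≤ so m)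
    (hdim : Module.finrank ℂ V ≤ a + 3 * b + 3) (hle : so m ≤ V ⊔ bracketRange m X) :
    V ⊓ bracketRange m X = ⊥ ∧ V ⊔ bracketRange m X = so m := by
  have hsup : V ⊔ bracketRange m X = so m :=
    le_antisymm (sup_le hV (bracketRange_le_so h.skew)) hle
  refine ⟨?_, hsup⟩
  have h1 := Submodule.finrank_sup_add_finrank_inf_eq V (bracketRange m X)
  have h2 := LinearMap.finrank_range_add_finrank_ker (commutatorMap X)
  have h3 : LinearMap.range (commutatorMap X) = bracketRange m X := LinearMap.range_domRestrict _ _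
  have h4 := h.le_finrank_ker_commutatorMap hba
  rw [h3] at h2
  rw [hsup] at h1
  exact Submodule.finrank_eq_zero.1 (by omega)

end ChainFrame

/-! ### The standard basis and the root vectors as wedges -/

/-- The vector spanning the anisotropic line of the standard representation. -/
def vecE (m : ℕ) : Vec m := Sum.elim (fun _ => 1) fun _ => 0

/-- The weight vector of weight `e_i`, with `i` counted from 1; it is `0` if `i = 0` or `i > m`. -/
def vecF (m i : ℕ) : Vec m :=
  Sum.elim (fun _ => 0) (Sum.elim (fun k => if k.val + 1 = i then 1 else 0) fun _ => 0)

/-- The weight vector of weight `-e_i`, with `i` counted from 1; it is `0` if `i = 0` or `i > m`. -/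
def vecF' (m i : ℕ) : Vec m :=
  Sum.elim (fun _ => 0) (Sum.elim (fun _ => 0) fun k => if k.val + 1 = i then 1 else 0)

theorem form_mulVec {m : ℕ} (u : Vec m) :
    form m *ᵥ u = Sum.elim (fun x => u (Sum.inl x))
      (Sum.elim (fun k => u (Sum.inr (Sum.inr k))) fun k => u (Sum.inr (Sum.inl k))) := by
  ext (x | x | x) <;>
    simp [form, LieAlgebra.Orthogonal.JD, fromBlocks_mulVec]

theorem pair_eq {m : ℕ} (u w : Vec m) :
    pair m u w = u (Sum.inl ()) * w (Sum.inl ()) +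
      (∑ k, u (Sum.inr (Sum.inl k)) * w (Sum.inr (Sum.inr k)) +
        ∑ k, u (Sum.inr (Sum.inr k)) * w (Sum.inr (Sum.inl k))) := by
  rw [pair_apply, form_mulVec, dotProduct, Fintype.sum_sum_type, Fintype.sum_sum_type]
  simp

theorem sum_fin_ite {m : ℕ} (i j : ℕ) :
    (∑ k : Fin m, (if k.val + 1 = i then (1 : ℂ) else 0) * (if k.val + 1 = j then 1 else 0)) =
      if i = j ∧ 1 ≤ i ∧ i ≤ m then 1 else 0 := by
  split_ifs with h
  · obtain ⟨rfl, h1, h2⟩ := h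
    rw [Finset.sum_eq_single ⟨i - 1, by omega⟩]
    · simp [Nat.sub_add_cancel h1]
    · intro k _ hk
      rw [if_neg, zero_mul]
      rintro rfl
      exact hk (by ext; simp)
    · simp
  · refine Finset.sum_eq_zero fun k _ => ?_
    have := k.isLt
    rw [ite_zero_mul_ite_zero, if_neg]
    rintro ⟨rfl, h2⟩
    exact h ⟨h2, by omega, by omega⟩

theorem pair_vecF_vecF (m i j : ℕ) : pair m (vecF m i) (vecF m j) = 0 := by
  simp [pair_eq, vecF]

theorem pair_vecF'_vecF' (m i j : ℕ) : pair m (vecF' m i) (vecF' m j) = 0 := by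
  simp [pair_eq, vecF']

theorem pair_vecF_vecF' (m i j : ℕ) :
    pair m (vecF m i) (vecF' m j) = if i = j ∧ 1 ≤ i ∧ i ≤ m then 1 else 0 := by
  rw [← sum_fin_ite]
  simp [pair_eq, vecF, vecF']

theorem pair_vecF'_vecF (m i j : ℕ) :
    pair m (vecF' m i) (vecF m j) = if i = j ∧ 1 ≤ i ∧ i ≤ m then 1 else 0 := by
  rw [← sum_fin_ite]
  simp [pair_eq, vecF, vecF']

theorem pair_vecE_vecE (m : ℕ) : pair m (vecE m) (vecE m) = 1 := by
  simp [pair_eq, vecE]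

theorem pair_vecE_vecF (m i : ℕ) : pair m (vecE m) (vecF m i) = 0 := by
  simp [pair_eq, vecE, vecF]

theorem pair_vecE_vecF' (m i : ℕ) : pair m (vecE m) (vecF' m i) = 0 := by
  simp [pair_eq, vecE, vecF']

theorem pair_vecF_vecE (m i : ℕ) : pair m (vecF m i) (vecE m) = 0 := by
  rw [pair_comm, pair_vecE_vecF]

theorem pair_vecF'_vecE (m i : ℕ) : pair m (vecF' m i) (vecE m) = 0 := by
  rw [pair_comm, pair_vecE_vecF']

theorem incl_rootPM (m i j : ℕ) : incl (rootPM m i j) = wedge m (vecF m i) (vecF' m j) := by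
  rw [wedge_apply, form_mulVec, form_mulVec]
  ext (x | x | x) (y | y | y) <;>
    simp [incl, rootPM, E, vecF, vecF', vecMulVec_apply, ite_and] <;>
    split_ifs <;> rfl

theorem incl_rootPP (m i j : ℕ) : incl (rootPP m i j) = wedge m (vecF m i) (vecF m j) := by
  rw [wedge_apply, form_mulVec, form_mulVec]
  ext (x | x | x) (y | y | y) <;>
    simp [incl, rootPP, E, vecF, vecMulVec_apply, ite_and] <;>
    split_ifs <;> rfl

theorem incl_rootMM (m i j : ℕ) : incl (rootMM m i j) = wedge m (vecF' m i) (vecF' m j) := by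
  rw [wedge_apply, form_mulVec, form_mulVec]
  ext (x | x | x) (y | y | y) <;>
    simp [incl, rootMM, E, vecF', vecMulVec_apply, ite_and] <;>
    split_ifs <;> rfl

theorem rootP_eq (m i : ℕ) : rootP m i = wedge m (vecE m) (vecF m i) := by
  rw [wedge_apply, form_mulVec, form_mulVec]
  ext (x | x | x) (y | y | y) <;> simp [rootP, vecE, vecF, vecMulVec_apply]
  split_ifs <;> simp

theorem rootM_eq (m i : ℕ) : rootM m i = wedge m (vecE m) (vecF' m i) := by
  rw [wedge_apply, form_mulVec, form_mulVec]
  ext (x | x | x) (y | y | y) <;> simp [rootM, vecE, vecF', vecMulVec_apply]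
  split_ifs <;> simp

/-- The inclusion of `2m × 2m` matrices as a linear map. -/
def inclLinear (m : ℕ) : MatD m →ₗ[ℂ] MatB m where
  toFun := incl
  map_add' Y Z := by ext (x | x) (y | y) <;> simp [incl]
  map_smul' c Y := by ext (x | x) (y | y) <;> simp [incl]

theorem inclLinear_apply {m : ℕ} (Y : MatD m) : inclLinear m Y = incl Y := rfl

/-! ### The nilpotent element and its Jordan chains -/

/-- The simple roots `e_i - e_{i+1}` that occur in the nilpotent element. -/
def simpleIndices (m r : ℕ) : Finset ℕ := (Finset.Icc 1 (m - 1)).filter fun i => i ≠ r + 1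

theorem mem_simpleIndices {m r i : ℕ} :
    i ∈ simpleIndices m r ↔ (1 ≤ i ∧ i ≤ m - 1) ∧ i ≠ r + 1 := by
  simp [simpleIndices]

section chains

variable {m r q : ℕ}

theorem incl_nilD (hm : m = r + 1 + q) :
    incl (nilD m q) = ∑ i ∈ simpleIndices m r, wedge m (vecF m i) (vecF' m (i + 1)) +
      wedge m (vecF m r) (vecF m (r + 1)) +
      (if q = 0 then 0 else wedge m (vecF m (r + 1)) (vecF m m)) := by
  have h1 : m - q = r + 1 := by omega
  rw [← inclLinear_apply, nilD, map_add, map_add, map_sum, h1]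
  congr 1
  · congr 1
    · exact Finset.sum_congr rfl fun i _ => incl_rootPM _ _ _
    · exact incl_rootPP _ _ _
  · split_ifs
    · exact map_zero _
    · exact incl_rootPP _ _ _

theorem incl_nilD_mem_so (hm : m = r + 1 + q) : incl (nilD m q) ∈ so m := by
  rw [incl_nilD hm]
  refine (so m).add_mem ((so m).add_mem ((so m).sum_mem fun _ _ => wedge_mem_so _ _)
    (wedge_mem_so _ _)) ?_
  split_ifs
  · exact (so m).zero_mem
  · exact wedge_mem_so _ _

theorem nil_mulVec_vecE (hm : m = r + 1 + q) : incl (nilD m q) *ᵥ vecE m = 0 := by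
  rw [incl_nilD hm, add_mulVec, add_mulVec, sum_mulVec]
  simp only [wedge_mulVec, pair_vecF_vecE, pair_vecF'_vecE]
  split_ifs <;> simp [wedge_mulVec, pair_vecF_vecE]

theorem sum_wedge_mulVec_vecF (hm : m = r + 1 + q) (k : ℕ) :
    (∑ i ∈ simpleIndices m r, wedge m (vecF m i) (vecF' m (i + 1))) *ᵥ vecF m (k + 1) =
      if k ∈ simpleIndices m r then vecF m k else 0 := by
  have h1 : ∀ i ∈ simpleIndices m r, wedge m (vecF m i) (vecF' m (i + 1)) *ᵥ vecF m (k + 1) =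
      if i = k then vecF m i else 0 := by
    intro i hi
    have h2 := mem_simpleIndices.1 hi
    rw [wedge_mulVec, pair_vecF'_vecF, pair_vecF_vecF]
    by_cases h : i = k
    · rw [if_pos ⟨by omega, by omega, by omega⟩, if_pos h]
      simp
    · rw [if_neg (by omega), if_neg h]
      simp
  rw [sum_mulVec, Finset.sum_congr rfl h1, Finset.sum_ite_eq']

theorem nil_mulVec_vecF (hm : m = r + 1 + q) (k : ℕ) :
    incl (nilD m q) *ᵥ vecF m (k + 1) = if k ∈ simpleIndices m r then vecF m k else 0 := by
  rw [incl_nilD hm, add_mulVec, add_mulVec, sum_wedge_mulVec_vecF hm]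
  split_ifs <;> simp [wedge_mulVec, pair_vecF_vecF]

theorem nil_mulVec_vecF' (hm : m = r + 1 + q) (hr : 1 ≤ r) (k : ℕ) :
    incl (nilD m q) *ᵥ vecF' m k =
      (if k ∈ simpleIndices m r then -vecF' m (k + 1) else 0) +
      ((if k = r + 1 then vecF m r else 0) - if k = r then vecF m (r + 1) else 0) +
      (if q = 0 then 0 else
        (if k = m then vecF m (r + 1) else 0) - if k = r + 1 then vecF m m else 0) := by
  have h1 : ∀ i ∈ simpleIndices m r, wedge m (vecF m i) (vecF' m (i + 1)) *ᵥ vecF' m k =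
      if i = k then -vecF' m (i + 1) else 0 := by
    intro i hi
    have h2 := mem_simpleIndices.1 hi
    rw [wedge_mulVec, pair_vecF_vecF', pair_vecF'_vecF']
    by_cases h : i = k
    · rw [if_pos ⟨by omega, by omega, by omega⟩, if_pos h]
      simp
    · rw [if_neg (by omega), if_neg h]
      simp
  rw [incl_nilD hm, add_mulVec, add_mulVec, sum_mulVec, Finset.sum_congr rfl h1,
    Finset.sum_ite_eq']
  congr 1
  · congr 1
    rw [wedge_mulVec, pair_vecF_vecF', pair_vecF_vecF']
    congr 1
    · by_cases h : k = r + 1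
      · rw [if_pos (by omega), if_pos h, one_smul]
      · rw [if_neg (by omega), if_neg h, zero_smul]
    · by_cases h : k = r
      · rw [if_pos h, h]
        rw [if_pos (by omega), one_smul]
      · rw [if_neg (by omega), if_neg h, zero_smul]
  · by_cases h0 : q = 0
    · rw [if_pos h0, if_pos h0, zero_mulVec]
    · rw [if_neg h0, if_neg h0, wedge_mulVec, pair_vecF_vecF', pair_vecF_vecF']
      congr 1
      · by_cases h : k = m
        · rw [if_pos (by omega), if_pos h, one_smul]
        · rw [if_neg (by omega), if_neg h, zero_smul]
      · by_cases h : k = r + 1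
        · rw [if_pos (by omega), if_pos h, one_smul]
        · rw [if_neg (by omega), if_neg h, zero_smul]

/-- The generator of the first Jordan chain. -/
def gen₁ (m : ℕ) : Vec m := vecF' m 1

/-- The vector that generates the second Jordan chain modulo the first one. -/
def gen₂ (m r q : ℕ) : Vec m := if q = 0 then -vecF m (r + 1) else vecF' m (r + 2)

theorem nil_pow_gen₁ (hm : m = r + 1 + q) (hr : 1 ≤ r) {k : ℕ} (hk : k < r) :
    incl (nilD m q) ^ k *ᵥ gen₁ m = (-1 : ℂ) ^ k • vecF' m (k + 1) := by
  induction k with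
  | zero => simp [gen₁]
  | succ k ih =>
    rw [pow_succ', ← mulVec_mulVec, ih (by omega), mulVec_smul, nil_mulVec_vecF' hm hr,
      if_pos (mem_simpleIndices.2 (by omega)), if_neg (by omega), if_neg (by omega),
      if_neg (show k + 1 ≠ m by omega), if_neg (show k + 1 ≠ r + 1 by omega)]
    simp [pow_succ]

theorem nil_pow_gen₁_mid (hm : m = r + 1 + q) (hr : 1 ≤ r) :
    incl (nilD m q) ^ r *ᵥ gen₁ m = (-1 : ℂ) ^ r • (vecF m (r + 1) + vecF' m (r + 1)) := by
  obtain ⟨k, rfl⟩ : ∃ k, r = k + 1 := ⟨r - 1, by omega⟩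
  rw [pow_succ', ← mulVec_mulVec, nil_pow_gen₁ hm hr (by omega), mulVec_smul,
    nil_mulVec_vecF' hm hr, if_pos (mem_simpleIndices.2 (by omega)), if_neg (by omega), if_pos rfl,
    if_neg (show k + 1 ≠ m by omega), if_neg (show k + 1 ≠ k + 1 + 1 by omega), pow_succ]
  simp only [sub_zero, ite_self]
  module

theorem nil_pow_vecF (hm : m = r + 1 + q) {j i : ℕ} (h : j + i ≤ r + 1) :
    incl (nilD m q) ^ j *ᵥ vecF m (j + i) = vecF m i := by
  induction j with
  | zero => simp
  | succ j ih =>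
    rw [pow_succ, ← mulVec_mulVec, show j + 1 + i = j + i + 1 by omega, nil_mulVec_vecF hm]
    split_ifs with h1
    · exact ih (by omega)
    · have h2 : j + i = 0 := by
        rw [mem_simpleIndices] at h1
        omega
      obtain ⟨rfl, rfl⟩ : j = 0 ∧ i = 0 := by omega
      ext (x | x | x) <;> simp [vecF]

theorem nil_pow_vecF_eq_zero (hm : m = r + 1 + q) {j : ℕ} (h0 : j ≠ 0) (h : j ≤ q) :
    incl (nilD m q) ^ j *ᵥ vecF m (r + 1 + j) = 0 := by
  induction j with
  | zero => exact absurd rfl h0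
  | succ j ih =>
    rw [pow_succ, ← mulVec_mulVec, ← add_assoc, nil_mulVec_vecF hm]
    split_ifs with h1
    · rw [mem_simpleIndices] at h1
      exact ih (by omega) (by omega)
    · simp

theorem vecF_zero (m : ℕ) : vecF m 0 = 0 := by
  ext (x | x | x) <;> simp [vecF]

theorem nil_pow_succ_vecF (hm : m = r + 1 + q) :
    incl (nilD m q) ^ (r + 1) *ᵥ vecF m (r + 1) = 0 := by
  have := nil_pow_vecF hm (j := r + 1) (i := 0) le_rfl
  rwa [vecF_zero] at this

theorem nil_pow_gen₂ (hm : m = r + 1 + q) (hr : 1 ≤ r) {k : ℕ} (hk : k < q) :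
    incl (nilD m q) ^ k *ᵥ gen₂ m r q = (-1 : ℂ) ^ k • vecF' m (r + 2 + k) := by
  induction k with
  | zero => simp [gen₂, hk.ne']
  | succ k ih =>
    rw [pow_succ', ← mulVec_mulVec, ih (by omega), mulVec_smul, nil_mulVec_vecF' hm hr,
      if_pos (mem_simpleIndices.2 (by omega)), if_neg (by omega), if_neg (by omega),
      if_neg (show r + 2 + k ≠ m by omega), if_neg (show r + 2 + k ≠ r + 1 by omega)]
    simp [pow_succ, add_assoc]

theorem nil_pow_gen₂_mid (hm : m = r + 1 + q) (hr : 1 ≤ r) :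
    incl (nilD m q) ^ q *ᵥ gen₂ m r q = (-1 : ℂ) ^ (q + 1) • vecF m (r + 1) := by
  rcases q with _ | k
  · simp [gen₂]
  · rw [pow_succ', ← mulVec_mulVec, nil_pow_gen₂ hm hr (by omega), mulVec_smul,
      nil_mulVec_vecF' hm hr, if_neg (by rw [mem_simpleIndices]; omega), if_neg (by omega),
      if_neg (by omega), if_neg (by omega), if_pos (by omega), if_neg (by omega), pow_succ,
      pow_succ]
    simp

/-- The generator of the second Jordan chain. -/
def gen₂' (m r q : ℕ) : Vec m :=
  gen₂ m r q + ((-1 : ℂ) ^ (r - q) / 2) • incl (nilD m q) ^ (r - q) *ᵥ gen₁ m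

theorem nil_pow_gen₂'_mid (hm : m = r + 1 + q) (hr : 1 ≤ r) (hq : q ≤ r) :
    incl (nilD m q) ^ q *ᵥ gen₂' m r q =
      ((-1 : ℂ) ^ q / 2) • (vecF' m (r + 1) - vecF m (r + 1)) := by
  rw [gen₂', mulVec_add, mulVec_smul, mulVec_mulVec, ← pow_add, Nat.add_sub_cancel' hq,
    nil_pow_gen₂_mid hm hr, nil_pow_gen₁_mid hm hr]
  have h1 : (-1 : ℂ) ^ (r - q) * (-1) ^ r = (-1) ^ q := by
    rw [← pow_add, show r - q + r = q + 2 * (r - q) by omega, pow_add, pow_mul]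
    simp
  rw [smul_smul, div_mul_eq_mul_div, h1, pow_succ]
  module

theorem nil_pow_gen₁_eq_zero (hm : m = r + 1 + q) (hr : 1 ≤ r) (hq : q ≤ r) :
    incl (nilD m q) ^ (2 * r + 1) *ᵥ gen₁ m = 0 := by
  rw [show 2 * r + 1 = r + 1 + r by omega, pow_add, ← mulVec_mulVec, nil_pow_gen₁_mid hm hr,
    mulVec_smul, mulVec_add, nil_pow_succ_vecF hm, pow_succ, ← mulVec_mulVec,
    nil_mulVec_vecF' hm hr, if_neg (by rw [mem_simpleIndices]; omega), if_pos rfl,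
    if_neg (by omega)]
  have h1 := nil_pow_vecF hm (j := r) (i := 0) (by omega)
  rw [add_zero, vecF_zero] at h1
  rcases Nat.eq_zero_or_pos q with h0 | h0
  · simp [h0] at h1 ⊢
    simp [h1]
  · rw [if_neg h0.ne', if_neg (by omega), if_pos rfl]
    have h2 := nil_pow_vecF_eq_zero hm h0.ne' le_rfl
    rw [← hm] at h2
    have h3 : incl (nilD m q) ^ r *ᵥ vecF m m = 0 := by
      rw [← Nat.sub_add_cancel hq, pow_add, ← mulVec_mulVec, h2, mulVec_zero]
    simp [mulVec_add, mulVec_neg, h1, h3]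

theorem nil_pow_gen₂'_eq_zero (hm : m = r + 1 + q) (hr : 1 ≤ r) (hq : q ≤ r) :
    incl (nilD m q) ^ (2 * q + 1) *ᵥ gen₂' m r q = 0 := by
  have hF : incl (nilD m q) *ᵥ vecF m (r + 1) = vecF m r := by
    rw [nil_mulVec_vecF hm, if_pos (mem_simpleIndices.2 (by omega))]
  rw [show 2 * q + 1 = q + 1 + q by omega, pow_add, ← mulVec_mulVec, nil_pow_gen₂'_mid hm hr hq,
    mulVec_smul, pow_succ, ← mulVec_mulVec, mulVec_sub, hF,
    nil_mulVec_vecF' hm hr, if_neg (by rw [mem_simpleIndices]; omega), if_pos rfl,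
    if_neg (by omega)]
  rcases Nat.eq_zero_or_pos q with h0 | h0
  · simp [h0]
  · rw [if_neg h0.ne', if_neg (by omega), if_pos rfl]
    have h2 := nil_pow_vecF_eq_zero hm h0.ne' le_rfl
    rw [← hm] at h2
    simp [mulVec_neg, h2]

end chains

/-! ### The grading element and the chain frame -/

/-- The values of `e_i` on the grading element. -/
def weight (m r i : ℕ) : ℂ := if i ≤ r + 1 then 2 * (r + 1 - i) else 2 * (m + 1 - i)

/-- The diagonal entries of the grading element. -/
def gradingDiag (m r : ℕ) : Vec m :=
  Sum.elim (fun _ => 0)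
    (Sum.elim (fun k => weight m r (k.val + 1)) fun k => -weight m r (k.val + 1))

/-- The grading element: the semisimple member of a Jacobson-Morozov triple of the nilpotent
element. -/
def gradingElt (m r : ℕ) : MatB m := diagonal (gradingDiag m r)

section grading

variable {m r q : ℕ}

theorem gradingElt_mulVec_vecE : gradingElt m r *ᵥ vecE m = (0 : ℂ) • vecE m := by
  ext (x | x | x) <;> simp [gradingElt, gradingDiag, mulVec_diagonal, vecE]

theorem gradingElt_mulVec_vecF (i : ℕ) :
    gradingElt m r *ᵥ vecF m i = weight m r i • vecF m i := by
  ext (x | x | x) <;> simp [gradingElt, gradingDiag, mulVec_diagonal, vecF]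
  split_ifs with h <;> simp [h]

theorem gradingElt_mulVec_vecF' (i : ℕ) :
    gradingElt m r *ᵥ vecF' m i = (-weight m r i) • vecF' m i := by
  ext (x | x | x) <;> simp [gradingElt, gradingDiag, mulVec_diagonal, vecF']
  split_ifs with h <;> simp [h]

theorem gradingElt_mem_so : gradingElt m r ∈ so m := by
  rw [mem_so_iff_pair]
  intro u w
  simp only [pair_eq, gradingElt, mulVec_diagonal, gradingDiag, Sum.elim_inl, Sum.elim_inr,
    zero_mul, zero_add, mul_zero, neg_add, ← Finset.sum_neg_distrib]
  congr 1 <;> exact Finset.sum_congr rfl fun k _ => by ring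

theorem commutator_wedge_of_weight {H : MatB m} (hH : H ∈ so m) {u w : Vec m} {α β : ℂ}
    (hu : H *ᵥ u = α • u) (hw : H *ᵥ w = β • w) :
    H * wedge m u w - wedge m u w * H = (α + β) • wedge m u w := by
  rw [commutator_wedge hH, hu, hw, map_smul, map_smul, LinearMap.smul_apply, add_smul]

/-- The nilpotent element is a sum of wedges of weight 2. -/
theorem nil_mem_of_wedge_mem (hm : m = r + 1 + q) {K : Submodule ℂ (MatB m)}
    (hK : ∀ u w : Vec m, ∀ α β : ℂ, gradingElt m r *ᵥ u = α • u → gradingElt m r *ᵥ w = β • w →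
      α + β = 2 → wedge m u w ∈ K) : incl (nilD m q) ∈ K := by
  rw [incl_nilD hm]
  refine K.add_mem (K.add_mem (K.sum_mem fun i hi => ?_) ?_) ?_
  · refine hK _ _ _ _ (gradingElt_mulVec_vecF i) (gradingElt_mulVec_vecF' _) ?_
    rw [mem_simpleIndices] at hi
    simp only [weight]
    split_ifs <;> first | omega | (push_cast; ring)
  · refine hK _ _ _ _ (gradingElt_mulVec_vecF _) (gradingElt_mulVec_vecF _) ?_
    simp [weight]
  · split_ifs with h0
    · exact K.zero_mem
    · refine hK _ _ _ _ (gradingElt_mulVec_vecF _) (gradingElt_mulVec_vecF _) ?_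
      have : ¬ m ≤ r + 1 := by omega
      simp [weight, this]

theorem commutator_nil (hm : m = r + 1 + q) :
    gradingElt m r * incl (nilD m q) - incl (nilD m q) * gradingElt m r =
      (2 : ℂ) • incl (nilD m q) := by
  let K : Submodule ℂ (MatB m) := LinearMap.eqLocus
    (LinearMap.mulLeft ℂ (gradingElt m r) - LinearMap.mulRight ℂ (gradingElt m r))
    ((2 : ℂ) • LinearMap.id)
  refine nil_mem_of_wedge_mem (K := K) hm fun u w α β hu hw h => ?_
  change gradingElt m r * wedge m u w - wedge m u w * gradingElt m r = (2 : ℂ) • wedge m u w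
  rw [← h]
  exact commutator_wedge_of_weight gradingElt_mem_so hu hw

theorem mulVec_pow_of_weight {H X : MatB m} (hHX : H * X - X * H = (2 : ℂ) • X) {u : Vec m} {α : ℂ}
    (hu : H *ᵥ u = α • u) (k : ℕ) : H *ᵥ X ^ k *ᵥ u = (α + 2 * k) • X ^ k *ᵥ u := by
  induction k with
  | zero => simp [hu]
  | succ k ih =>
    have h1 : H * X = X * H + (2 : ℂ) • X := by rw [← hHX]; abel
    rw [pow_succ', ← mulVec_mulVec, mulVec_mulVec _ H, h1, add_mulVec, ← mulVec_mulVec, ih,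
      smul_mulVec, mulVec_smul, ← add_smul]
    congr 1
    push_cast
    ring

theorem pair_eq_zero_of_weight {H : MatB m} (hH : H ∈ so m) {u w : Vec m} {α β : ℂ}
    (hu : H *ᵥ u = α • u) (hw : H *ᵥ w = β • w) (h : α + β ≠ 0) : pair m u w = 0 := by
  have h1 := pair_mulVec_left hH u w
  rw [hu, hw, map_smul, map_smul, LinearMap.smul_apply, smul_eq_mul, smul_eq_mul] at h1
  have h2 : (α + β) * pair m u w = 0 := by linear_combination h1
  exact (mul_eq_zero.1 h2).resolve_left h

theorem gradingElt_mulVec_gen₁ : gradingElt m r *ᵥ gen₁ m = (-(2 * r) : ℂ) • gen₁ m := by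
  rw [gen₁, gradingElt_mulVec_vecF']
  congr 1
  simp [weight]

theorem gradingElt_mulVec_gen₂ (hm : m = r + 1 + q) :
    gradingElt m r *ᵥ gen₂ m r q = (-(2 * q) : ℂ) • gen₂ m r q := by
  rw [gen₂]
  split_ifs with h
  · rw [mulVec_neg, gradingElt_mulVec_vecF]
    simp [weight, h]
  · rw [gradingElt_mulVec_vecF']
    congr 1
    simp [weight, hm]
    ring

theorem gradingElt_mulVec_gen₂' (hm : m = r + 1 + q) (hq : q ≤ r) :
    gradingElt m r *ᵥ gen₂' m r q = (-(2 * q) : ℂ) • gen₂' m r q := by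
  rw [gen₂', mulVec_add, mulVec_smul, gradingElt_mulVec_gen₂ hm,
    mulVec_pow_of_weight (commutator_nil hm) gradingElt_mulVec_gen₁, Nat.cast_sub hq]
  module

/-- The Jordan chains of the nilpotent element of the slice form a chain frame. -/
theorem nil_chainFrame (hm : m = r + 1 + q) (hr : 1 ≤ r) (hq : q ≤ r) :
    ChainFrame m (incl (nilD m q)) ![2 * r + 1, 2 * q + 1, 1] ![gen₁ m, gen₂' m r q, vecE m]
      ![(-1) ^ r * 2, (-1) ^ q * (-1 / 2), 1] := by
  have hX : incl (nilD m q) ∈ so m := incl_nilD_mem_so hm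
  have hHX := commutator_nil hm
  have hE : incl (nilD m q) *ᵥ vecE m = 0 := nil_mulVec_vecE hm
  have w₁ := gradingElt_mulVec_gen₁ (m := m) (r := r)
  have w₂ := gradingElt_mulVec_gen₂' hm hq
  have hH : gradingElt m r ∈ so m := gradingElt_mem_so
  have mid : ∀ (u w : Vec m) (i j : ℕ), pair m u (incl (nilD m q) ^ (i + j) *ᵥ w) =
      (-1) ^ i * pair m (incl (nilD m q) ^ i *ᵥ u) (incl (nilD m q) ^ j *ᵥ w) := by
    intro u w i j
    rw [pair_pow_left hX, ← mul_assoc, ← mul_pow, mulVec_mulVec, ← pow_add]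
    simp
  have h1 : True ∧ 1 ≤ r + 1 ∧ r + 1 ≤ m := ⟨trivial, by omega, by omega⟩
  -- Pairings of vectors of the chains vanish unless the weights are opposite.
  have g₁₁ : ∀ k, pair m (gen₁ m) (incl (nilD m q) ^ k *ᵥ gen₁ m) =
      if k = 2 * r then (-1) ^ r * 2 else 0 := by
    intro k
    split_ifs with hk
    · rw [hk, two_mul, mid, nil_pow_gen₁_mid hm hr]
      simp only [map_smul, LinearMap.smul_apply, map_add, LinearMap.add_apply, pair_vecF_vecF,
        pair_vecF_vecF', pair_vecF'_vecF, pair_vecF'_vecF']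
      rw [if_pos h1]
      have h2 : (-1 : ℂ) ^ r * (-1) ^ r = 1 := by rw [← mul_pow]; simp
      simp only [smul_eq_mul]
      linear_combination (-1 : ℂ) ^ r * 2 * h2
    · refine pair_eq_zero_of_weight hH w₁ (mulVec_pow_of_weight hHX w₁ k) fun h => hk ?_
      have h1 : (k : ℂ) = (2 * r : ℕ) := by push_cast; linear_combination h / 2
      exact_mod_cast h1
  have g₂₂ : ∀ k, pair m (gen₂' m r q) (incl (nilD m q) ^ k *ᵥ gen₂' m r q) =
      if k = 2 * q then (-1) ^ q * (-1 / 2) else 0 := by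
    intro k
    split_ifs with hk
    · rw [hk, two_mul, mid, nil_pow_gen₂'_mid hm hr hq]
      simp only [map_smul, LinearMap.smul_apply, map_sub, LinearMap.sub_apply, pair_vecF_vecF,
        pair_vecF_vecF', pair_vecF'_vecF, pair_vecF'_vecF']
      rw [if_pos h1]
      have h2 : (-1 : ℂ) ^ q * (-1) ^ q = 1 := by rw [← mul_pow]; simp
      simp only [smul_eq_mul]
      linear_combination (-1 : ℂ) ^ q / (-2) * h2
    · refine pair_eq_zero_of_weight hH w₂ (mulVec_pow_of_weight hHX w₂ k) fun h => hk ?_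
      have h1 : (k : ℂ) = (2 * q : ℕ) := by push_cast; linear_combination h / 2
      exact_mod_cast h1
  have g₁₂ : ∀ k, pair m (gen₁ m) (incl (nilD m q) ^ k *ᵥ gen₂' m r q) = 0 := by
    intro k
    by_cases hk : k = r + q
    · rw [hk, mid, nil_pow_gen₁_mid hm hr, nil_pow_gen₂'_mid hm hr hq]
      simp [pair_vecF_vecF, pair_vecF_vecF', pair_vecF'_vecF, pair_vecF'_vecF']
    · refine pair_eq_zero_of_weight hH w₁ (mulVec_pow_of_weight hHX w₂ k) fun h => hk ?_
      have h1 : (k : ℂ) = (r + q : ℕ) := by push_cast; linear_combination h / 2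
      exact_mod_cast h1
  have g₂₁ : ∀ k, pair m (gen₂' m r q) (incl (nilD m q) ^ k *ᵥ gen₁ m) = 0 := by
    intro k
    have h1 := mid (gen₂' m r q) (gen₁ m) k 0
    rw [add_zero, pow_zero, one_mulVec, pair_comm (_ *ᵥ _), g₁₂, mul_zero] at h1
    exact h1
  have gE : ∀ u, pair m (vecE m) u = 0 → ∀ k, pair m (vecE m) (incl (nilD m q) ^ k *ᵥ u) = 0 := by
    intro u hu k
    rcases k with _ | k
    · simpa using hu
    · have h1 := mid (vecE m) u (k + 1) 0
      rw [add_zero, pow_succ, ← mulVec_mulVec _ _ (incl (nilD m q)) , ← mulVec_mulVec, hE] at h1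
      rw [pow_succ, ← mulVec_mulVec, h1]
      simp
  have gE' : ∀ u, pair m (vecE m) u = 0 → ∀ k, pair m u (incl (nilD m q) ^ k *ᵥ vecE m) = 0 := by
    intro u hu k
    rcases k with _ | k
    · rw [pow_zero, one_mulVec, pair_comm, hu]
    · rw [pow_succ, ← mulVec_mulVec, hE, mulVec_zero, map_zero]
  have gEE : ∀ k, pair m (vecE m) (incl (nilD m q) ^ k *ᵥ vecE m) = if k = 0 then 1 else 0 := by
    intro k
    rcases k with _ | k
    · simp [pair_vecE_vecE]
    · rw [pow_succ, ← mulVec_mulVec, hE, mulVec_zero, map_zero, if_neg (by omega)]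
  have hE₁ : pair m (vecE m) (gen₁ m) = 0 := pair_vecE_vecF' _ _
  have hE₂ : pair m (vecE m) (gen₂' m r q) = 0 := by
    rw [gen₂', map_add, map_smul, gE _ hE₁, gen₂]
    split_ifs <;> simp [pair_vecE_vecF, pair_vecE_vecF']
  refine ⟨hX, ?_, ?_, ?_, ?_⟩
  · simp [Fin.sum_univ_three]
    omega
  · intro i
    fin_cases i <;> simp
  · intro i
    fin_cases i
    · exact nil_pow_gen₁_eq_zero hm hr hq
    · exact nil_pow_gen₂'_eq_zero hm hr hq
    · simpa using hE
  · intro i j k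
    fin_cases i <;> fin_cases j <;> simp [g₁₁, g₂₂, g₁₂, g₂₁, gE, gE', gEE, hE₁, hE₂]

end grading

/-! ### The slice in terms of the Jordan chains -/

theorem sum_Icc_one {M : Type*} [AddCommMonoid M] (n : ℕ) (f : ℕ → M) :
    ∑ i ∈ Finset.Icc 1 n, f i = ∑ i : Fin n, f (i + 1) := by
  rw [Fin.sum_univ_eq_sum_range fun i => f (i + 1), Finset.range_eq_Ico, Finset.sum_Ico_add' f]
  rfl

/-- The space of parameters of the slice. -/
abbrev Params (r q : ℕ) : Type :=
  (Fin r → ℂ) × (Fin q → ℂ) × (Fin q → ℂ) × (Fin (q + 1) → ℂ) × ℂ × ℂ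

/-- The directions of the slice, as wedges of vectors of the Jordan chains of `X` generated by `v`
and `u`; the coordinate `a₀` is carried by `e ∧ ρ`. -/
def direction {m : ℕ} (X : MatB m) (v u ρ : Vec m) (r q : ℕ) : Params r q →ₗ[ℂ] MatB m where
  toFun x :=
    ∑ k : Fin r, x.1 k • wedge m (X ^ k.val *ᵥ v) (X ^ (k.val + 1) *ᵥ v) +
    ∑ k : Fin q, x.2.1 k • wedge m (X ^ k.val *ᵥ u) (X ^ (k.val + 1) *ᵥ u) +
    ∑ k : Fin q, x.2.2.1 k • wedge m v (X ^ k.val *ᵥ u) +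
    ∑ k : Fin (q + 1), x.2.2.2.1 k • wedge m (X ^ q *ᵥ u) (X ^ k.val *ᵥ v) +
    x.2.2.2.2.1 • wedge m (vecE m) ρ + x.2.2.2.2.2 • wedge m (vecE m) v
  map_add' x y := by
    simp only [Prod.fst_add, Prod.snd_add, Pi.add_apply, add_smul, Finset.sum_add_distrib]
    abel
  map_smul' c x := by
    simp only [Prod.smul_fst, Prod.smul_snd, Pi.smul_apply, smul_eq_mul, mul_smul,
      ← Finset.smul_sum, smul_add, RingHom.id_apply]

theorem direction_apply {m : ℕ} (X : MatB m) (v u ρ : Vec m) {r q : ℕ} (x : Params r q) :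
    direction X v u ρ r q x =
    ∑ k : Fin r, x.1 k • wedge m (X ^ k.val *ᵥ v) (X ^ (k.val + 1) *ᵥ v) +
    ∑ k : Fin q, x.2.1 k • wedge m (X ^ k.val *ᵥ u) (X ^ (k.val + 1) *ᵥ u) +
    ∑ k : Fin q, x.2.2.1 k • wedge m v (X ^ k.val *ᵥ u) +
    ∑ k : Fin (q + 1), x.2.2.2.1 k • wedge m (X ^ q *ᵥ u) (X ^ k.val *ᵥ v) +
    x.2.2.2.2.1 • wedge m (vecE m) ρ + x.2.2.2.2.2 • wedge m (vecE m) v := rfl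

section slice

variable {m r q : ℕ}

/-- The coordinates of the slice, with the signs that turn root vectors into wedges of chain
vectors. -/
def signedParams (r q : ℕ) (a y z d : ℕ → ℂ) (a₀ d₀ : ℂ) : Params r q :=
  (fun k => -d (r - k), fun k => -a (q - k), fun k => (-1) ^ k.val * y (k + 1),
    fun k => (-1) ^ (q + k.val) * z (k + 1), (Real.sqrt 2 : ℂ) * a₀, -(d₀ / (Real.sqrt 2 : ℂ)))

theorem signedParams_surjective (x : Params r q) :
    ∃ a y z d a₀ d₀, signedParams r q a y z d a₀ d₀ = x := by
  obtain ⟨x₁, x₂, x₃, x₄, x₅, x₆⟩ := x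
  have h2 : (Real.sqrt 2 : ℂ) ≠ 0 := by simp
  have hs : ∀ k : ℕ, (-1 : ℂ) ^ k * (-1) ^ k = 1 := fun k => by rw [← mul_pow]; simp
  refine ⟨fun i => if h : q - i < q then -x₂ ⟨q - i, h⟩ else 0,
    fun i => if h : i - 1 < q then (-1) ^ (i - 1) * x₃ ⟨i - 1, h⟩ else 0,
    fun i => if h : i - 1 < q + 1 then (-1) ^ (q + (i - 1)) * x₄ ⟨i - 1, h⟩ else 0,
    fun i => if h : r - i < r then -x₁ ⟨r - i, h⟩ else 0, x₅ / (Real.sqrt 2 : ℂ),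
    -(x₆ * (Real.sqrt 2 : ℂ)), ?_⟩
  refine Prod.ext (funext fun k => ?_) (Prod.ext (funext fun k => ?_) (Prod.ext (funext fun k => ?_)
    (Prod.ext (funext fun k => ?_) (Prod.ext ?_ ?_))))
  · have hk := k.isLt
    have h1 : r - (r - k.val) = k.val := by omega
    simp [signedParams, h1, show 0 < r by omega]
  · have hk := k.isLt
    have h1 : q - (q - k.val) = k.val := by omega
    simp [signedParams, h1, show 0 < q by omega]
  · simp [signedParams, ← mul_assoc, hs]
  · have hk := k.isLt
    simp only [signedParams, Nat.add_sub_cancel, hk, dif_pos, ← mul_assoc, hs, one_mul]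
  · simp only [signedParams]
    field_simp
  · simp only [signedParams]
    field_simp

theorem incl_eltD (hm : m = r + 1 + q) (a y z d : ℕ → ℂ) :
    incl (eltD m q a y z d) = incl (nilD m q) +
    (if q = 0 then 0 else a 1 • wedge m (vecF m (r + 1)) (vecF' m m)) -
    d 1 • wedge m (vecF m (r + 1)) (vecF' m r) +
    ∑ i ∈ Finset.Icc 1 (q - 1), a (q - i + 1) •
      wedge m (vecF' m (r + 1 + i)) (vecF' m (r + 1 + i + 1)) +
    ∑ i ∈ Finset.Icc 1 q, y i • wedge m (vecF' m 1) (vecF' m (r + 1 + i)) -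
    ∑ j ∈ Finset.Icc 1 (q + 1), z j • wedge m (vecF m (r + 1)) (vecF' m j) +
    ∑ k ∈ Finset.Icc 1 r, d (r + 1 - k) • wedge m (vecF' m k) (vecF' m (k + 1)) := by
  have h1 : m - q = r + 1 := by omega
  simp only [← inclLinear_apply]
  rw [eltD, h1, Nat.add_sub_cancel]
  simp only [map_add, map_sub, map_sum, map_smul, apply_ite (inclLinear m), map_zero]
  simp only [inclLinear_apply, incl_rootPM, incl_rootMM]

theorem incl_eltD_add_vecV (hm : m = r + 1 + q) (hr : 1 ≤ r) (hq : q ≤ r) {R : MatB m} {ρ : Vec m}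
    (hR : R = wedge m (vecE m) ρ) (a y z d : ℕ → ℂ) (a₀ d₀ : ℂ) :
    incl (eltD m q a y z d) + vecV R a₀ d₀ = incl (nilD m q) +
      direction (incl (nilD m q)) (gen₁ m) (gen₂ m r q) ρ r q (signedParams r q a y z d a₀ d₀) := by
  have hs : ∀ k : ℕ, (-1 : ℂ) ^ k * (-1) ^ k = 1 := fun k => by rw [← mul_pow]; simp
  have p₁ := fun k (hk : k < r) => nil_pow_gen₁ hm hr hk
  have p₁' := nil_pow_gen₁_mid hm hr
  have p₂ := fun k (hk : k < q) => nil_pow_gen₂ hm hr hk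
  have p₂' := nil_pow_gen₂_mid hm hr
  -- The coordinates `d`; the top one combines two root vectors.
  have D : -(d 1 • wedge m (vecF m (r + 1)) (vecF' m r)) +
      ∑ k ∈ Finset.Icc 1 r, d (r + 1 - k) • wedge m (vecF' m k) (vecF' m (k + 1)) =
      ∑ k : Fin r, -d (r - k) • wedge m (incl (nilD m q) ^ k.val *ᵥ gen₁ m)
        (incl (nilD m q) ^ (k.val + 1) *ᵥ gen₁ m) := by
    obtain ⟨s, rfl⟩ : ∃ s, r = s + 1 := ⟨r - 1, by omega⟩
    rw [sum_Icc_one, Fin.sum_univ_castSucc, Fin.sum_univ_castSucc, add_left_comm]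
    congr 1
    · refine Finset.sum_congr rfl fun k _ => ?_
      have hk := k.isLt
      rw [Fin.val_castSucc, p₁ _ (by omega), p₁ _ (by omega), map_smul, map_smul,
        LinearMap.smul_apply, smul_smul, smul_smul, pow_succ]
      congr 1
      · rw [show s + 1 + 1 - (k.val + 1) = s + 1 - k.val by omega]
        linear_combination -d (s + 1 - k) * hs k
    · rw [Fin.val_last, p₁ _ (by omega), p₁', map_smul, map_smul, LinearMap.smul_apply, smul_smul,
        smul_smul, pow_succ, show s + 1 + 1 - (s + 1) = 1 by omega, show s + 1 - s = 1 by omega,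
        map_add, wedge_swap (vecF m _) (vecF' m _),
        show -d 1 * ((-1 : ℂ) ^ s * -1) * (-1) ^ s = d 1 by linear_combination d 1 * hs s]
      module
  have A : (if q = 0 then 0 else a 1 • wedge m (vecF m (r + 1)) (vecF' m m)) +
      ∑ i ∈ Finset.Icc 1 (q - 1), a (q - i + 1) •
        wedge m (vecF' m (r + 1 + i)) (vecF' m (r + 1 + i + 1)) =
      ∑ k : Fin q, -a (q - k) • wedge m (incl (nilD m q) ^ k.val *ᵥ gen₂ m r q)
        (incl (nilD m q) ^ (k.val + 1) *ᵥ gen₂ m r q) := by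
    rcases q with _ | s
    · simp
    · rw [if_neg (by omega), Nat.add_sub_cancel, sum_Icc_one, Fin.sum_univ_castSucc, add_comm]
      congr 1
      · refine Finset.sum_congr rfl fun k _ => ?_
        have hk := k.isLt
        rw [Fin.val_castSucc, p₂ _ (by omega), p₂ _ (by omega), map_smul, map_smul,
          LinearMap.smul_apply, smul_smul, smul_smul, pow_succ]
        congr 1
        · rw [show s + 1 - (k.val + 1) + 1 = s + 1 - k.val by omega]
          linear_combination -a (s + 1 - k) * hs k
        · rw [show r + 1 + (k.val + 1) = r + 2 + k.val by omega]
          rfl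
      · rw [Fin.val_last, p₂ _ (by omega), p₂', map_smul, map_smul, LinearMap.smul_apply, smul_smul,
          smul_smul, pow_succ, pow_succ, show s + 1 - s = 1 by omega,
          wedge_swap (vecF m _) (vecF' m _), show r + 2 + s = m by omega,
          show -a 1 * ((-1 : ℂ) ^ s * -1 * -1) * (-1) ^ s = -a 1 by linear_combination -a 1 * hs s]
        module
  have Y : ∑ i ∈ Finset.Icc 1 q, y i • wedge m (vecF' m 1) (vecF' m (r + 1 + i)) =
      ∑ k : Fin q, ((-1) ^ k.val * y (k + 1)) • wedge m (gen₁ m)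
        (incl (nilD m q) ^ k.val *ᵥ gen₂ m r q) := by
    rw [sum_Icc_one]
    refine Finset.sum_congr rfl fun k _ => ?_
    rw [p₂ _ k.isLt, map_smul, smul_smul, gen₁]
    congr 1
    · linear_combination -y (k + 1) * hs k
    · congr 2
      omega
  -- In the middle degree `f'_{r+1}` may be replaced by `f_{r+1} + f'_{r+1}`.
  have Z : -∑ j ∈ Finset.Icc 1 (q + 1), z j • wedge m (vecF m (r + 1)) (vecF' m j) =
      ∑ k : Fin (q + 1), ((-1) ^ (q + k.val) * z (k + 1)) •
        wedge m (incl (nilD m q) ^ q *ᵥ gen₂ m r q) (incl (nilD m q) ^ k.val *ᵥ gen₁ m) := by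
    rw [sum_Icc_one, ← Finset.sum_neg_distrib]
    refine Finset.sum_congr rfl fun k _ => ?_
    have h1 : wedge m (vecF m (r + 1)) (incl (nilD m q) ^ k.val *ᵥ gen₁ m) =
        (-1 : ℂ) ^ k.val • wedge m (vecF m (r + 1)) (vecF' m (k + 1)) := by
      have hk := k.isLt
      rcases lt_or_eq_of_le (show k.val ≤ r by omega) with h | h
      · rw [p₁ _ h, map_smul]
      · rw [h, p₁', map_smul, map_add, wedge_self, zero_add]
    rw [p₂', map_smul, LinearMap.smul_apply, h1, smul_smul, smul_smul, ← neg_smul]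
    congr 1
    rw [pow_add, pow_succ]
    linear_combination z (k + 1) * hs q + z (k + 1) * ((-1) ^ q * (-1) ^ q) * hs k
  rw [incl_eltD hm, direction_apply]
  simp only [signedParams]
  rw [← D, ← A, ← Y, ← Z, vecV, hR, rootM_eq, gen₁]
  module

theorem sliceB_eq (hm : m = r + 1 + q) (hr : 1 ≤ r) (hq : q ≤ r) {R : MatB m} {ρ : Vec m}
    (hR : R = wedge m (vecE m) ρ) :
    sliceB m (q + 1) R = {Y | ∃ v ∈ LinearMap.range
      (direction (incl (nilD m q)) (gen₁ m) (gen₂ m r q) ρ r q), Y = incl (nilD m q) + v} := by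
  ext Y
  constructor
  · rintro ⟨_, ⟨a, y, z, d, rfl⟩, a₀, d₀, rfl⟩
    exact ⟨_, ⟨_, rfl⟩, incl_eltD_add_vecV hm hr hq hR a y z d a₀ d₀⟩
  · rintro ⟨_, ⟨x, rfl⟩, rfl⟩
    obtain ⟨a, y, z, d, a₀, d₀, rfl⟩ := signedParams_surjective x
    exact ⟨_, ⟨a, y, z, d, rfl⟩, a₀, d₀, (incl_eltD_add_vecV hm hr hq hR a y z d a₀ d₀).symm⟩

end slice

/-! ### Transversality of the slice -/

section slice

variable {m r q : ℕ}

theorem isTransverseSlice_of_mem (hm : m = r + 1 + q) (hr : 1 ≤ r) (hq : q ≤ r) {R : MatB m}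
    {ρ : Vec m} (hR : R = wedge m (vecE m) ρ)
    (hρ : wedge m (vecE m) (gen₂ m r q) ∈
      Submodule.span ℂ {R} ⊔ bracketRange m (incl (nilD m q))) :
    IsTransverseSlice m (sliceB m (q + 1) R) (incl (nilD m q)) := by
  have hF := nil_chainFrame hm hr hq
  set X := incl (nilD m q)
  set f := direction X (gen₁ m) (gen₂ m r q) ρ r q
  refine ⟨LinearMap.range f, sliceB_eq hm hr hq hR, ?_⟩
  rw [orbitTangent_eq]
  have mem : ∀ A, (∃ x, f x = A) → A ∈ LinearMap.range f ⊔ bracketRange m X := fun A hA =>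
    Submodule.mem_sup_left hA
  refine hF.inf_eq_bot_and_sup_eq hq ?_ ?_ (hF.so_le_of_mem (u := gen₂ m r q)
    (r := -((-1 : ℂ) ^ (r - q) / 2)) (s := r - q) ?_ le_sup_right ?_ ?_ ?_ ?_ ?_ ?_)
  · rintro _ ⟨x, rfl⟩
    simp only [f, direction_apply]
    have h := fun (c : ℂ) (u w : Vec m) => (so m).smul_mem c (wedge_mem_so u w)
    exact (so m).add_mem ((so m).add_mem ((so m).add_mem ((so m).add_mem ((so m).add_mem
      ((so m).sum_mem fun _ _ => h _ _ _) ((so m).sum_mem fun _ _ => h _ _ _))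
      ((so m).sum_mem fun _ _ => h _ _ _)) ((so m).sum_mem fun _ _ => h _ _ _)) (h _ _ _)) (h _ _ _)
  · refine (LinearMap.finrank_range_le f).trans (le_of_eq ?_)
    simp only [Module.finrank_prod, Module.finrank_fin_fun, Module.finrank_self]
    ring
  · rw [gen₂']
    module
  · exact fun k hk => mem _ ⟨(Pi.single ⟨k, hk⟩ 1, 0, 0, 0, 0, 0), by
      simp [f, direction_apply, Pi.single_apply]⟩
  · exact fun k hk => mem _ ⟨(0, Pi.single ⟨k, hk⟩ 1, 0, 0, 0, 0), by
      simp [f, direction_apply, Pi.single_apply]⟩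
  · exact fun k hk => mem _ ⟨(0, 0, Pi.single ⟨k, hk⟩ 1, 0, 0, 0), by
      simp [f, direction_apply, Pi.single_apply]⟩
  · exact fun k hk => mem _ ⟨(0, 0, 0, Pi.single ⟨k, by omega⟩ 1, 0, 0), by
      simp [f, direction_apply, Pi.single_apply]⟩
  · exact mem _ ⟨(0, 0, 0, 0, 0, 1), by simp [f, direction_apply]⟩
  · refine sup_le_sup_right (?_ : Submodule.span ℂ {R} ≤ LinearMap.range f) _ hρ
    rw [Submodule.span_singleton_le_iff_mem]
    exact ⟨(0, 0, 0, 0, 1, 0), by simp [f, direction_apply, hR]⟩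

theorem shortRoot_eq (hm : m = r + 1 + q) :
    shortRoot m (q + 1) = wedge m (vecE m) (gen₂ m r q) := by
  rw [shortRoot, gen₂]
  rcases Nat.eq_zero_or_pos q with rfl | h0
  · rw [if_pos rfl, if_pos rfl, rootP_eq, map_neg, show m = r + 1 by omega]
  · rw [if_neg (by omega), if_neg h0.ne', rootM_eq, show m - (q + 1) + 2 = r + 2 by omega]

theorem isTransverseSlice_shortRoot (hm : m = r + 1 + q) (hr : 1 ≤ r) (hq : q ≤ r) :
    IsTransverseSlice m (sliceB m (q + 1) (shortRoot m (q + 1))) (incl (nilD m q)) := by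
  refine isTransverseSlice_of_mem hm hr hq (shortRoot_eq hm) (Submodule.mem_sup_left ?_)
  rw [← shortRoot_eq hm]
  exact Submodule.mem_span_singleton_self _

theorem isTransverseSlice_rootM (hm : m = r + 1) (hr : 1 ≤ r) :
    IsTransverseSlice m (sliceB m 1 (-rootM m m)) (incl (nilD m 0)) := by
  have hm' : m = r + 1 + 0 := hm
  have hR : -rootM m m = wedge m (vecE m) (-vecF' m m) := by rw [rootM_eq, map_neg]
  refine isTransverseSlice_of_mem hm' hr (Nat.zero_le r) hR ?_
  -- `f_m` and `-f'_m` differ by a multiple of `x ^ r f'_1`, and `e ∧ x ^ r f'_1` is tangent.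
  have hX := incl_nilD_mem_so hm'
  set X := incl (nilD m 0)
  have h1 : wedge m (vecE m) (X ^ r *ᵥ gen₁ m) ∈ bracketRange m X := by
    obtain ⟨s, rfl⟩ : ∃ s, r = s + 1 := ⟨r - 1, by omega⟩
    have h2 := (wedge_pow_mem_iff hX le_rfl (vecE m) (gen₁ m) (s + 1) 0).1 (by
      rw [pow_succ, ← mulVec_mulVec, nil_mulVec_vecE hm', mulVec_zero, map_zero]
      exact (bracketRange m X).zero_mem)
    exact h2
  have h3 : wedge m (vecE m) (gen₂ m r 0) =
      (-1 : ℂ) • -rootM m m + (-(-1 : ℂ) ^ r) • wedge m (vecE m) (X ^ r *ᵥ gen₁ m) := by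
    have hs : (-1 : ℂ) ^ r * (-1) ^ r = 1 := by rw [← mul_pow]; simp
    rw [hR, nil_pow_gen₁_mid hm' hr, gen₂, if_pos rfl, map_smul, smul_smul, neg_mul, hs, ← hm,
      map_add, map_neg, map_neg]
    module
  rw [h3]
  exact Submodule.add_mem_sup
    (Submodule.smul_mem _ _ (Submodule.mem_span_singleton_self _)) (Submodule.smul_mem _ _ h1)

/-! ### Invariance under the contracting action -/

theorem SO_conj_wedge {g : MatB m} (hg : g ∈ SO m) (u w : Vec m) :
    g * wedge m u w * g⁻¹ = wedge m (g *ᵥ u) (g *ᵥ w) := by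
  have h1 : ∀ u y : Vec m, pair m u (g⁻¹ *ᵥ y) = pair m (g *ᵥ u) y := by
    intro u y
    rw [SO_inv hg, pair_apply, pair_apply, ← mulVec_mulVec, ← mulVec_mulVec,
      form_mulVec_form_mulVec, dotProduct_mulVec, vecMul_transpose]
  refine eq_of_forall_mulVec fun y => ?_
  rw [← mulVec_mulVec, ← mulVec_mulVec, wedge_mulVec, wedge_mulVec, mulVec_sub, mulVec_smul,
    mulVec_smul, h1, h1]

theorem exp_gradingElt_mulVec (c : ℂ) {u : Vec m} {α : ℂ} (hu : gradingElt m r *ᵥ u = α • u) :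
    NormedSpace.exp (c • gradingElt m r) *ᵥ u = Complex.exp (c * α) • u := by
  have h1 : c • gradingElt m r = diagonal (c • gradingDiag m r) := by
    rw [gradingElt, diagonal_smul]
  rw [h1, Matrix.exp_diagonal]
  ext i
  have h2 := congrFun hu i
  rw [gradingElt, mulVec_diagonal, Pi.smul_apply, smul_eq_mul] at h2
  rw [mulVec_diagonal, Pi.smul_apply, smul_eq_mul, Pi.coe_exp, Pi.smul_apply, smul_eq_mul,
    ← Complex.exp_eq_exp_ℂ]
  by_cases h3 : u i = 0
  · simp [h3]
  · rw [mul_right_cancel₀ h3 h2]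

/-- The action of `exp w` as a linear map. -/
def lambdaLinear (H : MatB m) (w : ℂ) : MatB m →ₗ[ℂ] MatB m where
  toFun := lambdaAct H w
  map_add' Y Z := by simp [lambdaAct, Matrix.mul_add, Matrix.add_mul]
  map_smul' c Y := by simp [lambdaAct, smul_comm c]

theorem lambdaLinear_wedge (t : ℂ) {u w : Vec m} {α β : ℂ} (hu : gradingElt m r *ᵥ u = α • u)
    (hw : gradingElt m r *ᵥ w = β • w) :
    lambdaLinear (gradingElt m r) t (wedge m u w) =
      Complex.exp (t * (1 - (α + β) / 2)) • wedge m u w := by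
  have h1 : NormedSpace.exp ((t / 2) • gradingElt m r) =
      (NormedSpace.exp (-(t / 2) • gradingElt m r))⁻¹ := by
    rw [← Matrix.exp_neg, neg_smul, neg_neg]
  change Complex.exp t • (NormedSpace.exp (-(t / 2) • gradingElt m r) * wedge m u w *
    NormedSpace.exp ((t / 2) • gradingElt m r)) = _
  rw [h1, SO_conj_wedge (exp_mem_SO gradingElt_mem_so _), exp_gradingElt_mulVec _ hu,
    exp_gradingElt_mulVec _ hw, map_smul, map_smul, LinearMap.smul_apply, smul_smul, smul_smul,
    ← Complex.exp_add, ← Complex.exp_add]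
  congr 2
  ring

theorem lambdaLinear_nil (hm : m = r + 1 + q) (t : ℂ) :
    lambdaLinear (gradingElt m r) t (incl (nilD m q)) = incl (nilD m q) := by
  let K : Submodule ℂ (MatB m) := LinearMap.eqLocus (lambdaLinear (gradingElt m r) t) LinearMap.id
  have hK : ∀ u w : Vec m, ∀ α β : ℂ, gradingElt m r *ᵥ u = α • u → gradingElt m r *ᵥ w = β • w →
      α + β = 2 → wedge m u w ∈ K := by
    intro u w α β hu hw h
    change lambdaLinear (gradingElt m r) t (wedge m u w) = wedge m u w
    rw [lambdaLinear_wedge t hu hw, h]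
    simp
  exact nil_mem_of_wedge_mem hm hK

theorem isLambdaInvariant_of_weight (hm : m = r + 1 + q) (hr : 1 ≤ r) (hq : q ≤ r) {R : MatB m}
    {ρ : Vec m} (hR : R = wedge m (vecE m) ρ) {α : ℂ} (hρ : gradingElt m r *ᵥ ρ = α • ρ) :
    IsLambdaInvariant m (sliceB m (q + 1) R) (incl (nilD m q)) := by
  have hF := nil_chainFrame hm hr hq
  obtain ⟨N, hN⟩ := hF.exists_jmTriple (gradingElt_mem_so (r := r)) (commutator_nil hm) (by
    intro i
    fin_cases i
    · refine gradingElt_mulVec_gen₁.trans ?_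
      simp
    · refine (gradingElt_mulVec_gen₂' hm hq).trans ?_
      simp
    · refine gradingElt_mulVec_vecE.trans ?_
      simp)
  refine ⟨gradingElt m r, N, hN, fun t Y hY => ?_⟩
  rw [sliceB_eq hm hr hq hR] at hY ⊢
  obtain ⟨_, ⟨x, rfl⟩, rfl⟩ := hY
  have h₁ := mulVec_pow_of_weight (commutator_nil hm) (gradingElt_mulVec_gen₁ (m := m) (r := r))
  have h₂ := mulVec_pow_of_weight (commutator_nil hm) (gradingElt_mulVec_gen₂ hm)
  have h₁' := gradingElt_mulVec_gen₁ (m := m) (r := r)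
  have hE := gradingElt_mulVec_vecE (m := m) (r := r)
  have hl := fun (u w : Vec m) (α β : ℂ) (hu : gradingElt m r *ᵥ u = α • u)
    (hw : gradingElt m r *ᵥ w = β • w) => lambdaLinear_wedge t hu hw
  change ∃ v ∈ _, lambdaLinear (gradingElt m r) t _ = _
  -- Each coordinate is multiplied by a character of the torus.
  let c : ℂ → ℂ → ℂ := fun α β => Complex.exp (t * (1 - (α + β) / 2))
  refine ⟨_, ⟨(fun k => c (-(2 * r) + 2 * k) (-(2 * r) + 2 * (k + 1 : ℕ)) * x.1 k,
    fun k => c (-(2 * q) + 2 * k) (-(2 * q) + 2 * (k + 1 : ℕ)) * x.2.1 k,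
    fun k => c (-(2 * r)) (-(2 * q) + 2 * k) * x.2.2.1 k,
    fun k => c (-(2 * q) + 2 * q) (-(2 * r) + 2 * k) * x.2.2.2.1 k,
    c 0 α * x.2.2.2.2.1, c 0 (-(2 * r)) * x.2.2.2.2.2), rfl⟩, ?_⟩
  rw [map_add, lambdaLinear_nil hm, direction_apply, direction_apply]
  simp only [map_add, map_sum, map_smul, hl _ _ _ _ (h₁ _) (h₁ _), hl _ _ _ _ (h₂ _) (h₂ _),
    hl _ _ _ _ h₁' (h₂ _), hl _ _ _ _ (h₂ _) (h₁ _), hl _ _ _ _ hE hρ, hl _ _ _ _ hE h₁', smul_smul,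
    c, mul_comm]

end slice

/-! ### The characteristic polynomial of a rank-two perturbation -/

section resolvent

variable {m : ℕ}

theorem eval_charpoly_eq_det (A : MatB m) (t : ℂ) :
    A.charpoly.eval t = (t • (1 : MatB m) - A).det := by
  rw [Matrix.eval_charpoly, Matrix.scalar_apply, smul_one_eq_diagonal]

theorem resolvent_mulVec {A : MatB m} {t : ℂ} (hA : IsUnit (t • (1 : MatB m) - A).det) (u : Vec m) :
    t • (t • (1 : MatB m) - A)⁻¹ *ᵥ u - A *ᵥ (t • (1 : MatB m) - A)⁻¹ *ᵥ u = u := by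
  have h1 : (t • (1 : MatB m) - A) *ᵥ (t • (1 : MatB m) - A)⁻¹ *ᵥ u = u := by
    rw [mulVec_mulVec, Matrix.mul_nonsing_inv _ hA, one_mulVec]
  rwa [sub_mulVec, smul_mulVec, one_mulVec] at h1

theorem eq_resolvent_mulVec {A : MatB m} {t : ℂ} (hA : IsUnit (t • (1 : MatB m) - A).det)
    {u y : Vec m} (h : t • y - A *ᵥ y = u) : (t • (1 : MatB m) - A)⁻¹ *ᵥ u = y := by
  have h1 : (t • (1 : MatB m) - A) *ᵥ y = u := by rw [sub_mulVec, smul_mulVec, one_mulVec, h]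
  rw [← h1, mulVec_mulVec, Matrix.nonsing_inv_mul _ hA, one_mulVec]

/-- The matrix determinant lemma for a wedge: `u` and `w` solve `M u = φ` and `M w = ξ`. -/
theorem det_sub_wedge {M : MatB m} (hM : IsUnit M.det) (φ ξ : Vec m) :
    (M - wedge m φ ξ).det = M.det *
      ((1 - pair m ξ (M⁻¹ *ᵥ φ)) * (1 + pair m φ (M⁻¹ *ᵥ ξ)) +
        pair m ξ (M⁻¹ *ᵥ ξ) * pair m φ (M⁻¹ *ᵥ φ)) := by
  let U : Matrix (Unit ⊕ (Fin m ⊕ Fin m)) (Fin 2) ℂ := Matrix.of fun i j => ![-φ i, ξ i] j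
  let V : Matrix (Fin 2) (Unit ⊕ (Fin m ⊕ Fin m)) ℂ := Matrix.of ![form m *ᵥ ξ, form m *ᵥ φ]
  have h1 : M - wedge m φ ξ = M + U * V := by
    rw [wedge_apply]
    ext i j
    simp [U, V, Matrix.mul_apply, Fin.sum_univ_two, vecMulVec_apply]
    ring
  have h2 : ∀ i j, (V * M⁻¹ * U) i j = pair m (![ξ, φ] i) (M⁻¹ *ᵥ ![-φ, ξ] j) := by
    intro i j
    rw [← form_mulVec_dotProduct, Matrix.mul_assoc, Matrix.mul_apply', dotProduct]
    rw [dotProduct]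
    refine Finset.sum_congr rfl fun k _ => ?_
    congr 1
    · fin_cases i <;> rfl
    · rw [Matrix.mul_apply', mulVec]
      congr 1
      ext l
      fin_cases j <;> rfl
  rw [h1, det_add_mul _ _ hM, det_fin_two]
  simp only [Matrix.add_apply, h2]
  simp [mulVec_neg, ← sub_eq_add_neg]

/-- The characteristic polynomial of a perturbation `S + φ ∧ (η - S φ)` of a skew `S`. -/
theorem eval_charpoly_add_wedge {S : MatB m} (hS : S ∈ so m) {φ : Vec m} (hφ : pair m φ φ = 0)
    (η : Vec m) {t : ℂ} (hA : IsUnit (t • (1 : MatB m) - S).det) :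
    (S + wedge m φ (η - S *ᵥ φ)).charpoly.eval t = (t • (1 : MatB m) - S).det *
      ((1 - pair m η ((t • (1 : MatB m) - S)⁻¹ *ᵥ φ)) *
          (1 + pair m φ ((t • (1 : MatB m) - S)⁻¹ *ᵥ η)) +
        pair m φ ((t • (1 : MatB m) - S)⁻¹ *ᵥ φ) *
          (pair m η ((t • (1 : MatB m) - S)⁻¹ *ᵥ η) - 2 * t)) := by
  have hu := resolvent_mulVec hA φ
  have hw := resolvent_mulVec hA η
  rw [eval_charpoly_eq_det, ← sub_sub, det_sub_wedge hA]
  have h0 : (t • (1 : MatB m) - S)⁻¹ *ᵥ (η - S *ᵥ φ) =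
      (t • (1 : MatB m) - S)⁻¹ *ᵥ η + φ - t • (t • (1 : MatB m) - S)⁻¹ *ᵥ φ := by
    refine eq_resolvent_mulVec hA ?_
    generalize (t • (1 : MatB m) - S)⁻¹ *ᵥ φ = u at hu ⊢
    generalize (t • (1 : MatB m) - S)⁻¹ *ᵥ η = w at hw ⊢
    simp only [mulVec_sub, mulVec_add, mulVec_smul]
    have h1 : S *ᵥ u = t • u - φ := by rw [← hu]; abel
    have h2 : S *ᵥ w = t • w - η := by rw [← hw]; abel
    rw [h1, h2]
    module
  rw [h0]
  generalize (t • (1 : MatB m) - S)⁻¹ *ᵥ φ = u at hu ⊢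
  generalize (t • (1 : MatB m) - S)⁻¹ *ᵥ η = w at hw ⊢
  have h1 : S *ᵥ u = t • u - φ := by rw [← hu]; abel
  have h2 : S *ᵥ w = t • w - η := by rw [← hw]; abel
  have e1 : pair m (S *ᵥ φ) u = -t * pair m φ u := by
    rw [pair_mulVec_left hS, h1, map_sub, map_smul, hφ, smul_eq_mul]
    ring
  have e2 : pair m (S *ᵥ φ) w = -t * pair m φ w + pair m φ η := by
    rw [pair_mulVec_left hS, h2, map_sub, map_smul, smul_eq_mul]
    ring
  have e3 : pair m (S *ᵥ φ) φ = 0 := by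
    have := pair_mulVec_left hS φ φ
    rw [pair_comm φ] at this
    linear_combination this / 2
  simp only [map_sub, map_add, map_smul, LinearMap.sub_apply, smul_eq_mul, e1, e2, e3, hφ,
    pair_comm η φ]
  ring

/-- The resolvent preserves a stable subspace. -/
theorem resolvent_mulVec_mem {S : MatB m} {F : Submodule ℂ (Vec m)} (hF : ∀ y ∈ F, S *ᵥ y ∈ F)
    {t : ℂ} (hA : IsUnit (t • (1 : MatB m) - S).det) {ρ : Vec m} (hρ : ρ ∈ F) :
    (t • (1 : MatB m) - S)⁻¹ *ᵥ ρ ∈ F := by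
  have hinj : Function.Injective (t • (1 : MatB m) - S).mulVecLin := by
    intro u w h
    have h1 := congrArg (fun y => (t • (1 : MatB m) - S)⁻¹ *ᵥ y) h
    simpa only [mulVecLin_apply, mulVec_mulVec, Matrix.nonsing_inv_mul _ hA, one_mulVec] using h1
  have h2 : F.map (t • (1 : MatB m) - S).mulVecLin = F := by
    refine Submodule.eq_of_le_of_finrank_eq ?_
      (Submodule.equivMapOfInjective _ hinj F).finrank_eq.symm
    rintro _ ⟨y, hy, rfl⟩
    rw [mulVecLin_apply, sub_mulVec, smul_mulVec, one_mulVec]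
    exact F.sub_mem (F.smul_mem _ hy) (hF y hy)
  rw [← h2] at hρ
  obtain ⟨y, hy, rfl⟩ := hρ
  rw [mulVecLin_apply, mulVec_mulVec, Matrix.nonsing_inv_mul _ hA, one_mulVec]
  exact hy

/-- Matrix coefficients of the resolvent of a skew `S` from approximate solutions `x` and `y` whose
errors lie in a stable isotropic subspace. -/
theorem pair_resolvent {S : MatB m} (hS : S ∈ so m) {F : Submodule ℂ (Vec m)}
    (hF : ∀ y ∈ F, S *ᵥ y ∈ F) (hiso : ∀ y ∈ F, ∀ z ∈ F, pair m y z = 0) {t : ℂ}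
    (hA : IsUnit (t • (1 : MatB m) - S).det) {φ η x y ρ ρ' : Vec m}
    (hx : t • x - S *ᵥ x = φ - ρ) (hρ : ρ ∈ F) (hy : (-t) • y - S *ᵥ y = η - ρ') (hρ' : ρ' ∈ F) :
    pair m η ((t • (1 : MatB m) - S)⁻¹ *ᵥ φ) = pair m η x - pair m y ρ := by
  have hz := resolvent_mulVec_mem hF hA hρ
  have hz' := resolvent_mulVec hA ρ
  have h1 : (t • (1 : MatB m) - S)⁻¹ *ᵥ φ = x + (t • (1 : MatB m) - S)⁻¹ *ᵥ ρ := by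
    refine eq_resolvent_mulVec hA ?_
    rw [smul_add, mulVec_add, add_sub_add_comm, hx, hz', sub_add_cancel]
  rw [h1, map_add]
  generalize (t • (1 : MatB m) - S)⁻¹ *ᵥ ρ = z at hz hz' ⊢
  have h2 : pair m η z = pair m ((-t) • y - S *ᵥ y + ρ') z := by rw [hy, sub_add_cancel]
  rw [h2, ← hz']
  simp only [map_sub, map_add, map_smul, LinearMap.sub_apply, LinearMap.add_apply,
    LinearMap.smul_apply, smul_eq_mul, hiso _ hρ' _ hz, pair_mulVec_left hS y z]
  ring

theorem charpoly_eq_X_pow_of_isNilpotent {S : MatB m} (hS : IsNilpotent S) :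
    S.charpoly = Polynomial.X ^ (2 * m + 1) := by
  have h1 := (Matrix.isNilpotent_charpoly_sub_pow_of_isNilpotent hS).eq_zero
  rw [sub_eq_zero.1 h1]
  congr 1
  simp
  ring

end resolvent

/-! ### The nilpotent core of an element of the slice -/

/-- The isotropic subspace spanned by the weight vectors of weight `-e_i`. -/
def negSpan (m : ℕ) : Submodule ℂ (Vec m) := Submodule.span ℂ (Set.range (vecF' m))

/-- The nilpotent `∑ X_{e_i - e_{i+1}}` with two Jordan blocks on the span of the `vecF m i`. -/
def leviPart (m r : ℕ) : MatB m := ∑ i ∈ simpleIndices m r, wedge m (vecF m i) (vecF' m (i + 1))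

/-- The part of an element of the slice that lies in the exterior square of `negSpan m`. -/
def negPart (m r q : ℕ) (a y d : ℕ → ℂ) : MatB m :=
  ∑ k ∈ Finset.Icc 1 r, d (r + 1 - k) • wedge m (vecF' m k) (vecF' m (k + 1)) +
  ∑ i ∈ Finset.Icc 1 (q - 1), a (q - i + 1) •
    wedge m (vecF' m (r + 1 + i)) (vecF' m (r + 1 + i + 1)) +
  ∑ i ∈ Finset.Icc 1 q, y i • wedge m (vecF' m 1) (vecF' m (r + 1 + i))

/-- What remains of an element of the slice when the root vectors that involve `e_{r+1}` with
coefficient 1 are removed; `κ` carries the other short root vectors. -/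
def core (m r q : ℕ) (a y d : ℕ → ℂ) (κ : Vec m) : MatB m :=
  leviPart m r + negPart m r q a y d + wedge m (vecE m) κ

/-- The part in `negSpan m` of the vector `coreVec`. -/
def coreVec' (m q : ℕ) (a z : ℕ → ℂ) : Vec m :=
  (if q = 0 then 0 else a 1 • vecF' m m) - ∑ j ∈ Finset.Icc 1 (q + 1), z j • vecF' m j

/-- The vector `η` for which the element of the slice is `core + φ ∧ (η - core φ)` with
`φ = vecF m (r + 1)`. -/
def coreVec (m q : ℕ) (a z : ℕ → ℂ) (η₀ : ℂ) : Vec m :=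
  (if q = 0 then 0 else vecF m m) + coreVec' m q a z + η₀ • vecE m

section core

variable {m r q : ℕ} {a y z d : ℕ → ℂ} {κ : Vec m}

theorem vecF'_mem_negSpan (m i : ℕ) : vecF' m i ∈ negSpan m := Submodule.subset_span ⟨i, rfl⟩

theorem pair_eq_zero_of_mem_negSpan {u w : Vec m} (hu : u ∈ negSpan m) (hw : w ∈ negSpan m) :
    pair m u w = 0 := by
  have h1 : ∀ i, negSpan m ≤ LinearMap.ker (pair m (vecF' m i)) := fun i =>
    Submodule.span_le.2 fun _ ⟨j, hj⟩ => by
      rw [← hj]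
      exact pair_vecF'_vecF' m i j
  have h2 : negSpan m ≤ LinearMap.ker ((pair m).flip w) := Submodule.span_le.2 fun _ ⟨i, hi⟩ => by
    rw [← hi]
    exact h1 i hw
  exact h2 hu

theorem pair_vecE_of_mem_negSpan {u : Vec m} (hu : u ∈ negSpan m) : pair m (vecE m) u = 0 := by
  have h1 : negSpan m ≤ LinearMap.ker (pair m (vecE m)) := Submodule.span_le.2 fun _ ⟨j, hj⟩ => by
    rw [← hj]
    exact pair_vecE_vecF' m j
  exact h1 hu

theorem coreVec'_mem (m q : ℕ) (a z : ℕ → ℂ) : coreVec' m q a z ∈ negSpan m := by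
  refine Submodule.sub_mem _ ?_ (Submodule.sum_mem _ fun _ _ =>
    Submodule.smul_mem _ _ (vecF'_mem_negSpan _ _))
  split_ifs
  · exact Submodule.zero_mem _
  · exact Submodule.smul_mem _ _ (vecF'_mem_negSpan _ _)

/-- The pairing with `negPart`, in coordinates. -/
theorem pair_negPart_mulVec (a y d : ℕ → ℂ) (u w : Vec m) :
    pair m u (negPart m r q a y d *ᵥ w) =
      ∑ k ∈ Finset.Icc 1 r, d (r + 1 - k) *
        (pair m (vecF' m (k + 1)) w * pair m (vecF' m k) u -
          pair m (vecF' m k) w * pair m (vecF' m (k + 1)) u) +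
      ∑ i ∈ Finset.Icc 1 (q - 1), a (q - i + 1) *
        (pair m (vecF' m (r + 1 + i + 1)) w * pair m (vecF' m (r + 1 + i)) u -
          pair m (vecF' m (r + 1 + i)) w * pair m (vecF' m (r + 1 + i + 1)) u) +
      ∑ i ∈ Finset.Icc 1 q, y i *
        (pair m (vecF' m (r + 1 + i)) w * pair m (vecF' m 1) u -
          pair m (vecF' m 1) w * pair m (vecF' m (r + 1 + i)) u) := by
  simp only [negPart, add_mulVec, sum_mulVec, smul_mulVec, wedge_mulVec, map_add, map_sum, map_smul,
    map_sub, smul_eq_mul, pair_comm u (vecF' m _)]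

theorem negPart_mulVec_mem (a y d : ℕ → ℂ) (w : Vec m) :
    negPart m r q a y d *ᵥ w ∈ negSpan m := by
  simp only [negPart, add_mulVec, sum_mulVec, smul_mulVec, wedge_mulVec]
  have h1 : ∀ (c c₁ c₂ : ℂ) (i j : ℕ), c • (c₁ • vecF' m i - c₂ • vecF' m j) ∈ negSpan m :=
    fun c c₁ c₂ i j => Submodule.smul_mem _ _ (Submodule.sub_mem _
      (Submodule.smul_mem _ _ (vecF'_mem_negSpan _ _))
      (Submodule.smul_mem _ _ (vecF'_mem_negSpan _ _)))
  exact Submodule.add_mem _ (Submodule.add_mem _ (Submodule.sum_mem _ fun _ _ => h1 _ _ _ _ _)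
    (Submodule.sum_mem _ fun _ _ => h1 _ _ _ _ _)) (Submodule.sum_mem _ fun _ _ => h1 _ _ _ _ _)

theorem negPart_mulVec_eq_zero (a y d : ℕ → ℂ) {w : Vec m} (hw : ∀ i, pair m (vecF' m i) w = 0) :
    negPart m r q a y d *ᵥ w = 0 := by
  simp [negPart, add_mulVec, sum_mulVec, smul_mulVec, wedge_mulVec, hw]

theorem negPart_mem_so : negPart m r q a y d ∈ so m := by
  have h1 : ∀ (c : ℂ) (u w : Vec m), c • wedge m u w ∈ so m := fun c u w =>
    Submodule.smul_mem _ _ (wedge_mem_so u w)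
  exact Submodule.add_mem _ (Submodule.add_mem _ (Submodule.sum_mem _ fun _ _ => h1 _ _ _)
      (Submodule.sum_mem _ fun _ _ => h1 _ _ _)) (Submodule.sum_mem _ fun _ _ => h1 _ _ _)

theorem core_mem_so : core m r q a y d κ ∈ so m :=
  Submodule.add_mem _ (Submodule.add_mem _ (Submodule.sum_mem _ fun _ _ => wedge_mem_so _ _)
    negPart_mem_so) (wedge_mem_so _ _)

theorem core_mulVec_mem (hκ : κ ∈ negSpan m) {w : Vec m} (hw : w ∈ negSpan m) :
    core m r q a y d κ *ᵥ w ∈ negSpan m := by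
  rw [core, add_mulVec, add_mulVec, wedge_mulVec, pair_eq_zero_of_mem_negSpan hκ hw,
    pair_vecE_of_mem_negSpan hw, zero_smul, zero_smul, sub_zero, add_zero]
  refine Submodule.add_mem _ ?_ (negPart_mulVec_mem _ _ _ _)
  rw [leviPart, sum_mulVec]
  refine Submodule.sum_mem _ fun i _ => ?_
  rw [wedge_mulVec, pair_eq_zero_of_mem_negSpan (vecF'_mem_negSpan _ _) hw, zero_smul, zero_sub]
  exact Submodule.neg_mem _ (Submodule.smul_mem _ _ (vecF'_mem_negSpan _ _))

theorem core_mulVec_vecE (hκ : κ ∈ negSpan m) : core m r q a y d κ *ᵥ vecE m = -κ := by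
  rw [core, add_mulVec, add_mulVec, negPart_mulVec_eq_zero _ _ _ fun i => pair_vecF'_vecE m i,
    leviPart, sum_mulVec, wedge_mulVec, pair_vecE_vecE, pair_comm, pair_vecE_of_mem_negSpan hκ]
  simp [wedge_mulVec, pair_vecF'_vecE, pair_vecF_vecE]

theorem core_mulVec_vecF (hm : m = r + 1 + q) (hr : 1 ≤ r) :
    core m r q a y d κ *ᵥ vecF m (r + 1) =
      vecF m r + d 1 • vecF' m r + pair m κ (vecF m (r + 1)) • vecE m := by
  rw [core, add_mulVec, add_mulVec, wedge_mulVec, pair_vecE_vecF, zero_smul, sub_zero, leviPart,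
    sum_wedge_mulVec_vecF hm, if_pos (mem_simpleIndices.2 (by omega))]
  congr 2
  simp only [negPart, add_mulVec, sum_mulVec, smul_mulVec, wedge_mulVec, pair_vecF'_vecF]
  rw [Finset.sum_eq_single r]
  · rw [Finset.sum_eq_zero fun i hi => ?_, Finset.sum_eq_zero fun i hi => ?_]
    · rw [if_pos (by omega), if_neg (by omega), Nat.add_sub_cancel_left]
      simp
    · rw [Finset.mem_Icc] at hi
      rw [if_neg (by omega), if_neg (by omega)]
      simp
    · rw [Finset.mem_Icc] at hi
      rw [if_neg (by omega), if_neg (by omega)]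
      simp
  · intro k hk hk'
    rw [Finset.mem_Icc] at hk
    rw [if_neg (by omega), if_neg (by omega)]
    simp
  · intro h
    exact absurd (Finset.mem_Icc.2 ⟨hr, le_rfl⟩) h

/-- The elements of the slice as rank-two perturbations of nilpotent cores. -/
theorem incl_eltD_add_vecV_eq_core (hm : m = r + 1 + q) (hr : 1 ≤ r) {R : MatB m} {a₀ d₀ η₀ : ℂ}
    (hV : vecV R a₀ d₀ = wedge m (vecE m) κ +
      (η₀ - pair m κ (vecF m (r + 1))) • wedge m (vecF m (r + 1)) (vecE m)) :
    incl (eltD m q a y z d) + vecV R a₀ d₀ = core m r q a y d κ +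
      wedge m (vecF m (r + 1)) (coreVec m q a z η₀ - core m r q a y d κ *ᵥ vecF m (r + 1)) := by
  rw [core_mulVec_vecF hm hr, hV, incl_eltD hm, incl_nilD hm, core, leviPart, negPart, coreVec,
    coreVec']
  simp only [map_add, map_sub, map_sum, map_smul, apply_ite (wedge m (vecF m (r + 1))), map_zero,
    wedge_swap (vecF m (r + 1)) (vecF m r)]
  split_ifs <;> module

/-- A matrix that strictly lowers a grading of the index set is nilpotent. -/
theorem isNilpotent_of_grading {ι : Type*} [Fintype ι] [DecidableEq ι] {A : Matrix ι ι ℂ}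
    (ord : ι → ℕ) (h : ∀ i j, ord j ≤ ord i → A i j = 0) : IsNilpotent A := by
  have h1 : ∀ k i j, ord j < ord i + k → (A ^ k) i j = 0 := by
    intro k
    induction k with
    | zero =>
      intro i j hij
      rw [pow_zero, Matrix.one_apply, if_neg]
      rintro rfl
      omega
    | succ k ih =>
      intro i j hij
      rw [pow_succ, Matrix.mul_apply]
      refine Finset.sum_eq_zero fun l _ => ?_
      rcases le_or_gt (ord j) (ord l) with hl | hl
      · rw [h l j hl, mul_zero]
      · rw [ih i l (by omega), zero_mul]
  refine ⟨∑ j, ord j + 1, ?_⟩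
  ext i j
  have h2 := Finset.single_le_sum (f := ord) (fun _ _ => Nat.zero_le _) (Finset.mem_univ j)
  exact h1 _ i j (by omega)

/-- The grading of the standard basis that the core lowers: the vectors of weight `-e_m`, …, `-e_1`,
`0`, `e_1`, …, `e_m` in this order. -/
def basisOrd (m : ℕ) : Unit ⊕ (Fin m ⊕ Fin m) → ℕ :=
  Sum.elim (fun _ => m) (Sum.elim (fun k => m + 1 + k.val) fun k => m - 1 - k.val)

theorem core_isNilpotent (hκ : κ ∈ negSpan m) : IsNilpotent (core m r q a y d κ) := by
  let N : Submodule ℂ (MatB m) :=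
    { carrier := {A | ∀ i j, basisOrd m j ≤ basisOrd m i → A i j = 0}
      add_mem' := fun {A B} hA hB i j h => by rw [Matrix.add_apply, hA i j h, hB i j h, add_zero]
      zero_mem' := fun _ _ _ => rfl
      smul_mem' := fun c A hA i j h => by rw [Matrix.smul_apply, hA i j h, smul_zero] }
  have hPM : ∀ i, wedge m (vecF m i) (vecF' m (i + 1)) ∈ N := by
    intro i
    rw [← incl_rootPM]
    rintro (x | x | x) (y | y | y) h <;> simp [basisOrd, incl, rootPM, E] at h ⊢ <;> omega
  have hMM : ∀ i j, wedge m (vecF' m i) (vecF' m j) ∈ N := by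
    intro i j
    rw [← incl_rootMM]
    rintro (x | x | x) (y | y | y) h <;> simp [basisOrd, incl, rootMM, E] at h ⊢ <;> omega
  have hM : ∀ i, wedge m (vecE m) (vecF' m i) ∈ N := by
    intro i
    rw [← rootM_eq]
    rintro (x | x | x) (y | y | y) h <;> simp [basisOrd, rootM] at h ⊢ <;> omega
  have hκ' : negSpan m ≤ N.comap (wedge m (vecE m)) := Submodule.span_le.2 fun _ ⟨i, hi⟩ => by
    rw [← hi]
    exact hM i
  refine isNilpotent_of_grading (basisOrd m) (?_ : _ ∈ N)
  exact N.add_mem (N.add_mem (N.sum_mem fun i _ => hPM i) (N.add_mem (N.add_mem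
    (N.sum_mem fun i _ => N.smul_mem _ (hMM _ _)) (N.sum_mem fun i _ => N.smul_mem _ (hMM _ _)))
    (N.sum_mem fun i _ => N.smul_mem _ (hMM _ _)))) (hκ' hκ)

theorem det_smul_one_sub_core (hκ : κ ∈ negSpan m) (t : ℂ) :
    (t • (1 : MatB m) - core m r q a y d κ).det = t ^ (2 * m + 1) := by
  rw [← eval_charpoly_eq_det, charpoly_eq_X_pow_of_isNilpotent (core_isNilpotent hκ)]
  simp

/-- The vector `∑ x ^ (n + 1 - i) • f_{lo+i}` over `1 ≤ i ≤ n`. -/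
def ladder (m lo : ℕ) (x : ℂ) : ℕ → Vec m
  | 0 => 0
  | n + 1 => x • (ladder m lo x n + vecF m (lo + n + 1))

theorem pair_vecF'_ladder {lo n : ℕ} (h : lo + n ≤ m) (x : ℂ) (j : ℕ) :
    pair m (vecF' m j) (ladder m lo x n) =
      if lo < j ∧ j ≤ lo + n then x ^ (lo + n + 1 - j) else 0 := by
  induction n with
  | zero => rw [ladder, map_zero, if_neg (by omega)]
  | succ n ih =>
    rw [ladder, map_smul, map_add, ih (by omega), pair_vecF'_vecF, smul_eq_mul]
    by_cases h1 : lo < j ∧ j ≤ lo + n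
    · rw [if_pos h1, if_neg (by omega), if_pos (by omega), add_zero, ← pow_succ']
      congr 1
      omega
    · rw [if_neg h1]
      by_cases h2 : j = lo + n + 1
      · rw [if_pos (by omega), if_pos (by omega), h2,
          show lo + (n + 1) + 1 - (lo + n + 1) = 1 by omega]
        simp
      · rw [if_neg (by omega), if_neg (by omega)]
        simp

theorem pair_vecF_ladder (lo n : ℕ) (x : ℂ) (j : ℕ) :
    pair m (vecF m j) (ladder m lo x n) = 0 := by
  induction n with
  | zero => rw [ladder, map_zero]
  | succ n ih => rw [ladder, map_smul, map_add, ih, pair_vecF_vecF, add_zero, smul_zero]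

theorem pair_vecE_ladder (lo n : ℕ) (x : ℂ) : pair m (vecE m) (ladder m lo x n) = 0 := by
  induction n with
  | zero => rw [ladder, map_zero]
  | succ n ih => rw [ladder, map_smul, map_add, ih, pair_vecE_vecF, add_zero, smul_zero]

/-- The ladders invert `t - leviPart` on the last vector of a Jordan block. -/
theorem smul_ladder_sub {lo n : ℕ} (hm : m = r + 1 + q) {t x : ℂ} (htx : t * x = 1)
    (h0 : lo ∉ simpleIndices m r) (h1 : ∀ i, i ≠ 0 → i < n → lo + i ∈ simpleIndices m r) :
    t • ladder m lo x n - leviPart m r *ᵥ ladder m lo x n =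
      if n = 0 then 0 else vecF m (lo + n) := by
  induction n with
  | zero => simp [ladder]
  | succ n ih =>
    have h2 := ih fun i hi hi' => h1 i hi (by omega)
    have h3 : leviPart m r *ᵥ vecF m (lo + n + 1) = if n = 0 then 0 else vecF m (lo + n) := by
      rw [leviPart, sum_wedge_mulVec_vecF hm]
      by_cases hn : n = 0
      · rw [hn, add_zero, if_neg h0, if_pos rfl]
      · rw [if_pos (h1 n hn (by omega)), if_neg hn]
    have h4 : leviPart m r *ᵥ ladder m lo x n =
        t • ladder m lo x n - if n = 0 then 0 else vecF m (lo + n) := by rw [← h2]; abel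
    rw [ladder, mulVec_smul, mulVec_add, h3, h4, sub_add_cancel, smul_smul, smul_smul, mul_comm x,
      htx, if_neg n.succ_ne_zero, one_smul, one_smul, add_sub_cancel_left]
    rfl

/-- An approximate solution `u = L + x (ν + ⟨κ, L⟩) e` of `(t - core) u = φ + ν e`; the error lies
in `negSpan m`. -/
theorem smul_sub_core_mulVec (hκ : κ ∈ negSpan m) {t x : ℂ} (htx : t * x = 1) {L φ : Vec m}
    (hL : t • L - leviPart m r *ᵥ L = φ) (hE : pair m (vecE m) L = 0) (ν : ℂ) :
    t • (L + (x * (ν + pair m κ L)) • vecE m) -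
      core m r q a y d κ *ᵥ (L + (x * (ν + pair m κ L)) • vecE m) =
    φ + ν • vecE m - (negPart m r q a y d *ᵥ L - (x * (ν + pair m κ L)) • κ) := by
  have h1 : core m r q a y d κ *ᵥ L =
      leviPart m r *ᵥ L + negPart m r q a y d *ᵥ L + pair m κ L • vecE m := by
    rw [core, add_mulVec, add_mulVec, wedge_mulVec, hE, zero_smul, sub_zero]
  have h2 : (t * (x * (ν + pair m κ L))) • vecE m = (ν + pair m κ L) • vecE m := by
    rw [← mul_assoc, htx, one_mul]
  rw [mulVec_add, mulVec_smul, core_mulVec_vecE hκ, h1, smul_add, smul_smul, h2, ← hL]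
  module

end core

/-! ### Evaluation of the characteristic polynomial -/

section evaluation

variable {m r q : ℕ} {a y z d : ℕ → ℂ} {κ : Vec m}

theorem pow_mul_pow_of_mul_eq_one {t x : ℂ} (htx : t * x = 1) (i j : ℕ) :
    x ^ (i + j) * t ^ j = x ^ i := by
  rw [pow_add, mul_assoc, ← mul_pow, mul_comm x, htx, one_pow, mul_one]

theorem sum_Icc_reflect {n : ℕ} (f : ℕ → ℂ) :
    ∑ k ∈ Finset.Icc 1 n, f (n + 1 - k) = ∑ k ∈ Finset.Icc 1 n, f k := by
  refine Finset.sum_nbij' (fun k => n + 1 - k) (fun k => n + 1 - k) ?_ ?_ ?_ ?_ fun _ _ => rfl <;>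
  · intro k hk
    have h1 := Finset.mem_Icc.1 hk
    first | exact Finset.mem_Icc.2 (by omega) | exact Nat.sub_sub_self (by omega)

/-- The generating function of the `y_i` and `z_j`, in terms of `x = t⁻¹`. -/
theorem one_sub_eq_polyB (hm : m = r + 1 + q) (hq : q ≤ r) (y z : ℕ → ℂ) {t x : ℂ}
    (htx : t * x = 1) :
    1 + ∑ j ∈ Finset.Icc 1 (q + 1), z j * x ^ (r + 2 - j) -
      ∑ i ∈ Finset.Icc 1 q, y i * (x ^ (r + 1) * (-x) ^ (q + 1 - i)) =
    -((-1) ^ q * x ^ m * polyB m q y z (-t)) := by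
  have hs : ∀ k : ℕ, (-1 : ℂ) ^ k * (-1) ^ k = 1 := fun k => by rw [← mul_pow]; simp
  have hZ : ∑ j ∈ Finset.Icc 1 (q + 1), z j * x ^ (r + 2 - j) =
      x ^ (r + 1) * ∑ j ∈ Finset.Icc 1 (q + 1), (-1) ^ (j - 1) * z j * (-t) ^ (j - 1) := by
    rw [Finset.mul_sum]
    refine Finset.sum_congr rfl fun j hj => ?_
    rw [Finset.mem_Icc] at hj
    have h1 := pow_mul_pow_of_mul_eq_one htx (r + 2 - j) (j - 1)
    rw [show r + 2 - j + (j - 1) = r + 1 by omega] at h1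
    rw [← h1, neg_pow t]
    linear_combination -x ^ (r + 1) * t ^ (j - 1) * z j * hs (j - 1)
  have hY : ∑ i ∈ Finset.Icc 1 q, y i * (x ^ (r + 1) * (-x) ^ (q + 1 - i)) =
      (-1) ^ q * x ^ m * ∑ i ∈ Finset.Icc 1 q, y i * (-t) ^ (i - 1) := by
    rw [Finset.mul_sum]
    refine Finset.sum_congr rfl fun i hi => ?_
    rw [Finset.mem_Icc] at hi
    have h1 := pow_mul_pow_of_mul_eq_one htx (r + 1 + (q + 1 - i)) (i - 1)
    rw [show r + 1 + (q + 1 - i) + (i - 1) = m by omega] at h1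
    have h2 : (-1 : ℂ) ^ q = (-1) ^ (q + 1 - i) * (-1) ^ (i - 1) := by
      rw [← pow_add]
      congr 1
      omega
    rw [h2, neg_pow t, neg_pow x]
    rw [pow_add] at h1
    linear_combination (-(-1) ^ (q + 1 - i) * y i) * h1 -
      (-1) ^ (q + 1 - i) * x ^ m * y i * t ^ (i - 1) * hs (i - 1)
  have h1 := pow_mul_pow_of_mul_eq_one htx (r + 1) q
  have h2 := pow_mul_pow_of_mul_eq_one htx 0 (r + 1)
  rw [← hm] at h1
  rw [zero_add, pow_zero] at h2
  rw [hZ, hY, polyB, show m - q = r + 1 by omega, neg_pow t q, neg_pow t (r + 1)]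
  generalize ∑ j ∈ Finset.Icc 1 (q + 1), (-1) ^ (j - 1) * z j * (-t) ^ (j - 1) = Z
  linear_combination (-(Z + t ^ (r + 1))) * h1 - h2 - x ^ m * t ^ q * Z * hs q -
    x ^ m * t ^ q * t ^ (r + 1) * (hs q + (-1) ^ q * (-1) ^ q * hs (r + 1))

/-- The generating function of the `d_j`, in terms of `x = t⁻¹`. -/
theorem sum_eq_polyD (hm : m = r + 1 + q) (d : ℕ → ℂ) {t x : ℂ} (htx : t * x = 1) :
    ∑ j ∈ Finset.Icc 1 r, (-1) ^ j * d j * x ^ (2 * j + 1) =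
      -(x ^ (2 * r + 1) * polyD m q d t / 4) := by
  rw [polyD, show m - q - 1 = r by omega, Finset.mul_sum, Finset.sum_div, ← Finset.sum_neg_distrib]
  refine Finset.sum_congr rfl fun k hk => ?_
  rw [Finset.mem_Icc] at hk
  have h1 := pow_mul_pow_of_mul_eq_one htx (2 * k + 1) (2 * (r - k))
  rw [show 2 * k + 1 + 2 * (r - k) = 2 * r + 1 by omega] at h1
  obtain ⟨i, rfl⟩ : ∃ i, k = i + 1 := ⟨k - 1, by omega⟩
  rw [← h1, pow_succ, Nat.add_sub_cancel]
  ring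

/-- The generating function of the `a_l`, in terms of `x = t⁻¹`. -/
theorem sum_eq_polyA (q : ℕ) (a : ℕ → ℂ) {t x : ℂ} (htx : t * x = 1) :
    t + ∑ l ∈ Finset.Icc 1 q, (-1) ^ l * a l * x ^ (2 * l - 1) =
      x ^ (2 * q + 1) * (t ^ 2 * polyA q a t) := by
  have h0 := pow_mul_pow_of_mul_eq_one htx 0 (2 * q + 1)
  rw [zero_add, pow_zero] at h0
  rw [polyA, mul_add, mul_add, Finset.mul_sum, Finset.mul_sum]
  congr 1
  · linear_combination -t * h0
  · refine Finset.sum_congr rfl fun l hl => ?_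
    rw [Finset.mem_Icc] at hl
    have h1 := pow_mul_pow_of_mul_eq_one htx (2 * l - 1) (2 * (q - l) + 2)
    rw [show 2 * l - 1 + (2 * (q - l) + 2) = 2 * q + 1 by omega] at h1
    rw [← h1]
    ring

/-- The pairing of `negPart` between two ladders of the first block is the generating function of
the `d_j`. -/
theorem pair_ladder_negPart_first (hm : m = r + 1 + q) (a y d : ℕ → ℂ) (x : ℂ) :
    pair m (ladder m 0 (-x) (r + 1)) (negPart m r q a y d *ᵥ ladder m 0 x (r + 1)) =
      -(2 * ∑ j ∈ Finset.Icc 1 r, (-1) ^ j * d j * x ^ (2 * j + 1)) := by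
  rw [pair_negPart_mulVec]
  simp only [pair_vecF'_ladder (show 0 + (r + 1) ≤ m by omega)]
  rw [Finset.sum_eq_zero (s := Finset.Icc 1 (q - 1)) fun i hi => ?_,
    Finset.sum_eq_zero (s := Finset.Icc 1 q) fun i hi => ?_, add_zero, add_zero,
    ← sum_Icc_reflect fun j => (-1) ^ j * d j * x ^ (2 * j + 1), Finset.mul_sum,
    ← Finset.sum_neg_distrib]
  · refine Finset.sum_congr rfl fun k hk => ?_
    rw [Finset.mem_Icc] at hk
    obtain ⟨j, rfl⟩ : ∃ j, r = k + j := ⟨r - k, by omega⟩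
    rw [if_pos (by omega), if_pos (by omega), if_pos (by omega), if_pos (by omega),
      show 0 + (k + j + 1) + 1 - (k + 1) = j + 1 by omega,
      show 0 + (k + j + 1) + 1 - k = j + 2 by omega,
      show k + j + 1 - k = j + 1 by omega, neg_pow x, neg_pow x]
    ring
  · rw [Finset.mem_Icc] at hi
    have h1 : ¬(0 < r + 1 + i ∧ r + 1 + i ≤ 0 + (r + 1)) := by omega
    simp only [if_neg h1]
    simp
  · rw [Finset.mem_Icc] at hi
    have h1 : ¬(0 < r + 1 + i + 1 ∧ r + 1 + i + 1 ≤ 0 + (r + 1)) := by omega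
    have h2 : ¬(0 < r + 1 + i ∧ r + 1 + i ≤ 0 + (r + 1)) := by omega
    simp only [if_neg h1, if_neg h2]
    simp

/-- The pairing of `negPart` between ladders of different blocks is the generating function of the
`y_i`. -/
theorem pair_ladder_negPart_mixed (hm : m = r + 1 + q) (a y d : ℕ → ℂ) (x x' : ℂ) :
    pair m (ladder m (r + 1) x' q) (negPart m r q a y d *ᵥ ladder m 0 x (r + 1)) =
      -∑ i ∈ Finset.Icc 1 q, y i * (x ^ (r + 1) * x' ^ (q + 1 - i)) := by
  rw [pair_negPart_mulVec]
  simp only [pair_vecF'_ladder (show 0 + (r + 1) ≤ m by omega),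
    pair_vecF'_ladder (show r + 1 + q ≤ m by omega)]
  rw [Finset.sum_eq_zero (s := Finset.Icc 1 r) fun i hi => ?_,
    Finset.sum_eq_zero (s := Finset.Icc 1 (q - 1)) fun i hi => ?_, add_zero, zero_add,
    ← Finset.sum_neg_distrib]
  · refine Finset.sum_congr rfl fun k hk => ?_
    rw [Finset.mem_Icc] at hk
    have h1 : ¬(0 < r + 1 + k ∧ r + 1 + k ≤ 0 + (r + 1)) := by omega
    have h2 : 0 < 1 ∧ 1 ≤ 0 + (r + 1) := by omega
    have h3 : r + 1 < r + 1 + k ∧ r + 1 + k ≤ r + 1 + q := by omega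
    rw [if_neg h1, if_pos h2, if_pos h3, show 0 + (r + 1) + 1 - 1 = r + 1 by omega,
      show r + 1 + q + 1 - (r + 1 + k) = q + 1 - k by omega]
    ring
  · rw [Finset.mem_Icc] at hi
    have h1 : ¬(0 < r + 1 + i + 1 ∧ r + 1 + i + 1 ≤ 0 + (r + 1)) := by omega
    have h2 : ¬(0 < r + 1 + i ∧ r + 1 + i ≤ 0 + (r + 1)) := by omega
    simp only [if_neg h1, if_neg h2]
    simp
  · rw [Finset.mem_Icc] at hi
    have h1 : ¬(r + 1 < i ∧ i ≤ r + 1 + q) := by omega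
    have h2 : ¬(r + 1 < i + 1 ∧ i + 1 ≤ r + 1 + q) := by omega
    simp only [if_neg h1, if_neg h2]
    simp

/-- The pairing of `negPart` between two ladders of the second block is the generating function of
the `a_l` with `l ≥ 2`; the `a_1`-term comes from `coreVec'`. -/
theorem pair_ladder_negPart_second (hm : m = r + 1 + q) (hq : q ≤ r) (a y z d : ℕ → ℂ) (x : ℂ) :
    pair m (coreVec' m q a z) (ladder m (r + 1) x q) -
      pair m (ladder m (r + 1) (-x) q)
        (coreVec' m q a z + negPart m r q a y d *ᵥ ladder m (r + 1) x q) =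
      -(2 * ∑ l ∈ Finset.Icc 1 q, (-1) ^ l * a l * x ^ (2 * l - 1)) := by
  have hc : ∀ x : ℂ, pair m (coreVec' m q a z) (ladder m (r + 1) x q) =
      if q = 0 then 0 else a 1 * x := by
    intro x
    rw [coreVec', map_sub, LinearMap.sub_apply, map_sum, LinearMap.sum_apply,
      Finset.sum_eq_zero (s := Finset.Icc 1 (q + 1)) fun i hi => ?_, sub_zero]
    · split_ifs with h
      · simp
      · rw [map_smul, LinearMap.smul_apply, pair_vecF'_ladder (by omega), if_pos (by omega),
          show r + 1 + q + 1 - m = 1 by omega, pow_one, smul_eq_mul]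
    · rw [Finset.mem_Icc] at hi
      rw [map_smul, LinearMap.smul_apply, pair_vecF'_ladder (by omega), if_neg (by omega),
        smul_zero]
  rw [map_add, pair_comm _ (coreVec' m q a z), hc, hc, pair_negPart_mulVec]
  simp only [pair_vecF'_ladder (show r + 1 + q ≤ m by omega)]
  rw [Finset.sum_eq_zero (s := Finset.Icc 1 r) fun i hi => ?_,
    Finset.sum_eq_zero (s := Finset.Icc 1 q) fun i hi => ?_, add_zero, zero_add]
  · rcases q with _ | s
    · simp
    · have h1 : ∀ k ∈ Finset.Icc 1 s, a (s + 1 - k + 1) *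
          ((if r + 1 < r + 1 + k + 1 ∧ r + 1 + k + 1 ≤ r + 1 + (s + 1) then
              x ^ (r + 1 + (s + 1) + 1 - (r + 1 + k + 1)) else 0) *
            (if r + 1 < r + 1 + k ∧ r + 1 + k ≤ r + 1 + (s + 1) then
              (-x) ^ (r + 1 + (s + 1) + 1 - (r + 1 + k)) else 0) -
          (if r + 1 < r + 1 + k ∧ r + 1 + k ≤ r + 1 + (s + 1) then
              x ^ (r + 1 + (s + 1) + 1 - (r + 1 + k)) else 0) *
            (if r + 1 < r + 1 + k + 1 ∧ r + 1 + k + 1 ≤ r + 1 + (s + 1) then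
              (-x) ^ (r + 1 + (s + 1) + 1 - (r + 1 + k + 1)) else 0)) =
          2 * ((-1) ^ (s + 1 + 1 - k) * a (s + 1 + 1 - k) * x ^ (2 * (s + 1 + 1 - k) - 1)) := by
        intro k hk
        rw [Finset.mem_Icc] at hk
        obtain ⟨j, rfl⟩ : ∃ j, s = k + j := ⟨s - k, by omega⟩
        rw [if_pos (by omega), if_pos (by omega), if_pos (by omega), if_pos (by omega),
          show r + 1 + (k + j + 1) + 1 - (r + 1 + k + 1) = j + 1 by omega,
          show r + 1 + (k + j + 1) + 1 - (r + 1 + k) = j + 2 by omega,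
          show k + j + 1 - k + 1 = j + 2 by omega, show k + j + 1 + 1 - k = j + 2 by omega,
          show 2 * (j + 2) - 1 = 2 * j + 3 by omega, neg_pow x, neg_pow x]
        ring
      rw [if_neg s.succ_ne_zero, if_neg s.succ_ne_zero, Nat.add_sub_cancel,
        Finset.sum_congr rfl h1, ← Finset.mul_sum,
        ← sum_Icc_reflect (n := s + 1) fun l => (-1) ^ l * a l * x ^ (2 * l - 1),
        Finset.sum_Icc_succ_top (by omega), show s + 1 + 1 - (s + 1) = 1 by omega]
      ring
  · rw [Finset.mem_Icc] at hi
    have h1 : ¬(r + 1 < 1 ∧ 1 ≤ r + 1 + q) := by omega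
    simp only [if_neg h1]
    simp
  · rw [Finset.mem_Icc] at hi
    have h1 : ¬(r + 1 < i ∧ i ≤ r + 1 + q) := by omega
    have h2 : ¬(r + 1 < i + 1 ∧ i + 1 ≤ r + 1 + q) := by omega
    simp only [if_neg h1, if_neg h2]
    simp

end evaluation

section formula

variable {m r q : ℕ} {a y z d : ℕ → ℂ} {κ : Vec m}

theorem pair_coreVec'_ladder (hm : m = r + 1 + q) (hq : q ≤ r) (a z : ℕ → ℂ) (x : ℂ) :
    pair m (coreVec' m q a z) (ladder m 0 x (r + 1)) =
      -∑ j ∈ Finset.Icc 1 (q + 1), z j * x ^ (r + 2 - j) := by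
  have h1 : pair m (if q = 0 then 0 else a 1 • vecF' m m) (ladder m 0 x (r + 1)) = 0 := by
    split_ifs with h
    · simp
    · rw [map_smul, LinearMap.smul_apply, pair_vecF'_ladder (by omega), if_neg (by omega),
        smul_zero]
  rw [coreVec', map_sub, LinearMap.sub_apply, map_sum, LinearMap.sum_apply, h1, zero_sub]
  congr 1
  refine Finset.sum_congr rfl fun j hj => ?_
  rw [Finset.mem_Icc] at hj
  rw [map_smul, LinearMap.smul_apply, pair_vecF'_ladder (by omega), if_pos (by omega), smul_eq_mul,
    zero_add]

theorem pair_coreVec_add (a z : ℕ → ℂ) (η₀ c : ℂ) (lo n : ℕ) (x : ℂ) :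
    pair m (coreVec m q a z η₀) (ladder m lo x n + c • vecE m) =
      pair m (coreVec' m q a z) (ladder m lo x n) + c * η₀ := by
  have h1 : ∀ u, pair m u (vecF m m) = 0 →
      pair m (if q = 0 then 0 else vecF m m) u = 0 := by
    intro u hu
    split_ifs
    · simp
    · rw [pair_comm, hu]
  have h2 := pair_vecE_of_mem_negSpan (coreVec'_mem m q a z)
  rw [pair_comm] at h2
  simp only [coreVec, map_add, map_smul, LinearMap.add_apply, LinearMap.smul_apply, smul_eq_mul,
    pair_vecE_ladder, pair_vecE_vecE, h2, h1 _ (pair_vecE_vecF m m)]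
  rw [h1 _ (by rw [pair_comm, pair_vecF_ladder])]
  ring

/-- The resolvent of the core, evaluated on `φ = vecF m (r + 1)` and `η = coreVec m q a z η₀`, turns
the perturbation formula into an expression in the polynomials `A`, `D`, `B` and the four values of
`κ` and `η₀` on ladders. -/
theorem eval_charpoly_core_add_wedge (hm : m = r + 1 + q) (hr : 1 ≤ r) (hq : q ≤ r)
    (a y z d : ℕ → ℂ) (hκ : κ ∈ negSpan m) {η₀ t x k₁ k₂ w₁ w₂ : ℂ} (htx : t * x = 1)
    (hk₁ : pair m κ (ladder m 0 x (r + 1)) = k₁) (hk₂ : pair m κ (ladder m 0 (-x) (r + 1)) = k₂)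
    (hw₁ : η₀ + pair m κ (ladder m (r + 1) x q) = w₁)
    (hw₂ : η₀ + pair m κ (ladder m (r + 1) (-x) q) = w₂) :
    (core m r q a y d κ + wedge m (vecF m (r + 1))
      (coreVec m q a z η₀ - core m r q a y d κ *ᵥ vecF m (r + 1))).charpoly.eval t =
    t ^ (2 * m + 1) *
      ((-((-1) ^ q * x ^ m * polyB m q y z (-t)) - x * (k₁ * w₂)) *
          (-((-1) ^ q * (-x) ^ m * polyB m q y z t) + x * (k₂ * w₁)) +
        (-(x ^ (2 * r + 1) * polyD m q d t / 2) + x * (k₁ * k₂)) *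
          (x * (w₁ * w₂) - 2 * (x ^ (2 * q + 1) * (t ^ 2 * polyA q a t)))) := by
  have hdet := det_smul_one_sub_core (m := m) (r := r) (q := q) (a := a) (y := y) (d := d) hκ t
  have hA : IsUnit (t • (1 : MatB m) - core m r q a y d κ).det := by
    rw [hdet]
    exact (isUnit_iff_ne_zero.2 (left_ne_zero_of_mul_eq_one htx)).pow _
  have htx' : -t * -x = 1 := by rw [neg_mul_neg, htx]
  have hs0 : 0 ∉ simpleIndices m r := by rw [mem_simpleIndices]; omega
  have hs1 : r + 1 ∉ simpleIndices m r := by rw [mem_simpleIndices]; omega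
  have hP : ∀ t x : ℂ, t * x = 1 → _ := fun t x h => smul_sub_core_mulVec (q := q) (a := a) (y := y)
    (d := d) hκ h (smul_ladder_sub (n := r + 1) hm h hs0 fun i _ _ => by
      rw [mem_simpleIndices]; omega) (pair_vecE_ladder _ _ _) 0
  have hQ : ∀ t x : ℂ, t * x = 1 → _ := fun t x h => smul_sub_core_mulVec (q := q) (a := a) (y := y)
    (d := d) hκ h (smul_ladder_sub (n := q) hm h hs1 fun i _ _ => by
      rw [mem_simpleIndices]; omega) (pair_vecE_ladder _ _ _) η₀
  have hPn := hP _ _ htx'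
  have hQn := hQ _ _ htx'
  replace hP := hP _ _ htx
  replace hQ := hQ _ _ htx
  rw [hk₁, zero_add, zero_add, if_neg r.succ_ne_zero, zero_smul, add_zero] at hP
  rw [hk₂, zero_add, zero_add, if_neg r.succ_ne_zero, zero_smul, add_zero] at hPn
  rw [hw₁, ← hm] at hQ
  rw [hw₂, ← hm] at hQn
  have e1 : ∀ ρ : Vec m, (if q = 0 then 0 else vecF m m) + η₀ • vecE m - ρ =
      coreVec m q a z η₀ - (coreVec' m q a z + ρ) := by
    intro ρ
    rw [coreVec]
    abel
  rw [e1] at hQ hQn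
  have hmem : ∀ (L : Vec m) (c : ℂ), negPart m r q a y d *ᵥ L - c • κ ∈ negSpan m := fun L c =>
    Submodule.sub_mem _ (negPart_mulVec_mem _ _ _ _) (Submodule.smul_mem _ _ hκ)
  have hmem' : ∀ (L : Vec m) (c : ℂ),
      coreVec' m q a z + (negPart m r q a y d *ᵥ L - c • κ) ∈ negSpan m := fun L c =>
    Submodule.add_mem _ (coreVec'_mem _ _ _ _) (hmem L c)
  have hS : core m r q a y d κ ∈ so m := core_mem_so
  have hst := fun w (hw : w ∈ negSpan m) =>
    core_mulVec_mem (r := r) (q := q) (a := a) (y := y) (d := d) hκ hw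
  have hiso : ∀ u ∈ negSpan m, ∀ w ∈ negSpan m, pair m u w = 0 := fun _ hu _ hw =>
    pair_eq_zero_of_mem_negSpan hu hw
  have hE : ∀ u ∈ negSpan m, pair m (vecE m) u = 0 := fun _ => pair_vecE_of_mem_negSpan
  -- The four matrix coefficients of the resolvent.
  have c₁ := pair_resolvent hS hst hiso hA hP (hmem _ _) hQn (hmem' _ _)
  have c₂ := pair_resolvent hS hst hiso hA hQ (hmem' _ _) hPn (hmem _ _)
  have c₃ := pair_resolvent hS hst hiso hA hP (hmem _ _) hPn (hmem _ _)
  have c₄ := pair_resolvent hS hst hiso hA hQ (hmem' _ _) hQn (hmem' _ _)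
  rw [pair_coreVec_add, pair_coreVec'_ladder hm hq] at c₁
  rw [pair_coreVec_add] at c₄
  have hF : ∀ (lo n : ℕ) (x c : ℂ),
      pair m (vecF m (r + 1)) (ladder m lo x n + c • vecE m) = 0 := by
    intro lo n x c
    rw [map_add, map_smul, pair_vecF_ladder, pair_vecF_vecE, smul_zero, add_zero]
  rw [hF, zero_sub] at c₂ c₃
  have hadd : ∀ (L u : Vec m) (c : ℂ), u ∈ negSpan m →
      pair m (L + c • vecE m) u = pair m L u := by
    intro L u c hu
    rw [map_add, LinearMap.add_apply, map_smul, LinearMap.smul_apply, hE u hu, smul_zero, add_zero]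
  rw [hadd _ _ _ (hmem _ _), map_sub, map_smul, smul_eq_mul, pair_comm _ κ,
    pair_ladder_negPart_mixed hm] at c₁
  rw [hadd _ _ _ (hmem' _ _), map_add, map_sub, map_smul, smul_eq_mul, pair_comm _ κ, hk₂,
    pair_comm _ (coreVec' m q a z), pair_coreVec'_ladder hm hq] at c₂
  rw [hadd _ _ _ (hmem _ _), map_sub, map_smul, smul_eq_mul, pair_comm _ κ, hk₂,
    pair_ladder_negPart_first hm, sum_eq_polyD hm d htx] at c₃
  rw [hadd _ _ _ (hmem' _ _), ← add_sub_assoc, map_sub, map_smul, smul_eq_mul, pair_comm _ κ] at c₄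
  have c₂' : pair m (ladder m 0 (-x) (r + 1)) (negPart m r q a y d *ᵥ ladder m (r + 1) x q) =
      ∑ i ∈ Finset.Icc 1 q, y i * ((-x) ^ (r + 1) * x ^ (q + 1 - i)) := by
    have h1 := pair_mulVec_left (negPart_mem_so (r := r) (q := q) (a := a) (y := y) (d := d))
      (ladder m 0 (-x) (r + 1)) (ladder m (r + 1) x q)
    rw [pair_comm, pair_ladder_negPart_mixed hm] at h1
    exact (neg_inj.1 h1).symm
  rw [c₂'] at c₂
  have s₁ := one_sub_eq_polyB hm hq y z htx
  have s₂ := one_sub_eq_polyB hm hq y z htx'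
  have s₃ := sum_eq_polyA q a htx
  have s₄ := pair_ladder_negPart_second hm hq a y z d x
  rw [neg_neg, neg_neg] at s₂
  have b₁ : 1 - pair m (coreVec m q a z η₀)
      ((t • (1 : MatB m) - core m r q a y d κ)⁻¹ *ᵥ vecF m (r + 1)) =
      -((-1) ^ q * x ^ m * polyB m q y z (-t)) - x * (k₁ * w₂) := by
    rw [c₁, ← s₁]
    linear_combination (-x * k₁) * hw₂
  have b₂ : 1 + pair m (vecF m (r + 1))
      ((t • (1 : MatB m) - core m r q a y d κ)⁻¹ *ᵥ coreVec m q a z η₀) =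
      -((-1) ^ q * (-x) ^ m * polyB m q y z t) + x * (k₂ * w₁) := by
    rw [c₂, ← s₂]
    ring
  have b₃ : pair m (vecF m (r + 1))
      ((t • (1 : MatB m) - core m r q a y d κ)⁻¹ *ᵥ vecF m (r + 1)) =
      -(x ^ (2 * r + 1) * polyD m q d t / 2) + x * (k₁ * k₂) := by
    rw [c₃]
    ring
  have b₄ : pair m (coreVec m q a z η₀)
      ((t • (1 : MatB m) - core m r q a y d κ)⁻¹ *ᵥ coreVec m q a z η₀) - 2 * t =
      x * (w₁ * w₂) - 2 * (x ^ (2 * q + 1) * (t ^ 2 * polyA q a t)) := by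
    rw [c₄]
    linear_combination s₄ - 2 * s₃ + x * w₁ * hw₂
  rw [eval_charpoly_add_wedge hS (pair_vecF_vecF m _ _) _ hA, hdet, b₁, b₂, b₃, b₄]

end formula

section final

variable {m r q : ℕ}

theorem sqrt_two_sq : (Real.sqrt 2 : ℂ) * (Real.sqrt 2 : ℂ) = 2 := by
  rw [← Complex.ofReal_mul, Real.mul_self_sqrt (by norm_num)]
  simp

theorem div_sqrt_two (c : ℂ) : c / (Real.sqrt 2 : ℂ) = c * (Real.sqrt 2 : ℂ) / 2 := by
  have h2 : (Real.sqrt 2 : ℂ) ≠ 0 := by simp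
  rw [div_eq_div_iff h2 two_ne_zero, mul_assoc, sqrt_two_sq]

theorem charpolyFormula_shortRoot (hm : m = r + 1 + q) (hr : 1 ≤ r) (hq : q ≤ r) :
    CharpolyFormula m (q + 1) (shortRoot m (q + 1)) := by
  intro a y z d a₀ d₀ t ht
  rw [Nat.add_sub_cancel]
  obtain ⟨x, htx⟩ : ∃ x, t * x = 1 := ⟨t⁻¹, mul_inv_cancel₀ ht⟩
  set s : ℂ := (Real.sqrt 2 : ℂ) with hs
  have hss : s * s = 2 := sqrt_two_sq
  -- For `q = 0` the coordinate `a₀` sits at `φ ∧ e`, for `q ≠ 0` at `e ∧ f'_{r+2}`.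
  obtain ⟨κ, η₀, hκ, hV, hk, hw⟩ : ∃ (κ : Vec m) (η₀ : ℂ), κ ∈ negSpan m ∧
      vecV (shortRoot m (q + 1)) a₀ d₀ = wedge m (vecE m) κ +
        (η₀ - pair m κ (vecF m (r + 1))) • wedge m (vecF m (r + 1)) (vecE m) ∧
      (∀ x, pair m κ (ladder m 0 x (r + 1)) = -(d₀ * s / 2) * x ^ (r + 1)) ∧
      (∀ x, η₀ + pair m κ (ladder m (r + 1) x q) = s * a₀ * x ^ q) := by
    have h1 : ∀ x, pair m (vecF' m 1) (ladder m 0 x (r + 1)) = x ^ (r + 1) := fun x => by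
      rw [pair_vecF'_ladder (by omega), if_pos (by omega)]
      congr 1
      omega
    have h2 : ∀ x, pair m (vecF' m 1) (ladder m (r + 1) x q) = 0 := fun x => by
      rw [pair_vecF'_ladder (by omega), if_neg (by omega)]
    have h3 : pair m (vecF' m 1) (vecF m (r + 1)) = 0 := by
      rw [pair_vecF'_vecF, if_neg (by omega)]
    have h4 := Submodule.smul_mem _ (-(d₀ * s / 2)) (vecF'_mem_negSpan m 1)
    rcases Nat.eq_zero_or_pos q with h0 | h0
    · refine ⟨-(d₀ * s / 2) • vecF' m 1, s * a₀, h4, ?_, fun x => ?_, fun x => ?_⟩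
      · rw [vecV, div_sqrt_two, shortRoot_eq hm, gen₂, if_pos h0, rootM_eq, ← hs, map_neg,
          wedge_swap (vecE m) (vecF m _), map_smul, map_smul, LinearMap.smul_apply, h3]
        module
      · rw [map_smul, LinearMap.smul_apply, h1, smul_eq_mul]
      · rw [map_smul, LinearMap.smul_apply, h2, h0]
        simp
    · refine ⟨-(d₀ * s / 2) • vecF' m 1 + (s * a₀) • vecF' m (r + 2), 0,
        Submodule.add_mem _ h4 (Submodule.smul_mem _ _ (vecF'_mem_negSpan _ _)), ?_, fun x => ?_,
        fun x => ?_⟩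
      · have h5 : pair m (vecF' m (r + 2)) (vecF m (r + 1)) = 0 := by
          rw [pair_vecF'_vecF, if_neg (by omega)]
        rw [vecV, div_sqrt_two, shortRoot_eq hm, gen₂, if_neg h0.ne', rootM_eq, ← hs]
        simp only [map_add, map_smul, LinearMap.add_apply, LinearMap.smul_apply, h3, h5]
        module
      · simp only [map_add, map_smul, LinearMap.add_apply, LinearMap.smul_apply, h1, smul_eq_mul]
        rw [pair_vecF'_ladder (by omega), if_neg (by omega), mul_zero, add_zero]
      · simp only [map_add, map_smul, LinearMap.add_apply, LinearMap.smul_apply, h2, smul_eq_mul]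
        rw [pair_vecF'_ladder (by omega), if_pos (by omega),
          show r + 1 + q + 1 - (r + 2) = q by omega]
        ring
  rw [incl_eltD_add_vecV_eq_core hm hr hV, eval_charpoly_core_add_wedge hm hr hq a y z d hκ htx
    (hk x) (hk (-x)) (hw x) (hw (-x))]
  have hx : x = 1 / t := by field_simp; linear_combination htx
  have b₁ : -((-1) ^ q * x ^ m * polyB m q y z (-t)) -
      x * (-(d₀ * s / 2) * x ^ (r + 1) * (s * a₀ * (-x) ^ q)) =
      -((-1) ^ q * x ^ m * fb m (q + 1) a₀ d₀ y z (-t)) := by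
    rw [fb, Nat.add_sub_cancel, show a₀ * d₀ / -t = -(a₀ * d₀ * x) by rw [hx]; field_simp, hm,
      neg_pow x, pow_add]
    linear_combination (x * d₀ * x ^ (r + 1) * a₀ * (-1) ^ q * x ^ q / 2) * hss
  have hpow : ∀ k : ℕ, (-1 : ℂ) ^ k * (-1) ^ k = 1 := fun k => by rw [← mul_pow]; simp
  have b₂ : -((-1) ^ q * (-x) ^ m * polyB m q y z t) +
      x * (-(d₀ * s / 2) * (-x) ^ (r + 1) * (s * a₀ * x ^ q)) =
      -((-1) ^ q * (-x) ^ m * fb m (q + 1) a₀ d₀ y z t) := by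
    rw [fb, Nat.add_sub_cancel, show a₀ * d₀ / t = a₀ * d₀ * x by rw [hx]; field_simp, hm,
      pow_add, neg_pow x q]
    linear_combination (-(x * d₀ * (-x) ^ (r + 1) * a₀ * x ^ q) / 2) * hss +
      (x * d₀ * (-x) ^ (r + 1) * a₀ * x ^ q) * hpow q
  have b₃ : -(x ^ (2 * r + 1) * polyD m q d t / 2) +
      x * (-(d₀ * s / 2) * x ^ (r + 1) * (-(d₀ * s / 2) * (-x) ^ (r + 1))) =
      -(x ^ (2 * r + 1) * fd m (q + 1) d₀ d t / 2) := by
    rw [fd, Nat.add_sub_cancel, show m - (q + 1) = r by omega,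
      show (-1) ^ r * d₀ ^ 2 / t ^ 2 = (-1) ^ r * d₀ ^ 2 * x ^ 2 by rw [hx]; field_simp,
      neg_pow x (r + 1)]
    linear_combination (x * d₀ ^ 2 * x ^ (r + 1) * (-1) ^ (r + 1) * x ^ (r + 1) / 4) * hss
  have b₄ : x * (s * a₀ * x ^ q * (s * a₀ * (-x) ^ q)) -
      2 * (x ^ (2 * q + 1) * (t ^ 2 * polyA q a t)) =
      -(2 * (x ^ (2 * q + 1) * fa (q + 1) a₀ a t)) := by
    rw [fa, Nat.add_sub_cancel, neg_pow x q]
    linear_combination (x * a₀ ^ 2 * x ^ q * (-1) ^ q * x ^ q) * hss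
  rw [b₁, b₂, b₃, b₄]
  have h1 := pow_mul_pow_of_mul_eq_one htx 0 (2 * m)
  rw [zero_add, pow_zero] at h1
  have h2 : x ^ (2 * r + 1) * x ^ (2 * q + 1) = x ^ (2 * m) := by
    rw [← pow_add]
    congr 1
    omega
  generalize fa (q + 1) a₀ a t = α
  generalize fd m (q + 1) d₀ d t = δ
  generalize fb m (q + 1) a₀ d₀ y z t = β
  generalize fb m (q + 1) a₀ d₀ y z (-t) = β'
  rw [neg_pow x m]
  linear_combination (t ^ (2 * m + 1) * α * δ) * h2 + (t * α * δ + t * β * β' * (-1) ^ m) * h1 +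
    (t ^ (2 * m + 1) * x ^ (2 * m) * (-1) ^ m * β * β') * hpow q

/-- For the other choice of the short root vector with `n = 1`, the four coefficients of the
resolvent are not individually `a`, `b`, `d` up to powers of `t`: the coordinates `a₀` and `d₀` both occur in
the values of `κ` on the ladder. The extra terms cancel in the total when `m` is odd. -/
theorem charpolyFormula_rootM (hm : m = r + 1) (hr : 1 ≤ r) (ho : Odd m) :
    CharpolyFormula m 1 (-rootM m m) := by
  intro a y z d a₀ d₀ t ht
  have hm' : m = r + 1 + 0 := hm
  obtain ⟨x, htx⟩ : ∃ x, t * x = 1 := ⟨t⁻¹, mul_inv_cancel₀ ht⟩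
  set s : ℂ := (Real.sqrt 2 : ℂ) with hs
  have hss : s * s = 2 := sqrt_two_sq
  set κ : Vec m := -(d₀ * s / 2) • vecF' m 1 - (s * a₀) • vecF' m m with hκ_def
  have hκ : κ ∈ negSpan m := Submodule.sub_mem _
    (Submodule.smul_mem _ _ (vecF'_mem_negSpan _ _))
    (Submodule.smul_mem _ _ (vecF'_mem_negSpan _ _))
  have hφ : pair m κ (vecF m (r + 1)) = -(s * a₀) := by
    rw [hκ_def]
    simp only [map_sub, map_smul, LinearMap.sub_apply, LinearMap.smul_apply, pair_vecF'_vecF]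
    rw [if_neg (by omega), if_pos (by omega)]
    simp
  have hV : vecV (-rootM m m) a₀ d₀ = wedge m (vecE m) κ +
      (-(s * a₀) - pair m κ (vecF m (r + 1))) • wedge m (vecF m (r + 1)) (vecE m) := by
    rw [hφ, hκ_def, vecV, div_sqrt_two, rootM_eq, rootM_eq, ← hs]
    simp only [map_sub, map_smul]
    module
  have hk : ∀ x, pair m κ (ladder m 0 x (r + 1)) = -(d₀ * s / 2) * x ^ m - s * a₀ * x := by
    intro x
    rw [hκ_def]
    simp only [map_sub, map_smul, LinearMap.sub_apply, LinearMap.smul_apply, smul_eq_mul]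
    rw [pair_vecF'_ladder (by omega), if_pos (by omega), pair_vecF'_ladder (by omega),
      if_pos (by omega), show 0 + (r + 1) + 1 - 1 = m by omega,
      show 0 + (r + 1) + 1 - m = 1 by omega, pow_one]
  have hw : ∀ x, -(s * a₀) + pair m κ (ladder m (r + 1) x 0) = -(s * a₀) := by
    intro x
    rw [ladder, map_zero, add_zero]
  rw [Nat.sub_self, incl_eltD_add_vecV_eq_core hm' hr hV, eval_charpoly_core_add_wedge hm' hr
    (Nat.zero_le r) a y z d hκ htx (hk x) (hk (-x)) (hw x) (hw (-x))]
  have hB : ∀ t : ℂ, polyB m 0 y z t = -(z 1 + -1 * t ^ m) := by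
    intro t
    simp [polyB, ho.neg_one_pow]
  have hA : polyA 0 a t = 1 := by simp [polyA]
  have hn : (-1 : ℂ) ^ (m - 1) = 1 := by
    obtain ⟨k, hk⟩ := ho
    rw [hk, Nat.add_sub_cancel, pow_mul]
    simp
  have hD : x ^ (2 * r + 1) = t * (x ^ m * x ^ m) := by
    rw [← pow_add, show m + m = 2 * r + 1 + 1 by omega, pow_succ]
    linear_combination (-x ^ (2 * r + 1)) * htx
  have hX : x ^ m * t ^ m = 1 := by
    have := pow_mul_pow_of_mul_eq_one htx 0 m
    rwa [zero_add, pow_zero] at this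
  have hT : t ^ (2 * m + 1) = t * (t ^ m * t ^ m) := by ring
  rw [fa, fd, fb, fb, Nat.sub_self, hB, hB, hA, hn, hD, hT, ho.neg_one_pow, ho.neg_pow, ho.neg_pow]
  have hx : x = 1 / t := by field_simp; linear_combination htx
  have hX' : x ^ m = 1 / t ^ m := by
    rw [eq_div_iff (pow_ne_zero _ ht), hX]
  rw [hX']
  have hT0 : t ^ m ≠ 0 := pow_ne_zero _ ht
  generalize t ^ m = T at *
  generalize polyD m 0 d t = D
  subst hx
  have hs2 : s ^ 2 = 2 := by rw [sq, hss]
  field_simp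
  ring_nf
  simp only [hs2]
  field_simp
  ring

end final

end SliceB

end

theorem mainTheorem6 (m n : ℕ) (hm : 2 ≤ m) (hn : 1 ≤ n) (hmn : 2 * n - 1 ≤ m) :
    SliceB.HasJordanType (SliceB.nilB m n) [2 * (m - n) + 1, 2 * n - 1, 1] ∧
    SliceB.IsTransverseSlice m (SliceB.sliceB m n (SliceB.shortRoot m n)) (SliceB.nilB m n) ∧
    SliceB.IsLambdaInvariant m (SliceB.sliceB m n (SliceB.shortRoot m n)) (SliceB.nilB m n) ∧
    SliceB.CharpolyFormula m n (SliceB.shortRoot m n) ∧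
    (n = 1 →
      SliceB.IsTransverseSlice m (SliceB.sliceB m 1 (-SliceB.rootM m m)) (SliceB.nilB m 1) ∧
      SliceB.IsLambdaInvariant m (SliceB.sliceB m 1 (-SliceB.rootM m m)) (SliceB.nilB m 1) ∧
      (Odd m → SliceB.CharpolyFormula m 1 (-SliceB.rootM m m))) := by
  obtain ⟨q, rfl⟩ : ∃ q, n = q + 1 := ⟨n - 1, by omega⟩
  obtain ⟨r, hr⟩ : ∃ r, m = r + 1 + q := ⟨m - (q + 1), by omega⟩
  have h1 : 1 ≤ r := by omega
  have h2 : q ≤ r := by omega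
  have hJ := SliceB.nil_chainFrame hr h1 h2
  refine ⟨?_, SliceB.isTransverseSlice_shortRoot hr h1 h2,
    SliceB.isLambdaInvariant_of_weight hr h1 h2 (SliceB.shortRoot_eq hr)
      (SliceB.gradingElt_mulVec_gen₂ hr), SliceB.charpolyFormula_shortRoot hr h1 h2, fun h => ?_⟩
  · have h3 : (![2 * r + 1, 2 * q + 1, 1] : Fin 3 → ℕ) =
        [2 * (m - (q + 1)) + 1, 2 * (q + 1) - 1, 1].get := by
      funext i
      fin_cases i
      · change 2 * r + 1 = 2 * (m - (q + 1)) + 1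
        omega
      · rfl
      · rfl
    rw [h3] at hJ
    exact hJ.hasJordanType
  · obtain rfl : q = 0 := by omega
    refine ⟨SliceB.isTransverseSlice_rootM hr h1, ?_, SliceB.charpolyFormula_rootM hr h1⟩
    refine SliceB.isLambdaInvariant_of_weight hr h1 h2 (ρ := -SliceB.vecF' m m)
      (α := -SliceB.weight m r m) ?_ ?_
    · rw [SliceB.rootM_eq, map_neg]
    · rw [Matrix.mulVec_neg, SliceB.gradingElt_mulVec_vecF', smul_neg]
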